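/- Setting. Let $d\ge 2$, let $\mathcal F$ be a measurable space with a semi-metric (pseudo-metric) $\rho$, let $x\in\mathcal F$ be such that $\rho(x,\cdot)$ is measurable, and let $(X_i,Y_i)_{i\ge 1}$ be i.i.d. copies of a pair $(X,Y)$ with values in $\mathcal F\times\mathbb R^d$ and $\mathbb E\|Y\|<\infty$. Fix a regular conditional distribution of $Y$ given $X$; all expectations $\mathbb E[\,\cdot\mid X=x']$ are taken under it. Put $\mathcal U(y)=y/\|y\|$ for $y\ne0$, $\mathcal U(0)=0$; $\mathcal M(y,u)=\|y-u\|^{-1}\big(I_d-\mathcal U(y-u)\mathcal U(y-u)^t\big)$ for $y\neq u$, $\mathcal M(u,u)=0$; $G^{x'}(u)=\mathbb E[\|Y-u\|\mid X=x']$; $G^{x'}_\ell(u)=\mathbb E[\|Y-u\|^\ell\mid X=x']$; $H^{x'}(u)=\mathbb E[\mathcal M(Y,u)\mid X=x']$; $F_x(r)=\mathbb P(\rho(x,X)\le r)$. Let $\mu=\mu(x)$ be a conditional $L_1$-median, i.e. a minimizer of $u\mapsto\mathbb E[\|Y-u\|-\|Y\|\mid X=x]$, and suppose that the conditional law of $Y$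 given $X=x$ is not carried by any hyperplane through $\mu$ (as is the case when it is absolutely continuous). Let $K\colon\mathbb R\to\mathbb R$ and let $h=h_n>0$, $h_n\to0$. Put $\Delta_i=K(\rho(x,X_i)/h)$ and $w_{n,i}=\Delta_i/\sum_{j\le n}\Delta_j$ ($0$ if the denominator vanishes), and let $\mu_n=\mu_n(x)$ be a measurable, almost sure minimizer of $u\mapsto\sum_{i\le n}w_{n,i}\|Y_i-u\|$. Assumptions. (H1) $K$ is nonnegative, bounded, vanishes outside $[0,1]$, is $C^1$ on $[0,1]$ with $K'<0$ there, $K(1)>0$, and $K'$, $(K^2)'$ are integrable on $[0,1]$. (H2) There are a bounded nonnegative function $g$ on $\mathcal F$ with $g(x)>0$, and $\phi\ge0$ with $\phi(r)\to0$ as $r\downarrow0$, such that $F_x(r)=\phi(r)g(x)+o(\phi(r))$ as $r\downarrow0$; and a nondecreasing bounded $\tau_0$ on $[0,1]$ with $\phi(rs)/\phi(r)\to\tau_0(s)$ as $r\downarrow 0$, uniformly in $s\in[0,1]$, and with $(K^j)'\tau_0$ integrable on $[0,1]$ for all integers $j\ge1$. (H3) (i) For some $\beta>0$, $c>0$ and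 all $x'$ in a neighbourhood of $x$, $|G^x(u)-G^{x'}(u)|\le c\,\rho(x,x')^\beta$ for all $u\in\mathbb R^d$. (ii) $x'\mapsto H^{x'}(\mu)$ is continuous at $x$. (iii) For some integer $m\ge2$, $G^x_{-m}(\mu)<\infty$ and $x'\mapsto G^{x'}_{-m}(\mu)\in[0,\infty]$ is continuous at $x$. (iv) For some integer $m\ge1$ and all $1\le k,j\le d$, $\mathcal M_{k,j}(Y,\mu)^m$ is conditionally integrable given $X=x'$ for $x'$ near $x$, and $x'\mapsto\mathbb E[\mathcal M_{k,j}(Y,\mu)^m\mid X=x']$ is continuous at $x$. (H4) (i) For some integer $m\ge1$ and every $R\ge0$: $\sup_{\|u\|\le R}G^{x'}_m(u)<\infty$ for every $x'\in\mathcal F$, and $\sup_{\|u\|\le R}|G_m^{x'}(u)-G_m^x(u)|\to0$ as $\rho(x,x')\to0$. (ii) For some $\delta>0$ and every $\ell\in\mathbb R^d$, $x'\mapsto\mathbb E\big[|\ell^t\mathcal U(Y-\mu)|^{i+j\delta}\mid X=x'\big]$ is continuous at $x$ for $i=1,2$, $j=0,1$. (H5) There is a differentiable $\psi\colon\mathbb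 R\to\mathbb R^d$ with $\psi'(0)\neq0$ and $\mathbb E[\mathcal U(Y-\mu)\mid\rho(x,X)]=\psi(\rho(x,X))$ almost surely. (Bandwidth) As $n\to\infty$: $\dfrac{\log n}{n\phi(h)}\to0$; $(n\phi(h))^{\delta/2}\to\infty$ for some $\delta>0$; $\sqrt{n\phi(h)}\,h\to0$; $nF_x(h)\to\infty$; and $h^\beta(nF_x(h))^{1/2}\to0$ with $\beta$ as in (H3)(i). Estimators. $F_{x,n}(r)=\frac1n\sum_{i\le n}\mathbf 1_{\{\rho(x,X_i)\le r\}}$, $\ \tau_n(s)=F_{x,n}(sh)/F_{x,n}(h)$, $\ M_{j,n}=K^j(1)-\int_0^1(K^j)'(s)\,\tau_n(s)\,ds$ for $j=1,2$, $\ \Sigma_n=\sum_{i\le n}w_{n,i}\,\mathcal U(Y_i-\mu_n)\mathcal U(Y_i-\mu_n)^t$, $\ H_n=\sum_{i\le n}w_{n,i}\,\mathcal M(Y_i,\mu_n)$. Inverses of singular matrices and quotients by $0$ are given the value $0$. Conclusion. Under these assumptions $$\frac{M_{1,n}}{\sqrt{M_{2,n}}}\sqrt{nF_{x,n}(h)}\;\Sigma_n^{-1/2}H_n\,(\mu_n(x)-\mu(x))\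 \xrightarrow{\ \mathcal D\ }\ \mathcal N(0,I_d).$$ Moreover, with $\Gamma_n^{-1}=\frac{M_{1,n}^2\,nF_{x,n}(h)}{M_{2,n}}H_n\Sigma_n^{-1}H_n$, $$(\mu_n(x)-\mu(x))^t\,\Gamma_n^{-1}(\mu_n(x)-\mu(x))\ \xrightarrow{\ \mathcal D\ }\ \chi^2_d,$$ and for every $\alpha\in(0,1)$, if $q$ is the $(1-\alpha)$-quantile of $\chi^2_d$, then $\mathbb P\big((\mu_n(x)-\mu(x))^t\,\Gamma_n^{-1}(\mu_n(x)-\mu(x))\le q\big)\to1-\alpha$. -/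

import Mathlib

open MeasureTheory ProbabilityTheory Filter Topology Set
open scoped ENNReal MatrixOrder

noncomputable section

/-- Euclidean `d`-space. -/
abbrev Vec (d : ℕ) := EuclideanSpace ℝ (Fin d)

/-! ### The spatial sign, the Hessian kernel and conditional moments -/

section Spatial
variable {d : ℕ}

/-- The spatial sign `U(y) = y / ‖y‖`, with `U(0) = 0`. -/
def spatialSign (y : Vec d) : Vec d := ‖y‖⁻¹ • y

/-- The matrix `U(y) U(y)ᵗ`. -/
def signOuter (y : Vec d) : Matrix (Fin d) (Fin d) ℝ :=
  Matrix.of fun k j => spatialSign y k * spatialSign y j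

/-- `M(y, u) = ‖y - u‖⁻¹ (I - U(y - u) U(y - u)ᵗ)` for `y ≠ u`; the value at `y = u` is `0`. -/
def hessKernel (y u : Vec d) : Matrix (Fin d) (Fin d) ℝ :=
  ‖y - u‖⁻¹ • (1 - signOuter (y - u))

variable {F : Type*} [MeasurableSpace F]

/-- `G^{x'}(u) = E[‖Y - u‖ | X = x']`, where `κ` is the conditional law of `Y` given `X`. -/
def condDist (κ : Kernel F (Vec d)) (x' : F) (u : Vec d) : ℝ := ∫ y, ‖y - u‖ ∂κ x'

/-- `E[‖Y - u‖ ^ ℓ | X = x']` for a real exponent `ℓ`, as an element of `[0, ∞]`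
(for `ℓ < 0` it is infinite as soon as `u` is an atom). -/
def condMoment (κ : Kernel F (Vec d)) (ℓ : ℝ) (x' : F) (u : Vec d) : ℝ≥0∞ :=
  ∫⁻ y, ‖y - u‖ₑ ^ ℓ ∂κ x'

/-- The conditional Hessian `H^{x'}(u) = E[M(Y, u) | X = x']`. -/
def condHess (κ : Kernel F (Vec d)) (x' : F) (u : Vec d) : Matrix (Fin d) (Fin d) ℝ :=
  Matrix.of fun k j => ∫ y, hessKernel y u k j ∂κ x'

/-- `m` is a conditional `L₁`-median of `Y` given `X = x`: it minimizes
`u ↦ E[‖Y - u‖ - ‖Y‖ | X = x]`. -/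
def IsCondMedian (κ : Kernel F (Vec d)) (x : F) (m : Vec d) : Prop :=
  IsMinOn (fun u => ∫ y, (‖y - u‖ - ‖y‖) ∂κ x) univ m

end Spatial

/-! ### Constants and estimators -/

/-- `M_j(τ) = K^j(1) - ∫₀¹ (K^j)'(s) τ(s) ds`. -/
def kernelConst (K τ : ℝ → ℝ) (j : ℕ) : ℝ :=
  K 1 ^ j - ∫ s in (0 : ℝ)..1, derivWithin (fun t => K t ^ j) (Icc 0 1) s * τ s

/-- The small ball probability `P(d(x, X) ≤ r)`. -/
def smallBall {Ω F : Type*} [MeasurableSpace Ω] [PseudoMetricSpace F]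
    (P : Measure Ω) (X : Ω → F) (x : F) (r : ℝ) : ℝ :=
  P.real {ω | dist x (X ω) ≤ r}

section Estimators
variable {d : ℕ} {F : Type*} [PseudoMetricSpace F]

/-- Nadaraya--Watson weight of the `i`-th observation among `xs 0, …, xs (n - 1)`. -/
def nwWeight (K : ℝ → ℝ) (x : F) (h : ℝ) (xs : ℕ → F) (n i : ℕ) : ℝ :=
  K (dist x (xs i) / h) / ∑ j ∈ Finset.range n, K (dist x (xs j) / h)

/-- The kernel estimator `G_n^x(u)` of the conditional objective function. -/
def objectiveEst (K : ℝ → ℝ) (x : F) (h : ℝ) (xs : ℕ → F) (ys : ℕ → Vec d) (n : ℕ)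
    (u : Vec d) : ℝ :=
  ∑ i ∈ Finset.range n, nwWeight K x h xs n i * ‖ys i - u‖

/-- The empirical small ball probability `F_{x,n}(r)`. -/
def smallBallEst (x : F) (xs : ℕ → F) (n : ℕ) (r : ℝ) : ℝ :=
  (1 / (n : ℝ)) * ∑ i ∈ Finset.range n, if dist x (xs i) ≤ r then (1 : ℝ) else 0

/-- `τ_n(s) = F_{x,n}(s h) / F_{x,n}(h)`. -/
def tauEst (x : F) (h : ℝ) (xs : ℕ → F) (n : ℕ) (s : ℝ) : ℝ :=
  smallBallEst x xs n (s * h) / smallBallEst x xs n h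

/-- `M_{j,n}`: the constant `M_j` with `τ_n` plugged in. -/
def kernelConstEst (K : ℝ → ℝ) (x : F) (h : ℝ) (xs : ℕ → F) (n j : ℕ) : ℝ :=
  kernelConst K (tauEst x h xs n) j

/-- `Σ_n^x(u) = ∑ᵢ w_{n,i}(x) U(Yᵢ - u) U(Yᵢ - u)ᵗ`. -/
def sigmaEst (K : ℝ → ℝ) (x : F) (h : ℝ) (xs : ℕ → F) (ys : ℕ → Vec d) (n : ℕ)
    (u : Vec d) : Matrix (Fin d) (Fin d) ℝ :=
  ∑ i ∈ Finset.range n, nwWeight K x h xs n i • signOuter (ys i - u)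

/-- `H_n^x(u) = ∑ᵢ w_{n,i}(x) M(Yᵢ, u)`. -/
def hessEst (K : ℝ → ℝ) (x : F) (h : ℝ) (xs : ℕ → F) (ys : ℕ → Vec d) (n : ℕ)
    (u : Vec d) : Matrix (Fin d) (Fin d) ℝ :=
  ∑ i ∈ Finset.range n, nwWeight K x h xs n i • hessKernel (ys i) u

/-- The normalized estimation error
`(M_{1,n} / √M_{2,n}) √(n F_{x,n}(h)) Σ_n(v)^{-1/2} H_n(v) (v - m)`,
to be used with `v` the estimate and `m` the true median. -/
def pluginStat (K : ℝ → ℝ) (x : F) (h : ℝ) (xs : ℕ → F) (ys : ℕ → Vec d) (n : ℕ)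
    (m v : Vec d) : Vec d :=
  (kernelConstEst K x h xs n 1 / √(kernelConstEst K x h xs n 2)
      * √((n : ℝ) * smallBallEst x xs n h)) •
    Matrix.toEuclideanCLM (𝕜 := ℝ)
      ((CFC.sqrt (sigmaEst K x h xs ys n v))⁻¹ * hessEst K x h xs ys n v) (v - m)

/-- The inverse of the estimated covariance,
`Γ_n(v)⁻¹ = (M_{1,n}² n F_{x,n}(h) / M_{2,n}) H_n(v) Σ_n(v)⁻¹ H_n(v)`. -/
def gammaInvEst (K : ℝ → ℝ) (x : F) (h : ℝ) (xs : ℕ → F) (ys : ℕ → Vec d) (n : ℕ)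
    (v : Vec d) : Matrix (Fin d) (Fin d) ℝ :=
  (kernelConstEst K x h xs n 1 ^ 2 * ((n : ℝ) * smallBallEst x xs n h)
      / kernelConstEst K x h xs n 2) •
    (hessEst K x h xs ys n v * (sigmaEst K x h xs ys n v)⁻¹ * hessEst K x h xs ys n v)

/-- The quadratic form `(v - m)ᵗ Γ_n(v)⁻¹ (v - m)`. -/
def ellipsoidStat (K : ℝ → ℝ) (x : F) (h : ℝ) (xs : ℕ → F) (ys : ℕ → Vec d) (n : ℕ)
    (m v : Vec d) : ℝ :=
  inner ℝ (v - m) (Matrix.toEuclideanCLM (𝕜 := ℝ) (gammaInvEst K x h xs ys n v) (v - m))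

end Estimators

/-- The `χ²` law with `d` degrees of freedom: the law of `‖Z‖² = Z₁² + ⋯ + Z_d²` for a standard
Gaussian vector `Z`. -/
def chiSquaredLaw (d : ℕ) : Measure ℝ := (stdGaussian (Vec d)).map fun z => ‖z‖ ^ 2

instance (d : ℕ) : IsProbabilityMeasure (chiSquaredLaw d) :=
  Measure.isProbabilityMeasure_map (by fun_prop)

/-! ### The assumptions -/

/-- Assumptions on the kernel: nonnegative, bounded, supported in `[0, 1]`, continuously
differentiable with negative derivative on `[0, 1]`, positive at `1`, with `K'` and `(K²)'`
integrable. -/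
structure KernelAssumption (K : ℝ → ℝ) : Prop where
  nonneg : ∀ t, 0 ≤ K t
  bounded : ∃ C, ∀ t, K t ≤ C
  support : ∀ t, t ∉ Icc (0 : ℝ) 1 → K t = 0
  contDiff : ContDiffOn ℝ 1 K (Icc 0 1)
  one_pos : 0 < K 1
  deriv_neg : ∀ t ∈ Icc (0 : ℝ) 1, derivWithin K (Icc 0 1) t < 0
  integrable₁ : IntegrableOn (derivWithin K (Icc 0 1)) (Icc 0 1)
  integrable₂ : IntegrableOn (derivWithin (fun t => K t ^ 2) (Icc 0 1)) (Icc 0 1)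

/-- Small ball assumptions at `x`: `Fx` is the small ball probability `h ↦ P(d(x, X) ≤ h)`. -/
structure SmallBallAssumption {F : Type*} (K : ℝ → ℝ) (Fx : ℝ → ℝ) (g : F → ℝ) (x : F)
    (φ τ₀ : ℝ → ℝ) : Prop where
  g_nonneg : ∀ x', 0 ≤ g x'
  g_bounded : ∃ C, ∀ x', g x' ≤ C
  phi_nonneg : ∀ r, 0 ≤ φ r
  phi_tendsto : Tendsto φ (𝓝[>] 0) (𝓝 0)
  smallBall_eq : (fun r => Fx r - φ r * g x) =o[𝓝[>] 0] φ
  tau_monotone : MonotoneOn τ₀ (Icc 0 1)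
  tau_bounded : ∃ C, ∀ s ∈ Icc (0 : ℝ) 1, |τ₀ s| ≤ C
  ratio : TendstoUniformlyOn (fun r s => φ (r * s) / φ r) τ₀ (𝓝[>] 0) (Icc 0 1)
  integrable : ∀ j : ℕ, 1 ≤ j →
    IntegrableOn (fun t => derivWithin (fun t => K t ^ j) (Icc 0 1) t * τ₀ t) (Icc 0 1)

/-- Smoothness in `x'` of the conditional objective function, of the Hessian and of inverse
moments; `μ` is the conditional median at `x`. -/
structure SmoothnessAssumption {d : ℕ} {F : Type*} [PseudoMetricSpace F] [MeasurableSpace F]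
    (κ : Kernel F (Vec d)) (x : F) (μ : Vec d) (β : ℝ) : Prop where
  holder : 0 < β ∧ ∃ c > 0, ∀ᶠ x' in 𝓝 x, ∀ u,
    |condDist κ x u - condDist κ x' u| ≤ c * dist x x' ^ β
  hess : ContinuousAt (fun x' => condHess κ x' μ) x
  invMoment : ∃ m : ℕ, 2 ≤ m ∧ condMoment κ (-m) x μ < ∞ ∧
    ContinuousAt (fun x' => condMoment κ (-m) x' μ) x
  hessMoment : ∃ m : ℕ, 1 ≤ m ∧ ∀ k j,
    (∀ᶠ x' in 𝓝 x, Integrable (fun y => hessKernel y μ k j ^ m) (κ x')) ∧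
    ContinuousAt (fun x' => ∫ y, hessKernel y μ k j ^ m ∂κ x') x

/-- Conditional moments are finite, locally bounded in `u`, and continuous at `x` uniformly for
`u` in bounded sets; the moments of the spatial sign are continuous at `x`. -/
structure MomentAssumption {d : ℕ} {F : Type*} [PseudoMetricSpace F] [MeasurableSpace F]
    (κ : Kernel F (Vec d)) (x : F) (μ : Vec d) : Prop where
  moment : ∃ m : ℕ, 1 ≤ m ∧
    (∀ x' R, ⨆ u ∈ Metric.closedBall (0 : Vec d) R, condMoment κ m x' u < ∞) ∧
    ∀ R, TendstoUniformlyOn (fun x' u => (condMoment κ m x' u).toReal)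
      (fun u => (condMoment κ m x u).toReal) (𝓝 x) (Metric.closedBall 0 R)
  sign : ∃ δ : ℝ, 0 < δ ∧ ∀ l : Vec d, ∀ i ∈ ({1, 2} : Set ℕ), ∀ j ∈ ({0, 1} : Set ℕ),
    ContinuousAt
      (fun x' => ∫ y, |inner ℝ l (spatialSign (y - μ))| ^ ((i : ℝ) + (j : ℝ) * δ) ∂κ x') x

/-- `E[U(Y - μ) | d(x, X) = v] = ψ(v)` with `ψ` differentiable and `ψ'(0) ≠ 0`. -/
def BiasAssumption {d : ℕ} {Ω F : Type*} [MeasurableSpace Ω] [PseudoMetricSpace F]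
    (P : Measure Ω) (X : Ω → F) (Y : Ω → Vec d) (x : F) (μ : Vec d) : Prop :=
  ∃ ψ : ℝ → Vec d, Differentiable ℝ ψ ∧ deriv ψ 0 ≠ 0 ∧
    P[fun ω => spatialSign (Y ω - μ) | MeasurableSpace.comap (fun ω => dist x (X ω)) inferInstance]
      =ᵐ[P] fun ω => ψ (dist x (X ω))

end

/-! ### Pointwise inequalities for the norm and the spatial sign -/

section SpatialSign
variable {d : ℕ}

/-! Write Δ_i for the kernel weights, D = ∑ Δ_i, s = n E Δ, q = n E Δ². The plug-in constants are
exact, not approximate: by the fundamental theorem of calculus Δ^j = K(1)^j 1{ρ ≤ h} − ∫₀¹ (K^j)'(t)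
1{ρ ≤ th} dt, so M_{j,n} · n F_{x,n}(h) = ∑ Δ_i^j as soon as the ball contains an observation
(`kernelConstEst_mul`). The statistic is therefore D (∑ Δ_i²)^{-1/2} Σ_n^{-1/2} H_n (μ_n − μ)
(`kernelConstEst_normalization`).

H_n needs no limit of its own at μ_n. The sign is expanded around Y_i − μ_n rather than Y_i − μ:
U(Y_i − μ) = U(Y_i − μ_n) + M(Y_i, μ_n)(μ_n − μ) + O(‖μ_n − μ‖² ‖Y_i − μ_n‖⁻²). Summed against Δ_i,
the first term vanishes by the first order condition for μ_n, so D H_n (μ_n − μ) equals ∑ Δ_i U(Y_i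
− μ) up to a quadratic remainder (`sum_spatialSign_eq_zero`, `norm_sum_hess_sub_le`). After division
by √q, the sign sum whitened by Σ^{-1/2} is an i.i.d. array with uniformly small entries and
satisfies a central limit theorem (`tendstoInDistribution_signSum`); Slutsky's argument with Σ_n → Σ
and ∑ Δ_i² / q → 1 finishes the normal limit (`tendsto_pluginStat_sub`). The bias of the sign sum is
harmless: E[Δ U(Y − μ)] = E[Δ ψ(ρ)], and ψ(0) = 0 because the conditional mean of the sign tends to
0 at x, so the bias is O(h) E Δ and √s h → 0 (`exists_norm_integral_kernel_sign_le`).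

The first order condition and the remainder both require a deterministic radius r_n with ‖μ_n − μ‖ <
r_n, √s r_n² → 0, and no response of nonzero weight within 2 r_n of μ (`exists_localization`). By
convexity, μ_n is localized once the empirical objective exceeds its value at μ on the sphere of
radius r_n. This follows from positive definiteness of the conditional Hessian if r_n → 0 and r_n √s
→ ∞. But then s r_n² → ∞, and the expected number of responses near μ is O(s r_n² ε_n), where ε_n
bounds the conditional integral of ‖Y − μ‖⁻² over shrinking balls, uniformly in x' near x. Hence ε_n
→ 0 is indispensable: ‖Y − μ‖⁻² must be uniformly integrable near μ under the conditional laws close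
to x (`exists_eventually_setLIntegral_le`).

With an inverse moment of order m ≥ 3 this is immediate. For m = 2 it comes from continuity of the
inverse second moment together with a weak continuity of the laws, extracted from the uniform
closeness of u ↦ G^{x'}(u). That closeness bounds the energy distance; the norm is a mixture of
Gaussian kernels, so the energy distance dominates Gaussian kernel discrepancies, and these control
the bounded truncations (1 − exp(−S t²)) / t² of t⁻² (`energy_le`, `sq_gaussInteraction_sub_le`,
`abs_integral_gaussMixture_sub_le`). Subtracting the truncated part leaves a tail that is continuous
at x and small for large S.

Finally the quadratic form is exactly the squared norm of the normalized error (`ellipsoidStat_eq`),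
so the chi-squared limit is a continuous mapping, and coverage follows because the limit law has no
atoms. -/

lemma norm_spatialSign_le (y : Vec d) : ‖spatialSign y‖ ≤ 1 := by
  rw [spatialSign, norm_smul, norm_inv, norm_norm]
  exact inv_mul_le_one

lemma norm_smul_spatialSign (y : Vec d) : ‖y‖ • spatialSign y = y := by
  rcases eq_or_ne y 0 with rfl | hy
  · simp
  · rw [spatialSign, smul_smul, mul_inv_cancel₀ (norm_ne_zero_iff.2 hy), one_smul]

lemma norm_spatialSign {y : Vec d} (hy : y ≠ 0) : ‖spatialSign y‖ = 1 := by
  rw [spatialSign, norm_smul, norm_inv, norm_norm, inv_mul_cancel₀ (norm_ne_zero_iff.2 hy)]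

lemma norm_mul_inner_spatialSign (z v : Vec d) :
    ‖z‖ * inner ℝ v (spatialSign z) = inner ℝ v z := by
  rw [← inner_smul_right, norm_smul_spatialSign]

lemma abs_inner_spatialSign_le (z v : Vec d) : |inner ℝ v (spatialSign z)| ≤ ‖v‖ :=
  (abs_real_inner_le_norm _ _).trans
    (mul_le_of_le_one_right (norm_nonneg _) (norm_spatialSign_le z))

lemma abs_spatialSign_apply_le (z : Vec d) (k : Fin d) : |spatialSign z k| ≤ 1 :=
  (PiLp.norm_apply_le (spatialSign z) k).trans (norm_spatialSign_le z)

lemma norm_sub_sq_spatialSign (z v : Vec d) :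
    ‖z - v‖ ^ 2 = ‖z‖ ^ 2 - 2 * (‖z‖ * inner ℝ v (spatialSign z)) + ‖v‖ ^ 2 := by
  rw [norm_mul_inner_spatialSign, norm_sub_sq_real, real_inner_comm]

/-- The norm lies above its tangent at `z`. -/
lemma norm_sub_inner_spatialSign_le (z v : Vec d) :
    ‖z‖ - inner ℝ v (spatialSign z) ≤ ‖z - v‖ := by
  have h : inner ℝ (z - v) (spatialSign z) ≤ ‖z - v‖ :=
    (le_abs_self _).trans (abs_inner_spatialSign_le _ _)
  rw [inner_sub_left] at h
  have h2 : inner ℝ z (spatialSign z) = ‖z‖ := by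
    rw [spatialSign, inner_smul_right, real_inner_self_eq_norm_sq, pow_two, ← mul_assoc]
    rcases eq_or_ne z 0 with rfl | hz
    · simp
    · rw [inv_mul_cancel₀ (norm_ne_zero_iff.2 hz), one_mul]
  linarith

/-- The gap between the two sides is exactly the square (‖z − v‖ − ‖z‖)² / (2‖z‖). -/
lemma norm_sub_le_of_ne_zero {z : Vec d} (hz : z ≠ 0) (v : Vec d) :
    ‖z - v‖ ≤ ‖z‖ - inner ℝ v (spatialSign z) + ‖v‖ ^ 2 / 2 * ‖z‖⁻¹ := by
  have ht : 0 < ‖z‖ := norm_pos_iff.2 hz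
  have h1 := norm_sub_sq_spatialSign z v
  rw [← sub_nonneg]
  have : ‖z‖ - inner ℝ v (spatialSign z) + ‖v‖ ^ 2 / 2 * ‖z‖⁻¹ - ‖z - v‖
      = (‖z - v‖ - ‖z‖) ^ 2 / (2 * ‖z‖) := by
    field_simp
    linear_combination (-1) * h1
  rw [this]
  positivity

/-- Second order lower bound for the norm. -/
lemma norm_sub_ge_quadratic (z v : Vec d) :
    ‖z‖ - inner ℝ v (spatialSign z)
      + 1 / 2 * (‖z‖⁻¹ * (‖v‖ ^ 2 - inner ℝ v (spatialSign z) ^ 2))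
      - ‖v‖ ^ 3 / 2 * (‖z‖ ^ 2)⁻¹ ≤ ‖z - v‖ := by
  -- At z = 0 the conventions U(0) = 0 and 0⁻¹ = 0 leave only 0 ≤ ‖v‖.
  rcases eq_or_ne z 0 with rfl | hz
  · simp [spatialSign]
  have ht : 0 < ‖z‖ := norm_pos_iff.2 hz
  have h1 := norm_sub_sq_spatialSign z v
  have h2 := abs_inner_spatialSign_le z v
  have h3 := norm_sub_inner_spatialSign_le z v
  set a := inner ℝ v (spatialSign z)
  set q := ‖z - v‖
  set t := ‖z‖
  set b := ‖v‖
  have hb : 0 ≤ b := norm_nonneg _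
  have hq : 0 ≤ q := norm_nonneg _
  have hab : a ^ 2 ≤ b ^ 2 := sq_le_sq' (by linarith [neg_le_of_abs_le h2]) ((le_abs_self a).trans h2)
  have hqt : q ≤ t + b := by
    simpa [q, t, b] using norm_sub_le z v
  -- The excess q − (t − a) over the tangent is a factor of b² − a², and its cofactor is at most 2(t
  -- + b). Multiplying by t − b and using (t − b)(t + b) ≤ t² removes the denominator t + b; when t
  -- ≤ b the left side of the resulting bound is nonpositive.
  have key : (q - (t - a)) * (q + t - a) = b ^ 2 - a ^ 2 := by linear_combination h1
  have hup : q + t - a ≤ 2 * (t + b) := by linarith [neg_le_of_abs_le h2]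
  have h4 : b ^ 2 - a ^ 2 ≤ (q - (t - a)) * (2 * (t + b)) := by
    rw [← key]
    exact mul_le_mul_of_nonneg_left hup (by linarith)
  have h5 : (t - b) * (b ^ 2 - a ^ 2) ≤ 2 * t ^ 2 * (q - (t - a)) := by
    rcases le_total b t with hbt | hbt
    · nlinarith [mul_le_mul_of_nonneg_left h4 (sub_nonneg.2 hbt),
        mul_nonneg (sub_nonneg.2 h3) (sq_nonneg b)]
    · nlinarith [mul_nonneg (sub_nonneg.2 hbt) (sub_nonneg.2 hab),
        mul_nonneg (sub_nonneg.2 h3) (sq_nonneg t)]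
  have h6 : t * (b ^ 2 - a ^ 2) - b ^ 3 ≤ 2 * t ^ 2 * (q - (t - a)) := by
    nlinarith [mul_nonneg hb (sq_nonneg a)]
  have : t - a + 1 / 2 * (t⁻¹ * (b ^ 2 - a ^ 2)) - b ^ 3 / 2 * (t ^ 2)⁻¹
      = t - a + (t * (b ^ 2 - a ^ 2) - b ^ 3) / (2 * t ^ 2) := by
    field_simp
    ring
  rw [this]
  have : (t * (b ^ 2 - a ^ 2) - b ^ 3) / (2 * t ^ 2) ≤ q - (t - a) := by
    rw [div_le_iff₀ (by positivity)]
    linarith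
  linarith

/-- The difference of signs is ‖z‖⁻¹ times (w − z) + (‖z‖ − ‖w‖) U(w); the reverse triangle
inequality bounds both terms by ‖w − z‖, hence the constant 2. -/
lemma norm_spatialSign_sub_le {z : Vec d} (hz : z ≠ 0) (w : Vec d) :
    ‖spatialSign w - spatialSign z‖ ≤ 2 * ‖w - z‖ * ‖z‖⁻¹ := by
  have ht : 0 < ‖z‖ := norm_pos_iff.2 hz
  have h : spatialSign w - spatialSign z
      = ‖z‖⁻¹ • ((w - z) + (‖z‖ - ‖w‖) • spatialSign w) := by
    rw [smul_add, smul_smul, smul_sub, mul_sub, sub_smul, inv_mul_cancel₀ ht.ne', one_smul,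
      mul_smul, norm_smul_spatialSign]
    simp only [spatialSign]
    abel
  have h1 : |‖z‖ - ‖w‖| ≤ ‖w - z‖ := by
    rw [norm_sub_rev]; exact abs_norm_sub_norm_le z w
  rw [h, norm_smul, norm_inv, norm_norm, mul_comm]
  gcongr
  refine (norm_add_le _ _).trans ?_
  rw [norm_smul, Real.norm_eq_abs]
  nlinarith [norm_spatialSign_le w, abs_nonneg (‖z‖ - ‖w‖)]

/-- First order expansion of the spatial sign. -/
lemma norm_spatialSign_add_sub_le {y : Vec d} (hy : y ≠ 0) (v : Vec d) :
    ‖spatialSign (y + v) - spatialSign y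
      - ‖y‖⁻¹ • (v - inner ℝ v (spatialSign y) • spatialSign y)‖
      ≤ 5 / 2 * ‖v‖ ^ 2 * (‖y‖ ^ 2)⁻¹ := by
  have ht : 0 < ‖y‖ := norm_pos_iff.2 hy
  set a := inner ℝ v (spatialSign y)
  -- Up to the factor ‖y‖⁻¹ the remainder splits into the second order error of the norm (constant
  -- 1/2) and a times the increment of the sign (constant 2), which gives 5/2.
  have h : spatialSign (y + v) - spatialSign y - ‖y‖⁻¹ • (v - a • spatialSign y)
      = ‖y‖⁻¹ • ((‖y‖ - ‖y + v‖ + a) • spatialSign (y + v)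
        - a • (spatialSign (y + v) - spatialSign y)) := by
    have h0 : ‖y‖⁻¹ • ‖y‖ • spatialSign (y + v) = spatialSign (y + v) := by
      rw [smul_smul, inv_mul_cancel₀ ht.ne', one_smul]
    have h1 := norm_smul_spatialSign (y + v)
    rw [add_smul, sub_smul, h1]
    simp only [smul_sub, smul_add, h0]
    have h2 : ‖y‖⁻¹ • y = spatialSign y := rfl
    rw [h2]
    abel
  have h3 : |‖y‖ - ‖y + v‖ + a| ≤ ‖v‖ ^ 2 / 2 * ‖y‖⁻¹ := by
    have e1 := norm_sub_le_of_ne_zero hy (-v)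
    have e2 := norm_sub_inner_spatialSign_le y (-v)
    simp only [inner_neg_left, sub_neg_eq_add, norm_neg] at e1 e2
    rw [abs_le]
    constructor <;> linarith
  have h4 : ‖spatialSign (y + v) - spatialSign y‖ ≤ 2 * ‖v‖ * ‖y‖⁻¹ := by
    simpa using norm_spatialSign_sub_le hy (y + v)
  rw [h, norm_smul, norm_inv, norm_norm]
  have h5 : ‖(‖y‖ - ‖y + v‖ + a) • spatialSign (y + v)
        - a • (spatialSign (y + v) - spatialSign y)‖ ≤ 5 / 2 * ‖v‖ ^ 2 * ‖y‖⁻¹ := by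
    refine (norm_sub_le _ _).trans ?_
    rw [norm_smul, norm_smul, Real.norm_eq_abs, Real.norm_eq_abs]
    calc |‖y‖ - ‖y + v‖ + a| * ‖spatialSign (y + v)‖ + |a| * ‖spatialSign (y + v) - spatialSign y‖
        ≤ (‖v‖ ^ 2 / 2 * ‖y‖⁻¹) * 1 + ‖v‖ * (2 * ‖v‖ * ‖y‖⁻¹) := by
          gcongr
          · exact norm_spatialSign_le _
          · exact abs_inner_spatialSign_le _ _
      _ = _ := by ring
  calc ‖y‖⁻¹ * _ ≤ ‖y‖⁻¹ * (5 / 2 * ‖v‖ ^ 2 * ‖y‖⁻¹) := by gcongr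
    _ = _ := by rw [pow_two ‖y‖, mul_inv]; ring

lemma measurable_spatialSign : Measurable (spatialSign : Vec d → Vec d) := by
  unfold spatialSign
  fun_prop

lemma toEuclideanCLM_apply_apply (A : Matrix (Fin d) (Fin d) ℝ) (v : Vec d) (k : Fin d) :
    Matrix.toEuclideanCLM (𝕜 := ℝ) A v k = ∑ j, A k j * v j := by
  rfl

lemma signOuter_apply (y : Vec d) (k j : Fin d) :
    signOuter y k j = spatialSign y k * spatialSign y j := rfl

lemma inner_eq_sum_mul (v w : Vec d) : inner ℝ v w = ∑ j, v j * w j := by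
  simp [PiLp.inner_apply, mul_comm]

lemma toEuclideanCLM_signOuter (y v : Vec d) :
    Matrix.toEuclideanCLM (𝕜 := ℝ) (signOuter y) v
      = inner ℝ v (spatialSign y) • spatialSign y := by
  ext k
  rw [toEuclideanCLM_apply_apply, PiLp.smul_apply, smul_eq_mul, inner_eq_sum_mul, Finset.sum_mul]
  refine Finset.sum_congr rfl fun j _ => ?_
  rw [signOuter_apply]
  ring

lemma toEuclideanCLM_hessKernel (y u v : Vec d) :
    Matrix.toEuclideanCLM (𝕜 := ℝ) (hessKernel y u) v
      = ‖y - u‖⁻¹ • (v - inner ℝ v (spatialSign (y - u)) • spatialSign (y - u)) := by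
  rw [hessKernel, map_smul, map_sub, map_one, smul_apply,
    sub_apply, toEuclideanCLM_signOuter]
  rfl

lemma hessKernel_apply (y u : Vec d) (k j : Fin d) :
    hessKernel y u k j = ‖y - u‖⁻¹ * ((1 : Matrix (Fin d) (Fin d) ℝ) k j
      - spatialSign (y - u) k * spatialSign (y - u) j) := rfl

lemma abs_hessKernel_apply_le (y u : Vec d) (k j : Fin d) :
    |hessKernel y u k j| ≤ 2 * ‖y - u‖⁻¹ := by
  rw [hessKernel_apply, abs_mul, abs_of_nonneg (by positivity : (0:ℝ) ≤ ‖y - u‖⁻¹), mul_comm]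
  gcongr
  have h1 : |(1 : Matrix (Fin d) (Fin d) ℝ) k j| ≤ 1 := by
    rw [Matrix.one_apply]; split_ifs <;> simp
  have h2 : |spatialSign (y - u) k * spatialSign (y - u) j| ≤ 1 := by
    rw [abs_mul]
    exact mul_le_one₀ (abs_spatialSign_apply_le _ _) (abs_nonneg _) (abs_spatialSign_apply_le _ _)
  linarith [abs_sub ((1 : Matrix (Fin d) (Fin d) ℝ) k j)
    (spatialSign (y - u) k * spatialSign (y - u) j)]

end SpatialSign

/-! ### The kernel and the plug-in constants -/

lemma IntervalIntegrable.mul_ite_le_mul {D : ℝ → ℝ} {a b : ℝ}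
    (hD : IntervalIntegrable D volume a b) (ρ h : ℝ) :
    IntervalIntegrable (fun s => D s * (if ρ ≤ s * h then 1 else 0)) volume a b := by
  have key : ∀ m : Measure ℝ, Integrable D m →
      Integrable (fun s => D s * (if ρ ≤ s * h then 1 else 0)) m := by
    intro m hm
    refine hm.mul_bdd (c := 1) ?_ ?_
    · refine Measurable.aestronglyMeasurable ?_
      exact Measurable.ite (measurableSet_le (by fun_prop) (by fun_prop)) (by fun_prop)
        (by fun_prop)
    · refine .of_forall fun s => ?_
      split_ifs <;> simp
  exact ⟨key _ hD.1, key _ hD.2⟩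

namespace KernelAssumption
variable {K : ℝ → ℝ} (hK : KernelAssumption K)
include hK

lemma contDiffOn_pow (j : ℕ) : ContDiffOn ℝ 1 (fun t => K t ^ j) (Icc 0 1) :=
  hK.contDiff.pow j

lemma continuousOn_derivWithin_pow (j : ℕ) :
    ContinuousOn (derivWithin (fun t => K t ^ j) (Icc 0 1)) (Icc 0 1) :=
  (hK.contDiffOn_pow j).continuousOn_derivWithin (uniqueDiffOn_Icc zero_lt_one) le_rfl

lemma integral_derivWithin_pow (j : ℕ) {t : ℝ} (ht : t ∈ Icc (0 : ℝ) 1) :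
    ∫ s in t..1, derivWithin (fun t => K t ^ j) (Icc 0 1) s = K 1 ^ j - K t ^ j := by
  have hsub : Icc t 1 ⊆ Icc 0 1 := Icc_subset_Icc_left ht.1
  refine intervalIntegral.integral_eq_sub_of_hasDerivAt_of_le (f := fun t => K t ^ j) ht.2
    ((hK.contDiffOn_pow j).continuousOn.mono hsub) (fun s hs => ?_) ?_
  · have hs' : Icc (0 : ℝ) 1 ∈ 𝓝 s := Icc_mem_nhds (ht.1.trans_lt hs.1) hs.2
    have := ((hK.contDiffOn_pow j).differentiableOn one_ne_zero s (mem_of_mem_nhds hs'))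
    exact this.hasDerivWithinAt.hasDerivAt hs'
  · refine ContinuousOn.intervalIntegrable ?_
    rw [uIcc_of_le ht.2]
    exact (hK.continuousOn_derivWithin_pow j).mono hsub

/-- K decreases on [0, 1], so K(1) is its minimum there. With the upper bound on K, this makes the
ball count, ∑ Δ_i and ∑ Δ_i² comparable in mean up to constants. -/
lemma one_le_apply {t : ℝ} (ht : t ∈ Icc (0 : ℝ) 1) : K 1 ≤ K t := by
  have h := hK.integral_derivWithin_pow 1 ht
  simp only [pow_one] at h
  have : ∫ s in t..1, derivWithin K (Icc 0 1) s ≤ 0 := by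
    rw [← neg_nonneg, ← intervalIntegral.integral_neg]
    refine intervalIntegral.integral_nonneg ht.2 fun s hs => ?_
    exact neg_nonneg.2 (hK.deriv_neg s (Icc_subset_Icc_left ht.1 hs)).le
  linarith

lemma measurable : Measurable K := by
  have h1 : Measurable ((Icc (0 : ℝ) 1).piecewise K (fun _ => 0)) :=
    hK.contDiff.continuousOn.measurable_piecewise continuousOn_const measurableSet_Icc
  convert! h1 using 1
  ext t
  by_cases ht : t ∈ Icc (0 : ℝ) 1
  · simp [ht]
  · rw [piecewise_eq_of_notMem _ _ _ ht, hK.support t ht]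

lemma exists_pos_bound : ∃ C > 0, ∀ t, K t ≤ C :=
  let ⟨C, hC⟩ := hK.bounded
  ⟨C, hK.one_pos.trans_le (hC 1), hC⟩

lemma indicator_le {ρ h : ℝ} (hρ : 0 ≤ ρ) (hh : 0 < h) :
    (if ρ ≤ h then K 1 else 0) ≤ K (ρ / h) := by
  split_ifs with hc
  · exact hK.one_le_apply ⟨by positivity, (div_le_one hh).2 hc⟩
  · exact hK.nonneg _

lemma eq_zero_of_lt {ρ h : ℝ} (hh : 0 < h) (hc : h < ρ) : K (ρ / h) = 0 :=
  hK.support _ fun hm => not_le.2 hc ((div_le_one hh).1 hm.2)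

/-- For ρ ≤ h the indicator cuts the integral down to [ρ/h, 1], where it telescopes to K(1)^j −
K(ρ/h)^j. For ρ > h everything vanishes; this is where j = 0 must be excluded, since 0⁰ = 1. -/
lemma pow_eq_sub_integral {j : ℕ} (hj : j ≠ 0) {ρ h : ℝ} (hρ : 0 ≤ ρ) (hh : 0 < h) :
    K (ρ / h) ^ j = K 1 ^ j * (if ρ ≤ h then 1 else 0)
      - ∫ s in (0 : ℝ)..1, derivWithin (fun t => K t ^ j) (Icc 0 1) s
          * (if ρ ≤ s * h then 1 else 0) := by
  set D := derivWithin (fun t => K t ^ j) (Icc 0 1)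
  have hD : ∀ a b : ℝ, a ∈ Icc (0 : ℝ) 1 → b ∈ Icc (0 : ℝ) 1 →
      IntervalIntegrable D volume a b := fun a b ha hb =>
    ((hK.continuousOn_derivWithin_pow j).mono (uIcc_subset_Icc ha hb)).intervalIntegrable
  split_ifs with hc
  · have ht : ρ / h ∈ Icc (0 : ℝ) 1 := ⟨by positivity, (div_le_one hh).2 hc⟩
    have h1 : ∫ s in (0 : ℝ)..(ρ / h), D s * (if ρ ≤ s * h then 1 else 0) = 0 := by
      rw [intervalIntegral.integral_of_le ht.1, ← integral_Ioc_eq_integral_Ioo' (by simp) |>.symm]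
      refine setIntegral_eq_zero_of_forall_eq_zero fun s hs => ?_
      have : ¬ ρ ≤ s * h := not_le.2 ((lt_div_iff₀ hh).1 hs.2)
      simp [this]
    have h2 : EqOn (fun s => D s * (if ρ ≤ s * h then 1 else 0)) D (uIcc (ρ / h) 1) := by
      intro s hs
      rw [uIcc_of_le ht.2] at hs
      have : ρ ≤ s * h := (div_le_iff₀ hh).1 hs.1
      simp [this]
    have i1 := (hD 0 (ρ / h) (by simp) ht).mul_ite_le_mul ρ h
    have i2 : IntervalIntegrable (fun s => D s * (if ρ ≤ s * h then 1 else 0)) volume (ρ / h) 1 :=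
      (hD (ρ / h) 1 ht (by simp)).congr (fun s hs => (h2 (uIoc_subset_uIcc hs)).symm)
    rw [← intervalIntegral.integral_add_adjacent_intervals i1 i2, h1,
      intervalIntegral.integral_congr h2, hK.integral_derivWithin_pow j ht]
    ring
  · have h1 : EqOn (fun s => D s * (if ρ ≤ s * h then 1 else 0)) (fun _ => 0) (uIcc 0 1) := by
      intro s hs
      rw [uIcc_of_le zero_le_one] at hs
      have : ¬ ρ ≤ s * h := not_le.2 (lt_of_le_of_lt (mul_le_of_le_one_left hh.le hs.2) (not_le.1 hc))
      simp [this]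
    rw [intervalIntegral.integral_congr h1, hK.eq_zero_of_lt hh (not_le.1 hc)]
    simp [hj]

end KernelAssumption

section KernelConst
variable {F : Type*} [PseudoMetricSpace F] {K : ℝ → ℝ}

lemma mul_smallBallEst (x : F) (xs : ℕ → F) (n : ℕ) (r : ℝ) :
    (n : ℝ) * smallBallEst x xs n r
      = ∑ i ∈ Finset.range n, if dist x (xs i) ≤ r then (1 : ℝ) else 0 := by
  rcases eq_or_ne n 0 with rfl | hn
  · simp
  · rw [smallBallEst, ← mul_assoc, mul_one_div_cancel (Nat.cast_ne_zero.2 hn), one_mul]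

lemma smallBallEst_nonneg (x : F) (xs : ℕ → F) (n : ℕ) (r : ℝ) :
    0 ≤ smallBallEst x xs n r := by
  unfold smallBallEst
  exact mul_nonneg (by positivity) (Finset.sum_nonneg fun i _ => by split_ifs <;> simp)

/-- The plug-in constant is exactly the normalized sum of the powers of the kernel values. -/
lemma kernelConstEst_mul (hK : KernelAssumption K) (x : F) {h : ℝ} (hh : 0 < h) (xs : ℕ → F)
    (n : ℕ) {j : ℕ} (hj : j ≠ 0) (hF : smallBallEst x xs n h ≠ 0) :
    kernelConstEst K x h xs n j * (n * smallBallEst x xs n h)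
      = ∑ i ∈ Finset.range n, K (dist x (xs i) / h) ^ j := by
  set D := derivWithin (fun t => K t ^ j) (Icc 0 1) with hDdef
  have hn : (n : ℝ) ≠ 0 := by
    rintro h0
    exact hF (by simp [smallBallEst, h0])
  have hc : (n : ℝ) * smallBallEst x xs n h ≠ 0 := mul_ne_zero hn hF
  have hint : ∀ i, IntervalIntegrable (fun s => D s * (if dist x (xs i) ≤ s * h then 1 else 0))
      volume 0 1 := by
    intro i
    refine IntervalIntegrable.mul_ite_le_mul (ContinuousOn.intervalIntegrable ?_) _ _
    rw [uIcc_of_le zero_le_one]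
    exact hK.continuousOn_derivWithin_pow j
  have htau : ∀ s, tauEst x h xs n s = (n * smallBallEst x xs n h)⁻¹
      * ∑ i ∈ Finset.range n, if dist x (xs i) ≤ s * h then (1 : ℝ) else 0 := by
    intro s
    rw [← mul_smallBallEst, tauEst]
    field_simp
  rw [kernelConstEst, kernelConst]
  simp_rw [htau]
  rw [Finset.sum_congr rfl fun i _ => hK.pow_eq_sub_integral hj (dist_nonneg (x := x) (y := xs i)) hh,
    Finset.sum_sub_distrib, ← Finset.mul_sum, ← mul_smallBallEst, sub_mul,
    ← intervalIntegral.integral_finsetSum (fun i _ => hint i)]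
  congr 1
  rw [← intervalIntegral.integral_mul_const]
  refine intervalIntegral.integral_congr fun s _ => ?_
  rw [← Finset.mul_sum]
  field_simp
  rw [mul_comm, hDdef]

/-- With an empty ball, τ_n = 0 by the convention for quotients by 0, so the integral term
disappears. -/
lemma kernelConstEst_of_smallBallEst_eq_zero (x : F) (h : ℝ) (xs : ℕ → F) (n j : ℕ)
    (hF : smallBallEst x xs n h = 0) : kernelConstEst K x h xs n j = K 1 ^ j := by
  simp [kernelConstEst, kernelConst, tauEst, hF]

lemma kernelConstEst_nonneg (hK : KernelAssumption K) (x : F) {h : ℝ} (hh : 0 < h) (xs : ℕ → F)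
    (n : ℕ) {j : ℕ} (hj : j ≠ 0) : 0 ≤ kernelConstEst K x h xs n j := by
  by_cases hF : smallBallEst x xs n h = 0
  · rw [kernelConstEst_of_smallBallEst_eq_zero x h xs n j hF]
    exact pow_nonneg hK.one_pos.le _
  · have h1 := kernelConstEst_mul hK x hh xs n hj hF
    have hpos : 0 < (n : ℝ) * smallBallEst x xs n h := by
      refine lt_of_le_of_ne (mul_nonneg n.cast_nonneg (smallBallEst_nonneg _ _ _ _)) ?_
      refine (mul_ne_zero (fun h0 => hF ?_) hF).symm
      simp [smallBallEst, h0]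
    refine nonneg_of_mul_nonneg_left (b := (n : ℝ) * smallBallEst x xs n h) ?_ hpos
    rw [h1]
    exact Finset.sum_nonneg fun i _ => pow_nonneg (hK.nonneg _) _

/-- The scalar normalization of the plug-in statistic, in terms of the kernel values. -/
lemma kernelConstEst_normalization (hK : KernelAssumption K) (x : F) {h : ℝ} (hh : 0 < h)
    (xs : ℕ → F) (n : ℕ) :
    kernelConstEst K x h xs n 1 / √(kernelConstEst K x h xs n 2)
        * √((n : ℝ) * smallBallEst x xs n h)
      = (∑ i ∈ Finset.range n, K (dist x (xs i) / h))
          / √(∑ i ∈ Finset.range n, K (dist x (xs i) / h) ^ 2) := by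
  by_cases hF : smallBallEst x xs n h = 0
  -- An empty ball forces every kernel value to be 0, and both sides vanish.
  · have h0 : ∀ i ∈ Finset.range n, K (dist x (xs i) / h) = 0 := by
      intro i hi
      have h1 := mul_smallBallEst x xs n h
      rw [hF, mul_zero, eq_comm, Finset.sum_eq_zero_iff_of_nonneg
        (fun i _ => by split_ifs <;> simp)] at h1
      refine hK.eq_zero_of_lt hh ?_
      by_contra hc
      simpa [not_lt.1 hc] using h1 i hi
    rw [hF, Finset.sum_eq_zero h0]
    simp
  · have h1 := kernelConstEst_mul hK x hh xs n one_ne_zero hF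
    have h2 := kernelConstEst_mul hK x hh xs n two_ne_zero hF
    simp only [pow_one] at h1
    have hpos : 0 < (n : ℝ) * smallBallEst x xs n h := by
      refine lt_of_le_of_ne (mul_nonneg n.cast_nonneg (smallBallEst_nonneg _ _ _ _)) ?_
      refine (mul_ne_zero (fun h0 => hF ?_) hF).symm
      simp [smallBallEst, h0]
    rw [← h1, ← h2, Real.sqrt_mul' _ hpos.le]
    have hs : √((n : ℝ) * smallBallEst x xs n h) ≠ 0 := (Real.sqrt_pos.2 hpos).ne'
    by_cases hM : √(kernelConstEst K x h xs n 2) = 0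
    · simp [hM]
    · field_simp
      rw [Real.sq_sqrt hpos.le]
      ring

end KernelConst

/-! ### Inverse square roots of matrices and the plug-in statistic -/

section MatrixSqrt
variable {d : ℕ}

open scoped Matrix.Norms.L2Operator in
lemma continuousOn_matrix_sqrt :
    ContinuousOn (CFC.sqrt : Matrix (Fin d) (Fin d) ℝ → Matrix (Fin d) (Fin d) ℝ) {A | 0 ≤ A} :=
  CFC.continuousOn_sqrt

/-- The square root is continuous only on this cone. Closedness makes its extension by 0 Borel,
which is what measurability of Σ_n^{-1/2} rests on. -/
lemma isClosed_matrix_nonneg : IsClosed {A : Matrix (Fin d) (Fin d) ℝ | 0 ≤ A} := by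
  have : {A : Matrix (Fin d) (Fin d) ℝ | 0 ≤ A}
      = {A | A.conjTranspose = A} ∩ ⋂ v : Fin d → ℝ, {A | 0 ≤ v ⬝ᵥ (A.mulVec v)} := by
    ext A
    simp only [mem_ofPred_eq, Matrix.nonneg_iff_posSemidef, mem_inter_iff, mem_iInter,
      Matrix.posSemidef_iff_dotProduct_mulVec]
    simp [Matrix.IsHermitian]
  rw [this]
  refine IsClosed.inter (isClosed_eq (by fun_prop) (by fun_prop)) (isClosed_iInter fun v => ?_)
  exact isClosed_le continuous_const (by fun_prop)

/-- The formula includes singular matrices, where both sides are 0; continuity and measurability of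
inverses reduce to polynomials in the entries and one scalar inverse. -/
lemma matrix_inv_eq (A : Matrix (Fin d) (Fin d) ℝ) : A⁻¹ = (A.det)⁻¹ • A.adjugate := by
  rw [Matrix.inv_def, Ring.inverse_eq_inv']

lemma Matrix.PosDef.det_sqrt_ne_zero {B : Matrix (Fin d) (Fin d) ℝ} (hB : B.PosDef) :
    (CFC.sqrt B).det ≠ 0 := by
  intro h0
  have h2 : CFC.sqrt B * CFC.sqrt B = B := CFC.sqrt_mul_sqrt_self B hB.posSemidef.nonneg
  have h3 := congrArg Matrix.det h2
  rw [Matrix.det_mul, h0, zero_mul] at h3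
  exact hB.det_pos.ne h3

lemma tendsto_inv_sqrt {ι : Type*} {l : Filter ι} {A : ι → Matrix (Fin d) (Fin d) ℝ}
    {B : Matrix (Fin d) (Fin d) ℝ} (hA : ∀ i, (A i).PosSemidef) (hB : B.PosDef)
    (h : Tendsto A l (𝓝 B)) :
    Tendsto (fun i => (CFC.sqrt (A i))⁻¹) l (𝓝 (CFC.sqrt B)⁻¹) := by
  have h1 : Tendsto (fun i => CFC.sqrt (A i)) l (𝓝 (CFC.sqrt B)) := by
    refine (continuousOn_matrix_sqrt B hB.posSemidef.nonneg).tendsto.comp ?_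
    exact tendsto_nhdsWithin_iff.2 ⟨h, .of_forall fun i => (hA i).nonneg⟩
  simp only [matrix_inv_eq]
  have h4 : Tendsto (fun i => (CFC.sqrt (A i)).det) l (𝓝 (CFC.sqrt B).det) :=
    ((continuous_id.matrix_det).tendsto _).comp h1
  have h5 : Tendsto (fun i => (CFC.sqrt (A i)).adjugate) l (𝓝 (CFC.sqrt B).adjugate) :=
    ((continuous_id.matrix_adjugate).tendsto _).comp h1
  exact (h4.inv₀ hB.det_sqrt_ne_zero).smul h5

/-- The determinant and adjugate of the square root are continuous on the closed cone of nonnegative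
matrices, hence Borel after extension by 0, and A takes its values in that cone. -/
lemma aemeasurable_inv_sqrt_apply {Ω : Type*} [MeasurableSpace Ω] {P : Measure Ω}
    {A : Ω → Matrix (Fin d) (Fin d) ℝ} (hA : ∀ ω, (A ω).PosSemidef)
    (hm : ∀ k j, AEMeasurable (fun ω => A ω k j) P) (k j : Fin d) :
    AEMeasurable (fun ω => (CFC.sqrt (A ω))⁻¹ k j) P := by
  classical
  let S : Set (Fin d → Fin d → ℝ) := {a | 0 ≤ Matrix.of a}
  have hS : IsClosed S := isClosed_matrix_nonneg.preimage (by fun_prop)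
  have hsq : ContinuousOn (fun a : Fin d → Fin d → ℝ => CFC.sqrt (Matrix.of a)) S :=
    continuousOn_matrix_sqrt.comp (f := fun a : Fin d → Fin d → ℝ => Matrix.of a)
      (Continuous.continuousOn (by fun_prop)) (fun a ha => ha)
  have m1 : Measurable (S.piecewise (fun a => (CFC.sqrt (Matrix.of a)).det) (fun _ => 0)) :=
    ((continuous_id.matrix_det).comp_continuousOn hsq).measurable_piecewise
      continuousOn_const hS.measurableSet
  have m2 : Measurable (S.piecewise (fun a => (CFC.sqrt (Matrix.of a)).adjugate k j)
      (fun _ => 0)) :=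
    (((continuous_apply_apply k j).comp continuous_id.matrix_adjugate).comp_continuousOn
      hsq).measurable_piecewise continuousOn_const hS.measurableSet
  have hmA : AEMeasurable (fun ω => (fun k j => A ω k j : Fin d → Fin d → ℝ)) P :=
    aemeasurable_pi_lambda _ fun k => aemeasurable_pi_lambda _ fun j => hm k j
  have hmem : ∀ ω, (fun k j => A ω k j : Fin d → Fin d → ℝ) ∈ S := fun ω => (hA ω).nonneg
  have := ((m1.inv.mul m2).comp_aemeasurable hmA)
  refine this.congr (.of_forall fun ω => ?_)
  simp only [Function.comp_apply, Pi.mul_apply, Pi.inv_apply]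
  rw [piecewise_eq_of_mem _ _ _ (hmem ω), piecewise_eq_of_mem _ _ _ (hmem ω), matrix_inv_eq]
  rfl

end MatrixSqrt

section PluginStat
variable {d : ℕ} {F : Type*} [PseudoMetricSpace F] {K : ℝ → ℝ}

lemma posSemidef_signOuter (y : Vec d) : (signOuter y).PosSemidef := by
  have := Matrix.posSemidef_vecMulVec_self_star (R := ℝ) (fun k => spatialSign y k)
  simpa [Matrix.vecMulVec, signOuter] using this

lemma hessKernel_isSymm (y u : Vec d) : (hessKernel y u).IsSymm := by
  ext k j
  simp only [Matrix.transpose_apply, hessKernel_apply, Matrix.one_apply, eq_comm (a := j)]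
  ring

lemma nwWeight_nonneg (hK : KernelAssumption K) (x : F) (h : ℝ) (xs : ℕ → F) (n i : ℕ) :
    0 ≤ nwWeight K x h xs n i :=
  div_nonneg (hK.nonneg _) (Finset.sum_nonneg fun _ _ => hK.nonneg _)

lemma posSemidef_sigmaEst (hK : KernelAssumption K) (x : F) (h : ℝ) (xs : ℕ → F)
    (ys : ℕ → Vec d) (n : ℕ) (u : Vec d) : (sigmaEst K x h xs ys n u).PosSemidef :=
  Matrix.posSemidef_sum _ fun i _ =>
    (posSemidef_signOuter _).smul (nwWeight_nonneg hK x h xs n i)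

lemma hessEst_isSymm (x : F) (h : ℝ) (xs : ℕ → F)
    (ys : ℕ → Vec d) (n : ℕ) (u : Vec d) : (hessEst K x h xs ys n u).IsSymm := by
  rw [hessEst, Matrix.IsSymm, Matrix.transpose_sum]
  refine Finset.sum_congr rfl fun i _ => ?_
  rw [Matrix.transpose_smul, (hessKernel_isSymm _ _).eq]

lemma inner_toEuclideanCLM_transpose_mul (A : Matrix (Fin d) (Fin d) ℝ) (v : Vec d) :
    inner ℝ v (Matrix.toEuclideanCLM (𝕜 := ℝ) (A.transpose * A) v)
      = ‖Matrix.toEuclideanCLM (𝕜 := ℝ) A v‖ ^ 2 := by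
  have h : A.transpose = star A := by
    rw [Matrix.star_eq_conjTranspose, Matrix.conjTranspose_eq_transpose_of_trivial]
  rw [h, map_mul, map_star, mul_apply_eq_comp, ContinuousLinearMap.star_eq_adjoint,
    ContinuousLinearMap.adjoint_inner_right, real_inner_self_eq_norm_sq]

/-- The ellipsoid statistic is the squared norm of the normalized error. -/
lemma ellipsoidStat_eq (hK : KernelAssumption K) (x : F) {h : ℝ} (hh : 0 < h) (xs : ℕ → F)
    (ys : ℕ → Vec d) (n : ℕ) (m v : Vec d) :
    ellipsoidStat K x h xs ys n m v = ‖pluginStat K x h xs ys n m v‖ ^ 2 := by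
  set A := sigmaEst K x h xs ys n v
  set H := hessEst K x h xs ys n v
  have hA : 0 ≤ A := (posSemidef_sigmaEst hK x h xs ys n v).nonneg
  have hsq : CFC.sqrt A * CFC.sqrt A = A := CFC.sqrt_mul_sqrt_self A hA
  have hsymm : (CFC.sqrt A).transpose = CFC.sqrt A := by
    have h1 := (Matrix.nonneg_iff_posSemidef.1 (CFC.sqrt_nonneg A)).isHermitian
    rwa [Matrix.IsHermitian, Matrix.conjTranspose_eq_transpose_of_trivial] at h1
  have hH : H.transpose = H := hessEst_isSymm x h xs ys n v
  -- No invertibility is needed: (R R)⁻¹ = R⁻¹ R⁻¹ also holds for singular R, both sides being 0.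
  -- Hence the identity with the squared norm holds at every sample point.
  have hmat : H * A⁻¹ * H = ((CFC.sqrt A)⁻¹ * H).transpose * ((CFC.sqrt A)⁻¹ * H) := by
    rw [Matrix.transpose_mul, Matrix.transpose_nonsing_inv, hsymm, hH, Matrix.mul_assoc,
      Matrix.mul_assoc, ← Matrix.mul_assoc (CFC.sqrt A)⁻¹, ← Matrix.mul_inv_rev, hsq]
  rw [ellipsoidStat, pluginStat, gammaInvEst, map_smul, smul_apply,
    inner_smul_right, norm_smul, mul_pow]
  change _ * inner ℝ (v - m) (Matrix.toEuclideanCLM (𝕜 := ℝ) (H * A⁻¹ * H) (v - m)) = _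
  rw [hmat, inner_toEuclideanCLM_transpose_mul, Real.norm_eq_abs, sq_abs, mul_pow, div_pow,
    Real.sq_sqrt (kernelConstEst_nonneg hK x hh xs n two_ne_zero),
    Real.sq_sqrt (mul_nonneg n.cast_nonneg (smallBallEst_nonneg _ _ _ _))]
  ring

end PluginStat

/-! ### Convergence in probability as convergence along a filter -/

section InProb
variable {Ω : Type*} [MeasurableSpace Ω] {P : Measure Ω}

/-- The filter of sequences of events whose probability tends to one. A sequence of random
variables converges in probability iff it converges along this filter. -/
def inProb (P : Measure Ω) : Filter (ℕ × Ω) where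
  sets := {S | Tendsto (fun n => P {ω | (n, ω) ∉ S}) atTop (𝓝 0)}
  univ_sets := by simp
  sets_of_superset := fun {S T} hS hST => tendsto_of_tendsto_of_tendsto_of_le_of_le
    tendsto_const_nhds hS (fun _ => zero_le) (fun n => measure_mono fun _ hω h => hω (hST h))
  inter_sets := fun {S T} hS hT => by
    have := Tendsto.add hS hT
    rw [add_zero] at this
    refine tendsto_of_tendsto_of_tendsto_of_le_of_le tendsto_const_nhds this
      (fun _ => zero_le) (fun n => (measure_mono fun ω hω => ?_).trans (measure_union_le _ _))
    by_contra hc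
    simp only [mem_union, mem_ofPred_eq, not_or, not_not] at hc
    exact hω hc

lemma eventually_inProb {p : ℕ × Ω → Prop} :
    (∀ᶠ z in inProb P, p z) ↔ Tendsto (fun n => P {ω | ¬ p (n, ω)}) atTop (𝓝 0) := Iff.rfl

lemma tendsto_fst_inProb : Tendsto Prod.fst (inProb P) atTop := by
  refine tendsto_atTop.2 fun N => eventually_inProb.2 ?_
  refine tendsto_const_nhds.congr' ?_
  filter_upwards [eventually_ge_atTop N] with n hn
  simp [hn]

lemma Filter.Eventually.inProb {p : ℕ → Prop} (h : ∀ᶠ n in atTop, p n) :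
    ∀ᶠ z in inProb P, p z.1 := tendsto_fst_inProb.eventually h

lemma Filter.Tendsto.inProb {E : Type*} [TopologicalSpace E] {u : ℕ → E} {a : E}
    (h : Tendsto u atTop (𝓝 a)) : Tendsto (fun z : ℕ × Ω => u z.1) (inProb P) (𝓝 a) :=
  h.comp tendsto_fst_inProb

lemma eventually_inProb_of_ae {p : ℕ → Ω → Prop} (h : ∀ n, ∀ᵐ ω ∂P, p n ω) :
    ∀ᶠ z in inProb P, p z.1 z.2 := by
  refine eventually_inProb.2 (tendsto_const_nhds.congr fun n => ?_)
  exact (ae_iff.1 (h n)).symm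

lemma tendstoInMeasure_of_tendsto_inProb {E : Type*} [SeminormedAddCommGroup E] {f : ℕ → Ω → E}
    (h : Tendsto (fun z : ℕ × Ω => f z.1 z.2) (inProb P) (𝓝 0)) :
    TendstoInMeasure P f atTop 0 := by
  rw [tendstoInMeasure_iff_norm]
  intro ε hε
  have := eventually_inProb.1 (h.norm.eventually_lt_const (by simpa using hε))
  simpa using this

/-- A null sequence times a tight sequence is a null sequence. -/
lemma tendsto_inProb_smul_of_tight {E : Type*} [SeminormedAddCommGroup E] [NormedSpace ℝ E]
    {A : ℕ × Ω → ℝ} {W : ℕ × Ω → E} (hA : Tendsto A (inProb P) (𝓝 0))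
    (hW : ∀ ε : ℝ≥0∞, 0 < ε → ∃ M : ℝ, ∀ᶠ n in atTop, P {ω | M < ‖W (n, ω)‖} ≤ ε) :
    Tendsto (fun z => A z • W z) (inProb P) (𝓝 0) := by
  rw [Metric.tendsto_nhds]
  intro η hη
  refine eventually_inProb.2 (ENNReal.tendsto_nhds_zero.2 fun ε hε => ?_)
  obtain ⟨M, hM⟩ := hW (ε / 2) (ENNReal.half_pos hε.ne')
  -- The denominator |M| + 1 is positive whatever the sign of the tightness bound M.
  have hA' : ∀ᶠ z in inProb P, |A z| < η / (|M| + 1) := by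
    have := hA.abs
    rw [abs_zero] at this
    exact this.eventually_lt_const (by positivity)
  have hA2 := (ENNReal.tendsto_nhds_zero.1 (eventually_inProb.1 hA')) (ε / 2)
    (ENNReal.half_pos hε.ne')
  filter_upwards [hM, hA2] with n h1 h2
  calc P {ω | ¬ dist (A (n, ω) • W (n, ω)) 0 < η}
      ≤ P ({ω | M < ‖W (n, ω)‖} ∪ {ω | ¬ |A (n, ω)| < η / (|M| + 1)}) := by
        refine measure_mono fun ω hω => ?_
        by_contra hc
        simp only [mem_union, mem_ofPred_eq, not_or, not_lt, not_le] at hc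
        refine hω ?_
        rw [dist_zero_right, norm_smul, Real.norm_eq_abs]
        calc |A (n, ω)| * ‖W (n, ω)‖ ≤ |A (n, ω)| * (|M| + 1) := by
              gcongr
              linarith [hc.1, le_abs_self M]
          _ < η / (|M| + 1) * (|M| + 1) := by gcongr; exact hc.2
          _ = η := by field_simp
    _ ≤ ε / 2 + ε / 2 := (measure_union_le _ _).trans (add_le_add h1 h2)
    _ = ε := ENNReal.add_halves ε

end InProb

/-! ### Sums over i.i.d. arrays -/

section Arrays
variable {Ω S : Type*} [MeasurableSpace Ω] [MeasurableSpace S] {P : Measure Ω}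
  [IsProbabilityMeasure P] {Z : ℕ → Ω → S}

/-- Chebyshev's inequality for a sum of i.i.d. variables. -/
lemma measure_abs_sum_sub_ge_le (hindep : iIndepFun Z P)
    (hident : ∀ i, IdentDistrib (Z i) (Z 0) P P) {ξ : S → ℝ} (hξ : Measurable ξ)
    (h2 : MemLp (fun ω => ξ (Z 0 ω)) 2 P) (n : ℕ) {t : ℝ} (ht : 0 < t) :
    P {ω | t ≤ |∑ i ∈ Finset.range n, ξ (Z i ω) - n * ∫ ω, ξ (Z 0 ω) ∂P|}
      ≤ ENNReal.ofReal (n * (∫ ω, ξ (Z 0 ω) ^ 2 ∂P) / t ^ 2) := by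
  have hid : ∀ i, IdentDistrib (fun ω => ξ (Z i ω)) (fun ω => ξ (Z 0 ω)) P P :=
    fun i => (hident i).comp hξ
  have hL : ∀ i, MemLp (fun ω => ξ (Z i ω)) 2 P := fun i => (hid i).memLp_iff.2 h2
  have hsum : MemLp (∑ i ∈ Finset.range n, fun ω => ξ (Z i ω)) 2 P :=
    memLp_finsetSum' _ fun i _ => hL i
  have hmean : ∫ ω, (∑ i ∈ Finset.range n, fun ω => ξ (Z i ω)) ω ∂P
      = n * ∫ ω, ξ (Z 0 ω) ∂P := by
    simp only [Finset.sum_apply]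
    rw [integral_finsetSum _ fun i _ => (hL i).integrable (by norm_num)]
    simp [fun i => (hid i).integral_eq]
  have hvar : Var[∑ i ∈ Finset.range n, fun ω => ξ (Z i ω); P]
      ≤ n * ∫ ω, ξ (Z 0 ω) ^ 2 ∂P := by
    rw [IndepFun.variance_sum (fun i _ => hL i)]
    · simp only [fun i => (hid i).variance_eq]
      rw [Finset.sum_const, Finset.card_range, nsmul_eq_mul]
      gcongr
      exact variance_le_expectation_sq h2.aestronglyMeasurable
    · intro i _ j _ hij
      exact (hindep.indepFun hij).comp hξ hξ
  have h := meas_ge_le_variance_div_sq hsum ht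
  rw [hmean] at h
  simp only [Finset.sum_apply] at h
  refine h.trans (ENNReal.ofReal_le_ofReal ?_)
  gcongr

/-- Weak law of large numbers for an array of i.i.d. rows. -/
lemma tendsto_inProb_mul_sum (hindep : iIndepFun Z P)
    (hident : ∀ i, IdentDistrib (Z i) (Z 0) P P) {ξ : ℕ → S → ℝ} (hξ : ∀ n, Measurable (ξ n))
    (h2 : ∀ᶠ n in atTop, MemLp (fun ω => ξ n (Z 0 ω)) 2 P) {c : ℕ → ℝ} {a : ℝ}
    (hvar : Tendsto (fun n => c n ^ 2 * (n * ∫ ω, ξ n (Z 0 ω) ^ 2 ∂P)) atTop (𝓝 0))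
    (hmean : Tendsto (fun n => c n * (n * ∫ ω, ξ n (Z 0 ω) ∂P)) atTop (𝓝 a)) :
    Tendsto (fun z : ℕ × Ω => c z.1 * ∑ i ∈ Finset.range z.1, ξ z.1 (Z i z.2))
      (inProb P) (𝓝 a) := by
  have key : Tendsto (fun z : ℕ × Ω => c z.1 * (∑ i ∈ Finset.range z.1, ξ z.1 (Z i z.2)
      - z.1 * ∫ ω, ξ z.1 (Z 0 ω) ∂P)) (inProb P) (𝓝 0) := by
    rw [Metric.tendsto_nhds]
    intro η hη
    refine eventually_inProb.2 ?_
    have hlim : Tendsto (fun n => ENNReal.ofReal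
        (c n ^ 2 * (n * ∫ ω, ξ n (Z 0 ω) ^ 2 ∂P) / η ^ 2)) atTop (𝓝 0) := by
      have := ENNReal.tendsto_ofReal (hvar.div_const (η ^ 2))
      simpa using this
    refine tendsto_of_tendsto_of_tendsto_of_le_of_le' tendsto_const_nhds hlim
      (.of_forall fun _ => zero_le) ?_
    filter_upwards [h2] with n hn
    rcases eq_or_ne (c n) 0 with h0 | h0
    · simp [h0, hη]
    have hpos : 0 < |c n| := abs_pos.2 h0
    refine le_trans (measure_mono fun ω hω => ?_)
      ((measure_abs_sum_sub_ge_le hindep hident (hξ n) hn n (div_pos hη hpos)).trans_eq ?_)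
    · simp only [mem_ofPred_eq, dist_zero_right, Real.norm_eq_abs, abs_mul, not_lt] at hω ⊢
      rw [div_le_iff₀ hpos, mul_comm]
      exact hω
    · congr 1
      rw [div_pow, sq_abs]
      field_simp
  have := key.add hmean.inProb
  rw [zero_add] at this
  refine this.congr fun z => ?_
  ring

/-- Tightness of normalized sums over an array of i.i.d. rows. -/
lemma tight_mul_sum (hindep : iIndepFun Z P)
    (hident : ∀ i, IdentDistrib (Z i) (Z 0) P P) {ξ : ℕ → S → ℝ} (hξ : ∀ n, Measurable (ξ n))
    (h2 : ∀ᶠ n in atTop, MemLp (fun ω => ξ n (Z 0 ω)) 2 P) {c : ℕ → ℝ} {C : ℝ}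
    (hvar : ∀ᶠ n in atTop, c n ^ 2 * (n * ∫ ω, ξ n (Z 0 ω) ^ 2 ∂P) ≤ C)
    (hmean : Tendsto (fun n => c n * (n * ∫ ω, ξ n (Z 0 ω) ∂P)) atTop (𝓝 0))
    (ε : ℝ≥0∞) (hε : 0 < ε) :
    ∃ M : ℝ, ∀ᶠ n in atTop, P {ω | M < |c n * ∑ i ∈ Finset.range n, ξ n (Z i ω)|} ≤ ε := by
  have hlim : Tendsto (fun M : ℝ => ENNReal.ofReal (C / M ^ 2)) atTop (𝓝 0) := by
    have := ENNReal.tendsto_ofReal (tendsto_const_nhds (x := C) |>.div_atTop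
      (tendsto_pow_atTop (α := ℝ) two_ne_zero))
    simpa using this
  obtain ⟨M, hM, hM0⟩ := ((ENNReal.tendsto_nhds_zero.1 hlim ε hε).and (eventually_gt_atTop 0)).exists
  refine ⟨M + 1, ?_⟩
  filter_upwards [h2, hvar, (Metric.tendsto_nhds.1 hmean 1 one_pos)] with n hn hv hm
  rcases eq_or_ne (c n) 0 with h0 | h0
  · have : ¬ (M + 1 < 0) := by linarith
    simp [h0, this]
  have hpos : 0 < |c n| := abs_pos.2 h0
  refine le_trans (measure_mono fun ω hω => ?_)
    ((measure_abs_sum_sub_ge_le hindep hident (hξ n) hn n (div_pos hM0 hpos)).trans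
      (le_trans (ENNReal.ofReal_le_ofReal ?_) hM))
  · simp only [mem_ofPred_eq, dist_zero_right, Real.norm_eq_abs] at hω hm ⊢
    rw [div_le_iff₀ hpos, mul_comm, ← abs_mul, mul_sub]
    linarith [abs_sub_abs_le_abs_sub (c n * ∑ i ∈ Finset.range n, ξ n (Z i ω))
      (c n * (n * ∫ ω, ξ n (Z 0 ω) ∂P))]
  · calc _ = c n ^ 2 * (n * ∫ ω, ξ n (Z 0 ω) ^ 2 ∂P) / M ^ 2 := by
          rw [div_pow, sq_abs]
          field_simp
      _ ≤ C / M ^ 2 := by gcongr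

end Arrays

section Markov
variable {Ω S : Type*} [MeasurableSpace Ω] [MeasurableSpace S] {P : Measure Ω} {Z : ℕ → Ω → S}

/-- Markov's inequality for an array of i.i.d. rows. -/
lemma tendsto_inProb_mul_sum_of_nonneg
    (hident : ∀ i, IdentDistrib (Z i) (Z 0) P P) {ξ : ℕ → S → ℝ} (hξ : ∀ n, Measurable (ξ n))
    (hnn : ∀ n s, 0 ≤ ξ n s) {c : ℕ → ℝ} (hc : ∀ n, 0 ≤ c n)
    (hmean : Tendsto (fun n => ENNReal.ofReal (c n) *
      (n * ∫⁻ ω, ENNReal.ofReal (ξ n (Z 0 ω)) ∂P)) atTop (𝓝 0)) :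
    Tendsto (fun z : ℕ × Ω => c z.1 * ∑ i ∈ Finset.range z.1, ξ z.1 (Z i z.2))
      (inProb P) (𝓝 0) := by
  have hZm : ∀ i, AEMeasurable (Z i) P := fun i => (hident i).aemeasurable_fst
  rw [Metric.tendsto_nhds]
  intro η hη
  refine eventually_inProb.2 ?_
  have hη' : ENNReal.ofReal η ≠ 0 := by simpa using hη
  have hlim := ENNReal.Tendsto.div_const (b := ENNReal.ofReal η) hmean (.inr hη')
  rw [ENNReal.zero_div] at hlim
  refine tendsto_of_tendsto_of_tendsto_of_le_of_le tendsto_const_nhds hlim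
      (fun _ => zero_le) fun n => ?_
  have hmeas : ∀ i, AEMeasurable (fun ω => ENNReal.ofReal (ξ n (Z i ω))) P := fun i =>
    ((hξ n).comp_aemeasurable (hZm i)).ennreal_ofReal
  have h1 : ∫⁻ ω, ENNReal.ofReal (c n * ∑ i ∈ Finset.range n, ξ n (Z i ω)) ∂P
      = ENNReal.ofReal (c n) * (n * ∫⁻ ω, ENNReal.ofReal (ξ n (Z 0 ω)) ∂P) := by
    simp_rw [ENNReal.ofReal_mul (hc n), ENNReal.ofReal_sum_of_nonneg fun i _ => hnn n _]
    rw [lintegral_const_mul'' _ (Finset.aemeasurable_fun_sum _ fun i _ => hmeas i),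
      lintegral_finsetSum' _ fun i _ => hmeas i]
    congr 1
    have h2 : ∀ i, ∫⁻ ω, ENNReal.ofReal (ξ n (Z i ω)) ∂P = ∫⁻ ω, ENNReal.ofReal (ξ n (Z 0 ω)) ∂P :=
      fun i => ((hident i).comp (hξ n).ennreal_ofReal).lintegral_eq
    simp [h2]
  rw [ENNReal.le_div_iff_mul_le (.inl hη') (.inl ENNReal.ofReal_ne_top), mul_comm]
  refine le_trans ?_ ((mul_meas_ge_le_lintegral₀ (f := fun ω => ENNReal.ofReal
    (c n * ∑ i ∈ Finset.range n, ξ n (Z i ω))) ?_ (ENNReal.ofReal η)).trans_eq h1)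
  · gcongr
    intro h
    simp only [dist_zero_right, Real.norm_eq_abs, not_lt] at h
    rw [abs_of_nonneg (mul_nonneg (hc n) (Finset.sum_nonneg fun i _ => hnn n _))] at h
    exact ENNReal.ofReal_le_ofReal h
  · exact ((Finset.aemeasurable_fun_sum _ fun i _ =>
      (hξ n).comp_aemeasurable (hZm i)).const_mul _).ennreal_ofReal

end Markov

/-! ### A central limit theorem for uniformly small arrays with i.i.d. rows -/

section CLT
variable {Ω S : Type*} [MeasurableSpace Ω] [MeasurableSpace S] {P : Measure Ω}
  [IsProbabilityMeasure P] {Z : ℕ → Ω → S} {d : ℕ}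

lemma norm_exp_mul_I_sub_le (y : ℝ) :
    ‖Complex.exp (y * Complex.I) - 1 - (y * Complex.I - (y : ℂ) ^ 2 / 2)‖
      ≤ |y| ^ 3 * Real.exp |y| := by
  have h := Complex.norm_exp_sub_sum_le_norm_mul_exp (y * Complex.I) 3
  simp only [Finset.sum_range_succ, Finset.sum_range_zero, norm_mul, Complex.norm_I, mul_one,
    Complex.norm_real, Real.norm_eq_abs] at h
  refine le_trans (le_of_eq ?_) h
  congr 1
  simp [mul_pow, Nat.factorial]
  ring

/-- The limit follows from n (φ_n(t) − 1) → −‖t‖²/2 and (1 + g_n)^n → exp(lim n g_n). The cubic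
Taylor remainder of exp(iy) is at most B exp(B) y² when |y| ≤ B, so uniform smallness of the entries
plays the role of the Lindeberg condition. -/
lemma tendsto_charFun_array {ξ : ℕ → Ω → Vec d} (hξ : ∀ n, AEMeasurable (ξ n) P) {b : ℕ → ℝ}
    (hb : Tendsto b atTop (𝓝 0)) (hbd : ∀ᶠ n in atTop, ∀ ω, ‖ξ n ω‖ ≤ b n) (t : Vec d)
    (hmean : Tendsto (fun n : ℕ => n * ∫ ω, inner ℝ (ξ n ω) t ∂P) atTop (𝓝 0))
    (hvar : Tendsto (fun n : ℕ => n * ∫ ω, inner ℝ (ξ n ω) t ^ 2 ∂P) atTop (𝓝 (‖t‖ ^ 2))) :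
    Tendsto (fun n : ℕ => charFun (P.map (ξ n)) t ^ n) atTop
      (𝓝 (Complex.exp (-‖t‖ ^ 2 / 2))) := by
  set y : ℕ → Ω → ℝ := fun n ω => inner ℝ (ξ n ω) t
  have hym : ∀ n, AEMeasurable (y n) P := fun n => (hξ n).inner_const
  have hcf : ∀ n, charFun (P.map (ξ n)) t
      = ∫ ω, Complex.exp (y n ω * Complex.I) ∂P := by
    intro n
    rw [charFun_apply, integral_map (hξ n) (by fun_prop)]
  set B : ℕ → ℝ := fun n => b n * ‖t‖
  have hB : Tendsto B atTop (𝓝 0) := by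
    simpa using hb.mul_const ‖t‖
  have hyB : ∀ᶠ n in atTop, ∀ ω, |y n ω| ≤ B n := by
    filter_upwards [hbd] with n hn ω
    exact (abs_real_inner_le_norm _ _).trans
      (mul_le_mul_of_nonneg_right (hn ω) (norm_nonneg _))
  have hrest : Tendsto (fun n : ℕ => (n : ℂ) * ∫ ω, (Complex.exp (y n ω * Complex.I) - 1
      - (y n ω * Complex.I - (y n ω : ℂ) ^ 2 / 2)) ∂P) atTop (𝓝 0) := by
    have hlim : Tendsto (fun n : ℕ => (B n * Real.exp (B n)) * (n * ∫ ω, y n ω ^ 2 ∂P)) atTop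
        (𝓝 0) := by
      have := (hB.mul ((Real.continuous_exp.tendsto _).comp hB)).mul hvar
      simpa using this
    refine squeeze_zero_norm' ?_ hlim
    filter_upwards [hyB] with n hn
    rw [norm_mul, Complex.norm_natCast, mul_left_comm]
    gcongr
    rw [← integral_const_mul]
    refine norm_integral_le_of_norm_le ?_ (.of_forall fun ω => ?_)
    · refine Integrable.const_mul (Integrable.of_bound ((hym n).pow_const 2).aestronglyMeasurable
        (B n ^ 2) (.of_forall fun ω => ?_)) _
      rw [norm_pow, Real.norm_eq_abs]
      gcongr
      exact hn ω
    · refine (norm_exp_mul_I_sub_le _).trans ?_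
      have h0 := hn ω
      have hB0 : 0 ≤ B n := (abs_nonneg _).trans h0
      calc |y n ω| ^ 3 * Real.exp |y n ω| = |y n ω| * Real.exp |y n ω| * y n ω ^ 2 := by
            rw [← sq_abs (y n ω)]; ring
        _ ≤ B n * Real.exp (B n) * y n ω ^ 2 := by gcongr
  have hg : Tendsto (fun n : ℕ => (n : ℂ) * (charFun (P.map (ξ n)) t - 1)) atTop
      (𝓝 (-‖t‖ ^ 2 / 2)) := by
    have h1 : Tendsto (fun n : ℕ => ((n * ∫ ω, y n ω ∂P : ℝ) : ℂ) * Complex.I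
        - ((n * ∫ ω, y n ω ^ 2 ∂P : ℝ) : ℂ) / 2) atTop
        (𝓝 ((0 : ℝ) * Complex.I - ((‖t‖ ^ 2 : ℝ) : ℂ) / 2)) := by
      refine Tendsto.sub (Tendsto.mul_const _ ?_) (Tendsto.div_const ?_ _)
      · exact (Complex.continuous_ofReal.tendsto _).comp hmean
      · exact (Complex.continuous_ofReal.tendsto _).comp hvar
    have h2 := hrest.add h1
    have e : (0 : ℂ) + (((0 : ℝ) : ℂ) * Complex.I - ((‖t‖ ^ 2 : ℝ) : ℂ) / 2) = -‖t‖ ^ 2 / 2 := by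
      push_cast; ring
    rw [e] at h2
    refine h2.congr' ?_
    filter_upwards [hyB] with n hn
    have i1 : Integrable (fun ω => Complex.exp (y n ω * Complex.I)) P := by
      refine Integrable.of_bound (C := 1) ?_ (.of_forall fun ω => ?_)
      · exact (Complex.measurable_exp.comp_aemeasurable
          ((Complex.measurable_ofReal.comp_aemeasurable (hym n)).mul_const _)).aestronglyMeasurable
      · rw [Complex.norm_exp_ofReal_mul_I]
    have i2 : Integrable (fun ω => (y n ω : ℂ) * Complex.I) P := by
      refine Integrable.of_bound (C := B n) ?_ (.of_forall fun ω => ?_)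
      · exact ((Complex.measurable_ofReal.comp_aemeasurable (hym n)).mul_const
          _).aestronglyMeasurable
      · simpa using hn ω
    have i3 : Integrable (fun ω => (y n ω : ℂ) ^ 2 / 2) P := by
      refine Integrable.of_bound (C := B n ^ 2 / 2) ?_ (.of_forall fun ω => ?_)
      · exact (((Complex.measurable_ofReal.comp_aemeasurable (hym n)).pow_const 2).div_const
          _).aestronglyMeasurable
      · simp only [norm_div, norm_pow, Complex.norm_real, Real.norm_eq_abs, Complex.norm_ofNat]
        gcongr
        exact hn ω
    have e4 := integral_sub (i1.sub (integrable_const (1 : ℂ))) (i2.sub i3)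
    simp only [Pi.sub_apply] at e4
    rw [e4, integral_sub i1 (integrable_const _),
      integral_sub i2 i3, integral_mul_const, integral_div, integral_complex_ofReal]
    have e3 : ∫ ω, (y n ω : ℂ) ^ 2 ∂P = ((∫ ω, y n ω ^ 2 ∂P : ℝ) : ℂ) := by
      rw [← integral_complex_ofReal]
      push_cast
      rfl
    rw [e3, ← hcf]
    simp only [integral_const, probReal_univ, one_smul]
    push_cast
    ring
  have h := Complex.tendsto_one_add_pow_exp_of_tendsto hg
  simpa using h

/-- Central limit theorem for an array with i.i.d. rows and uniformly small entries. -/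
theorem tendstoInDistribution_sum_array (hindep : iIndepFun Z P)
    (hident : ∀ i, IdentDistrib (Z i) (Z 0) P P) {ξ : ℕ → S → Vec d} (hξ : ∀ n, Measurable (ξ n))
    {b : ℕ → ℝ} (hb : Tendsto b atTop (𝓝 0)) (hbd : ∀ᶠ n in atTop, ∀ s, ‖ξ n s‖ ≤ b n)
    (hmean : ∀ t, Tendsto (fun n : ℕ => n * ∫ ω, inner ℝ (ξ n (Z 0 ω)) t ∂P) atTop (𝓝 0))
    (hvar : ∀ t, Tendsto (fun n : ℕ => n * ∫ ω, inner ℝ (ξ n (Z 0 ω)) t ^ 2 ∂P) atTop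
      (𝓝 (‖t‖ ^ 2))) :
    TendstoInDistribution (fun n ω => ∑ i ∈ Finset.range n, ξ n (Z i ω)) atTop id (fun _ => P)
      (stdGaussian (Vec d)) where
  forall_aemeasurable n := Finset.aemeasurable_fun_sum _ fun i _ =>
    (hξ n).comp_aemeasurable (hident i).aemeasurable_fst
  tendsto := by
    have hm : ∀ n i, AEMeasurable (fun ω => ξ n (Z i ω)) P := fun n i =>
      (hξ n).comp_aemeasurable (hident i).aemeasurable_fst
    refine ProbabilityMeasure.tendsto_iff_tendsto_charFun.2 fun t => ?_
    have h1 := tendsto_charFun_array (fun n => hm n 0) hb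
      (hbd.mono fun n hn ω => hn (Z 0 ω)) t (hmean t) (hvar t)
    simp only [ProbabilityMeasure.coe_mk, Measure.map_id, charFun_stdGaussian]
    refine h1.congr fun n => ?_
    have hi : iIndepFun (fun i ω => ξ n (Z i ω)) P := hindep.comp (fun _ => ξ n) fun _ => hξ n
    have hid : ∀ i, P.map (fun ω => ξ n (Z i ω)) = P.map (fun ω => ξ n (Z 0 ω)) :=
      fun i => ((hident i).comp (hξ n)).map_eq
    rw [(hi.restrict _).charFun_map_fun_finsetSum_eq_prod (fun i _ => hm n i)]
    simp [hid]

end CLT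

/-! ### The energy distance and Gaussian test functions -/

section Energy
variable {d : ℕ}

/-- The Gaussian interaction `∬ exp (-s ‖x - y‖²) dP(x) dQ(y)`. -/
noncomputable def gaussInteraction (s : ℝ) (P Q : Measure (Vec d)) : ℝ :=
  ∫ p, Real.exp (-s * ‖p.1 - p.2‖ ^ 2) ∂(P.prod Q)

/-- After Fubini the inner integral is the standard Gaussian characteristic function at √(2s)(x −
y), that is exp(−s ‖x − y‖²). The Gaussian interaction thus becomes an L² inner product of
characteristic functions. -/
lemma integral_charFun_mul_conj (P Q : Measure (Vec d)) [IsProbabilityMeasure P]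
    [IsProbabilityMeasure Q] {s : ℝ} (hs : 0 ≤ s) :
    ∫ z, charFun P (√(2 * s) • z) * (starRingEnd ℂ) (charFun Q (√(2 * s) • z))
      ∂(stdGaussian (Vec d)) = (gaussInteraction s P Q : ℂ) := by
  set c := √(2 * s)
  have hc : c ^ 2 = 2 * s := Real.sq_sqrt (by positivity)
  have h1 : ∀ z : Vec d, charFun P (c • z) * (starRingEnd ℂ) (charFun Q (c • z))
      = ∫ p, Complex.exp ((inner ℝ z (c • (p.1 - p.2)) : ℝ) * Complex.I) ∂(P.prod Q) := by
    intro z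
    rw [charFun_apply, charFun_apply, ← integral_conj, ← integral_prod_mul]
    congr 1
    ext p
    rw [← Complex.exp_conj, ← Complex.exp_add]
    congr 1
    simp only [map_mul, Complex.conj_ofReal, Complex.conj_I]
    rw [inner_smul_right, inner_smul_right, inner_smul_right, inner_sub_right,
      real_inner_comm p.1 z, real_inner_comm p.2 z]
    push_cast
    ring
  simp_rw [h1]
  rw [integral_integral_swap]
  · rw [gaussInteraction, ← integral_complex_ofReal]
    congr 1
    ext p
    rw [← charFun_apply, charFun_stdGaussian, norm_smul, ← Complex.ofReal_pow, mul_pow,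
      Real.norm_eq_abs, sq_abs, hc]
    push_cast
    congr 1
    ring
  · refine Integrable.of_bound (C := 1) ?_ (.of_forall fun q => ?_)
    · refine Continuous.aestronglyMeasurable ?_
      simp only [Function.uncurry_def]
      fun_prop
    · simp only [Function.uncurry_def]
      rw [Complex.norm_exp_ofReal_mul_I]

lemma sq_integral_norm_le {Ω : Type*} [MeasurableSpace Ω] (γ : Measure Ω) [IsProbabilityMeasure γ]
    {f : Ω → ℝ} (hf : MemLp f 2 γ) : (∫ z, f z ∂γ) ^ 2 ≤ ∫ z, f z ^ 2 ∂γ := by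
  have h := variance_nonneg f γ
  rw [variance_eq_sub hf] at h
  simpa using h

/-- The Gaussian kernel is positive definite. -/
lemma sq_gaussInteraction_sub_le (P Q R : Measure (Vec d)) [IsProbabilityMeasure P]
    [IsProbabilityMeasure Q] [IsProbabilityMeasure R] {s : ℝ} (hs : 0 ≤ s) :
    (gaussInteraction s P R - gaussInteraction s Q R) ^ 2
      ≤ gaussInteraction s P P + gaussInteraction s Q Q - gaussInteraction s P Q
        - gaussInteraction s Q P := by
  set c := √(2 * s)
  set γ := stdGaussian (Vec d)
  have hcont : ∀ M : Measure (Vec d), IsProbabilityMeasure M →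
      Continuous fun z : Vec d => charFun M (c • z) := fun M _ =>
    (continuous_charFun (μ := M)).comp (by fun_prop)
  have hint : ∀ M N : Measure (Vec d), IsProbabilityMeasure M → IsProbabilityMeasure N →
      Integrable (fun z => charFun M (c • z) * (starRingEnd ℂ) (charFun N (c • z))) γ := by
    intro M N hM hN
    refine Integrable.of_bound (C := 1 * 1) ?_ (.of_forall fun z => ?_)
    · exact ((hcont M hM).mul (Complex.continuous_conj.comp (hcont N hN))).aestronglyMeasurable
    · rw [norm_mul, RCLike.norm_conj]
      gcongr
      · exact norm_charFun_le_one _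
      · exact norm_charFun_le_one _
  -- The right side of the claim is ∫ ‖A‖² dγ and the left side is the square of ∫ A · conj(charFun
  -- R) dγ. As |charFun R| ≤ 1, Jensen's inequality concludes.
  set A : Vec d → ℂ := fun z => charFun P (c • z) - charFun Q (c • z)
  have hAc : Continuous A := (hcont P inferInstance).sub (hcont Q inferInstance)
  have hA2 : ∀ z, ‖A z‖ ≤ 2 := fun z => (norm_sub_le _ _).trans (by
    linarith [norm_charFun_le_one (μ := P) (c • z), norm_charFun_le_one (μ := Q) (c • z)])
  have e1 : ((∫ z, ‖A z‖ ^ 2 ∂γ : ℝ) : ℂ) = ((gaussInteraction s P P + gaussInteraction s Q Q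
      - gaussInteraction s P Q - gaussInteraction s Q P : ℝ) : ℂ) := by
    set f : Measure (Vec d) → Measure (Vec d) → Vec d → ℂ :=
      fun M N z => charFun M (c • z) * (starRingEnd ℂ) (charFun N (c • z))
    have hf : (fun z => ((‖A z‖ ^ 2 : ℝ) : ℂ)) = f P P + f Q Q - f P Q - f Q P := by
      ext z
      have : ((‖A z‖ ^ 2 : ℝ) : ℂ) = A z * (starRingEnd ℂ) (A z) := by
        rw [Complex.mul_conj, Complex.normSq_eq_norm_sq]
      rw [this]
      simp only [A, map_sub, f, Pi.sub_apply, Pi.add_apply]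
      ring
    have i1 := hint P P inferInstance inferInstance
    have i2 := hint Q Q inferInstance inferInstance
    have i3 := hint P Q inferInstance inferInstance
    have i4 := hint Q P inferInstance inferInstance
    rw [← integral_complex_ofReal, hf, integral_sub' ((i1.add i2).sub i3) i4,
      integral_sub' (i1.add i2) i3, integral_add' i1 i2]
    simp only [γ, c]
    rw [integral_charFun_mul_conj P P hs, integral_charFun_mul_conj Q Q hs,
      integral_charFun_mul_conj P Q hs, integral_charFun_mul_conj Q P hs]
    push_cast
    ring
  have e2 : ((gaussInteraction s P R - gaussInteraction s Q R : ℝ) : ℂ)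
      = ∫ z, A z * (starRingEnd ℂ) (charFun R (c • z)) ∂γ := by
    push_cast
    rw [← integral_charFun_mul_conj P R hs, ← integral_charFun_mul_conj Q R hs,
      ← integral_sub (hint P R inferInstance inferInstance) (hint Q R inferInstance inferInstance)]
    congr 1
    ext z
    simp only [A]
    ring
  have hL : MemLp (fun z => ‖A z‖) 2 γ :=
    MemLp.of_bound hAc.norm.aestronglyMeasurable 2 (.of_forall fun z => by simpa using hA2 z)
  have e3 : |gaussInteraction s P R - gaussInteraction s Q R| ≤ ∫ z, ‖A z‖ ∂γ := by
    rw [← Real.norm_eq_abs, ← Complex.norm_real, e2]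
    refine norm_integral_le_of_norm_le (hL.integrable (by norm_num)) (.of_forall fun z => ?_)
    rw [norm_mul, RCLike.norm_conj]
    exact mul_le_of_le_one_right (norm_nonneg _) (norm_charFun_le_one _)
  rw [← Complex.ofReal_inj.1 e1, ← sq_abs]
  exact (pow_le_pow_left₀ (abs_nonneg _) e3 2).trans (sq_integral_norm_le γ hL)

/-! #### The norm as a mixture of Gaussians -/

/-- The integrand is at most s^(−1/2) near 0 and at most s^(−3/2) at infinity. -/
lemma integrableOn_one_sub_exp_mul_rpow :
    IntegrableOn (fun s : ℝ => (1 - Real.exp (-s)) * s ^ (-(3 / 2) : ℝ)) (Ioi 0) := by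
  have hm : Measurable fun s : ℝ => (1 - Real.exp (-s)) * s ^ (-(3 / 2) : ℝ) := by fun_prop
  rw [← Ioc_union_Ioi_eq_Ioi zero_le_one]
  refine IntegrableOn.union ?_ ?_
  · have h : IntegrableOn (fun s : ℝ => s ^ (-(1 / 2) : ℝ)) (Ioc 0 1) :=
      (intervalIntegrable_iff_integrableOn_Ioc_of_le zero_le_one).1
        (intervalIntegral.intervalIntegrable_rpow' (by norm_num))
    refine h.mono' hm.aestronglyMeasurable ?_
    refine (ae_restrict_mem measurableSet_Ioc).mono fun s hs => ?_
    have hs0 : 0 < s := hs.1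
    have h1 : 0 ≤ 1 - Real.exp (-s) := by
      have := Real.exp_le_one_iff.2 (neg_nonpos.2 hs0.le); linarith
    have h2 : 1 - Real.exp (-s) ≤ s := by linarith [Real.add_one_le_exp (-s)]
    rw [Real.norm_eq_abs, abs_of_nonneg (by positivity)]
    calc _ ≤ s * s ^ (-(3 / 2) : ℝ) := by gcongr
      _ = s ^ (-(1 / 2) : ℝ) := by
        rw [← Real.rpow_one_add' hs0.le (by norm_num)]; norm_num
  · refine (integrableOn_Ioi_rpow_of_lt (by norm_num : (-(3 / 2) : ℝ) < -1) one_pos).mono'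
      hm.aestronglyMeasurable ?_
    refine (ae_restrict_mem measurableSet_Ioi).mono fun s hs => ?_
    have hs0 : (0 : ℝ) < s := one_pos.trans hs
    have h1 : 0 ≤ 1 - Real.exp (-s) := by
      have := Real.exp_le_one_iff.2 (neg_nonpos.2 hs0.le); linarith
    rw [Real.norm_eq_abs, abs_of_nonneg (by positivity)]
    exact mul_le_of_le_one_left (by positivity) (by linarith [Real.exp_pos (-s)])

/-- The normalizing constant of the representation of the norm as a mixture of Gaussians. -/
noncomputable def normMixtureConst : ℝ := ∫ s in Ioi (0 : ℝ), (1 - Real.exp (-s)) * s ^ (-(3 / 2) : ℝ)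

/-- The substitution s ↦ a² s has Jacobian a⁻², so the factor a³ leaves exactly one power of a: the
mixture integral is linear in a. -/
lemma one_sub_exp_mul_rpow_scaling {a : ℝ} (ha : 0 < a) {s : ℝ} (hs : 0 < s) :
    (1 - Real.exp (-s * a ^ 2)) * s ^ (-(3 / 2) : ℝ)
      = a ^ 3 * ((1 - Real.exp (-(a ^ 2 * s))) * (a ^ 2 * s) ^ (-(3 / 2) : ℝ)) := by
  have h1 : (a ^ 2 * s) ^ (-(3 / 2) : ℝ) = (a ^ 3)⁻¹ * s ^ (-(3 / 2) : ℝ) := by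
    rw [Real.mul_rpow (by positivity) hs.le]
    congr 1
    rw [← Real.rpow_natCast a 2, ← Real.rpow_mul ha.le, ← Real.rpow_natCast a 3,
      ← Real.rpow_neg ha.le]
    norm_num
  rw [h1]
  field_simp

lemma integrableOn_norm_mixture {a : ℝ} (ha : 0 ≤ a) :
    IntegrableOn (fun s : ℝ => (1 - Real.exp (-s * a ^ 2)) * s ^ (-(3 / 2) : ℝ)) (Ioi 0) := by
  rcases ha.eq_or_lt with rfl | ha
  · simp
  · have h := (integrableOn_Ioi_comp_mul_left_iff
      (fun s : ℝ => (1 - Real.exp (-s)) * s ^ (-(3 / 2) : ℝ)) 0 (pow_pos ha 2)).2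
      (by simpa using integrableOn_one_sub_exp_mul_rpow)
    refine IntegrableOn.congr_fun (h.const_mul (a ^ 3)) (fun s hs => ?_) measurableSet_Ioi
    exact (one_sub_exp_mul_rpow_scaling ha hs).symm

lemma integral_norm_mixture {a : ℝ} (ha : 0 ≤ a) :
    ∫ s in Ioi (0 : ℝ), (1 - Real.exp (-s * a ^ 2)) * s ^ (-(3 / 2) : ℝ)
      = normMixtureConst * a := by
  rcases ha.eq_or_lt with rfl | ha
  · simp
  · rw [setIntegral_congr_fun measurableSet_Ioi
      (fun s hs => one_sub_exp_mul_rpow_scaling ha hs), integral_const_mul,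
      integral_comp_mul_left_Ioi (fun s : ℝ => (1 - Real.exp (-s)) * s ^ (-(3 / 2) : ℝ)) 0
        (pow_pos ha 2), mul_zero, smul_eq_mul, ← normMixtureConst]
    field_simp

lemma normMixtureConst_nonneg : 0 ≤ normMixtureConst := by
  refine setIntegral_nonneg measurableSet_Ioi fun s hs => ?_
  have hs0 : (0 : ℝ) < s := hs
  have := Real.exp_le_one_iff.2 (neg_nonpos.2 hs0.le)
  exact mul_nonneg (by linarith) (by positivity)

end Energy

/-! ### From mean distance functions to truncated inverse squares. -/

section EnergyBound
variable {d : ℕ}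

lemma integrable_norm_sub_prod {P Q : Measure (Vec d)} [IsProbabilityMeasure P]
    [IsProbabilityMeasure Q] (hP : Integrable (fun y => ‖y‖) P)
    (hQ : Integrable (fun y => ‖y‖) Q) :
    Integrable (fun p : Vec d × Vec d => ‖p.1 - p.2‖) (P.prod Q) := by
  refine Integrable.mono' ((hP.comp_fst Q).add (hQ.comp_snd P))
    (by fun_prop) (.of_forall fun p => ?_)
  rw [norm_norm]
  exact norm_sub_le _ _

lemma measurable_norm_mixture : Measurable fun p : ℝ × ℝ =>
    (1 - Real.exp (-p.1 * p.2 ^ 2)) * p.1 ^ (-(3 / 2) : ℝ) := by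
  fun_prop

lemma integral_norm_norm_mixture {a : ℝ} (ha : 0 ≤ a) :
    ∫ s in Ioi (0 : ℝ), ‖(1 - Real.exp (-s * a ^ 2)) * s ^ (-(3 / 2) : ℝ)‖
      = normMixtureConst * a := by
  rw [← integral_norm_mixture ha]
  refine setIntegral_congr_fun measurableSet_Ioi fun s hs => ?_
  have hs0 : (0 : ℝ) < s := hs
  have : Real.exp (-s * a ^ 2) ≤ 1 := Real.exp_le_one_iff.2 (by nlinarith [sq_nonneg a])
  exact abs_of_nonneg (mul_nonneg (by linarith) (by positivity))

/-- By Tonelli: the integral over s of the absolute value is a constant times ‖x − y‖, which is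
integrable by the first moments. -/
lemma integrable_gauss_mixture_prod {P Q : Measure (Vec d)} [IsProbabilityMeasure P]
    [IsProbabilityMeasure Q] (hP : Integrable (fun y => ‖y‖) P)
    (hQ : Integrable (fun y => ‖y‖) Q) :
    Integrable (fun q : ℝ × (Vec d × Vec d) =>
        (1 - Real.exp (-q.1 * ‖q.2.1 - q.2.2‖ ^ 2)) * q.1 ^ (-(3 / 2) : ℝ))
      ((volume.restrict (Ioi (0 : ℝ))).prod (P.prod Q)) := by
  have hf : Measurable fun q : ℝ × (Vec d × Vec d) => (q.1, ‖q.2.1 - q.2.2‖) :=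
    measurable_fst.prodMk (measurable_snd.fst.sub measurable_snd.snd).norm
  have hm : Measurable fun q : ℝ × (Vec d × Vec d) =>
      (1 - Real.exp (-q.1 * ‖q.2.1 - q.2.2‖ ^ 2)) * q.1 ^ (-(3 / 2) : ℝ) :=
    measurable_norm_mixture.comp hf
  have h1 : ∀ p : Vec d × Vec d, Integrable (fun s : ℝ =>
      (1 - Real.exp (-s * ‖p.1 - p.2‖ ^ 2)) * s ^ (-(3 / 2) : ℝ)) (volume.restrict (Ioi 0)) :=
    fun p => integrableOn_norm_mixture (norm_nonneg (p.1 - p.2))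
  have h2 : Integrable (fun p : Vec d × Vec d => ∫ s in Ioi (0 : ℝ),
      ‖(1 - Real.exp (-s * ‖p.1 - p.2‖ ^ 2)) * s ^ (-(3 / 2) : ℝ)‖) (P.prod Q) := by
    simp_rw [integral_norm_norm_mixture (norm_nonneg _)]
    exact (integrable_norm_sub_prod hP hQ).const_mul normMixtureConst
  exact (integrable_prod_iff' hm.aestronglyMeasurable).2 ⟨.of_forall h1, h2⟩

lemma integrable_exp_neg_norm_sub {P Q : Measure (Vec d)} [IsProbabilityMeasure P]
    [IsProbabilityMeasure Q] {s : ℝ} (hs : 0 ≤ s) :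
    Integrable (fun p : Vec d × Vec d => Real.exp (-s * ‖p.1 - p.2‖ ^ 2)) (P.prod Q) := by
  refine Integrable.of_bound (C := 1) (by fun_prop) (.of_forall fun p => ?_)
  rw [Real.norm_eq_abs, Real.abs_exp]
  exact Real.exp_le_one_iff.2 (by nlinarith [sq_nonneg ‖p.1 - p.2‖])

lemma gauss_section_eq {P Q : Measure (Vec d)} [IsProbabilityMeasure P]
    [IsProbabilityMeasure Q] {s : ℝ} (hs : 0 ≤ s) :
    ∫ p, (1 - Real.exp (-s * ‖p.1 - p.2‖ ^ 2)) * s ^ (-(3 / 2) : ℝ) ∂(P.prod Q)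
      = (1 - gaussInteraction s P Q) * s ^ (-(3 / 2) : ℝ) := by
  rw [integral_mul_const, integral_sub (integrable_const _) (integrable_exp_neg_norm_sub hs)]
  simp [gaussInteraction]

lemma integrableOn_gaussInteraction {P Q : Measure (Vec d)} [IsProbabilityMeasure P]
    [IsProbabilityMeasure Q] (hP : Integrable (fun y => ‖y‖) P)
    (hQ : Integrable (fun y => ‖y‖) Q) :
    IntegrableOn (fun s => (1 - gaussInteraction s P Q) * s ^ (-(3 / 2) : ℝ)) (Ioi 0) := by
  have h := (integrable_gauss_mixture_prod hP hQ).integral_prod_left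
  exact IntegrableOn.congr_fun h (fun s hs => gauss_section_eq (le_of_lt hs)) measurableSet_Ioi

lemma integral_gaussInteraction {P Q : Measure (Vec d)} [IsProbabilityMeasure P]
    [IsProbabilityMeasure Q] (hP : Integrable (fun y => ‖y‖) P)
    (hQ : Integrable (fun y => ‖y‖) Q) :
    ∫ s in Ioi (0 : ℝ), (1 - gaussInteraction s P Q) * s ^ (-(3 / 2) : ℝ)
      = normMixtureConst * ∫ p, ‖p.1 - p.2‖ ∂(P.prod Q) := by
  rw [← setIntegral_congr_fun measurableSet_Ioi
    (fun s hs => gauss_section_eq (P := P) (Q := Q) (le_of_lt hs)),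
    integral_integral_swap (f := fun (s : ℝ) (p : Vec d × Vec d) =>
      (1 - Real.exp (-s * ‖p.1 - p.2‖ ^ 2)) * s ^ (-(3 / 2) : ℝ))
      (integrable_gauss_mixture_prod hP hQ), ← integral_const_mul]
  congr 1
  ext p
  exact integral_norm_mixture (norm_nonneg _)

/-- The energy distance is controlled by the difference of the mean distance functions. -/
lemma energy_le {P Q : Measure (Vec d)} [IsProbabilityMeasure P]
    [IsProbabilityMeasure Q] (hP : Integrable (fun y => ‖y‖) P)
    (hQ : Integrable (fun y => ‖y‖) Q) {η : ℝ}
    (h : ∀ u, |∫ y, ‖y - u‖ ∂P - ∫ y, ‖y - u‖ ∂Q| ≤ η) :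
    ∫ p, ‖p.1 - p.2‖ ∂(P.prod Q) + ∫ p, ‖p.1 - p.2‖ ∂(Q.prod P)
      - ∫ p, ‖p.1 - p.2‖ ∂(P.prod P) - ∫ p, ‖p.1 - p.2‖ ∂(Q.prod Q) ≤ 2 * η := by
  -- The energy distance regroups as ∫ (G_P − G_Q) dQ + ∫ (G_Q − G_P) dP, where G denotes the mean
  -- distance function; each part is at most η.
  have key : ∀ M N : Measure (Vec d), IsProbabilityMeasure M → IsProbabilityMeasure N →
      Integrable (fun y => ‖y‖) M → Integrable (fun y => ‖y‖) N →
      ∫ p, ‖p.1 - p.2‖ ∂(M.prod N) - ∫ p, ‖p.1 - p.2‖ ∂(N.prod N)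
        = ∫ u, (∫ y, ‖y - u‖ ∂M - ∫ y, ‖y - u‖ ∂N) ∂N := by
    intro M N _ _ hM hN
    rw [integral_prod_symm _ (integrable_norm_sub_prod hM hN),
      integral_prod_symm _ (integrable_norm_sub_prod hN hN),
      integral_sub (integrable_norm_sub_prod hM hN).integral_prod_right
        (integrable_norm_sub_prod hN hN).integral_prod_right]
  have hb : ∀ M N : Measure (Vec d), IsProbabilityMeasure N →
      (∀ u, |∫ y, ‖y - u‖ ∂M - ∫ y, ‖y - u‖ ∂N| ≤ η) →
      ∫ u, (∫ y, ‖y - u‖ ∂M - ∫ y, ‖y - u‖ ∂N) ∂N ≤ η := by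
    intro M N _ hMN
    have := norm_integral_le_of_norm_le_const (μ := N) (C := η)
      (f := fun u => ∫ y, ‖y - u‖ ∂M - ∫ y, ‖y - u‖ ∂N) (.of_forall hMN)
    simp only [probReal_univ, mul_one] at this
    exact (le_abs_self _).trans this
  have h1 := key P Q inferInstance inferInstance hP hQ
  have h2 := key Q P inferInstance inferInstance hQ hP
  have h3 := hb P Q inferInstance h
  have h4 := hb Q P inferInstance fun u => by rw [abs_sub_comm]; exact h u
  linarith

/-- The function `t ↦ ∫₀^S exp (-s t²) ds`. -/
noncomputable def gaussMixture (S t : ℝ) : ℝ := ∫ s in Ioc 0 S, Real.exp (-s * t ^ 2)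

lemma gaussInteraction_dirac (s : ℝ) (P : Measure (Vec d)) [IsProbabilityMeasure P] (m : Vec d) :
    gaussInteraction s P (Measure.dirac m) = ∫ y, Real.exp (-s * ‖y - m‖ ^ 2) ∂P := by
  rw [gaussInteraction, Measure.prod_dirac, integral_map (by fun_prop) (by fun_prop)]

lemma integrable_exp_neg_Ioc (P : Measure (Vec d)) [IsProbabilityMeasure P] (m : Vec d) (S : ℝ) :
    Integrable (Function.uncurry fun (s : ℝ) (y : Vec d) => Real.exp (-s * ‖y - m‖ ^ 2))
      ((volume.restrict (Ioc (0 : ℝ) S)).prod P) := by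
  refine Integrable.of_bound (C := 1) ?_ ?_
  · refine Continuous.aestronglyMeasurable ?_
    simp only [Function.uncurry_def]
    fun_prop
  · have h := (ae_restrict_mem (μ := (volume : Measure ℝ)) (measurableSet_Ioc (a := (0:ℝ)) (b := S)))
    have := (Measure.quasiMeasurePreserving_fst (μ := volume.restrict (Ioc (0 : ℝ) S))
      (ν := P)).ae h
    filter_upwards [this] with q hq
    simp only [Function.uncurry_def, Real.norm_eq_abs, Real.abs_exp]
    exact Real.exp_le_one_iff.2 (by nlinarith [sq_nonneg ‖q.2 - m‖, hq.1])

lemma integral_gaussInteraction_dirac (P : Measure (Vec d)) [IsProbabilityMeasure P] (m : Vec d)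
    (S : ℝ) :
    ∫ s in Ioc 0 S, gaussInteraction s P (Measure.dirac m)
      = ∫ y, gaussMixture S ‖y - m‖ ∂P := by
  simp_rw [gaussInteraction_dirac, gaussMixture]
  exact integral_integral_swap (integrable_exp_neg_Ioc P m S)

lemma integrableOn_gaussInteraction_dirac (P : Measure (Vec d)) [IsProbabilityMeasure P]
    (m : Vec d) (S : ℝ) :
    IntegrableOn (fun s => gaussInteraction s P (Measure.dirac m)) (Ioc 0 S) := by
  simp_rw [gaussInteraction_dirac]
  exact (integrable_exp_neg_Ioc P m S).integral_prod_left

/-- Closeness of the mean distance functions implies closeness of the integrals of Gaussian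
mixtures. -/
lemma abs_integral_gaussMixture_sub_le {P Q : Measure (Vec d)} [IsProbabilityMeasure P]
    [IsProbabilityMeasure Q] (hP : Integrable (fun y => ‖y‖) P)
    (hQ : Integrable (fun y => ‖y‖) Q) {η : ℝ}
    (h : ∀ u, |∫ y, ‖y - u‖ ∂P - ∫ y, ‖y - u‖ ∂Q| ≤ η) (m : Vec d) {S l : ℝ} (hS : 0 < S)
    (hl : 0 < l) :
    |∫ y, gaussMixture S ‖y - m‖ ∂P - ∫ y, gaussMixture S ‖y - m‖ ∂Q|
      ≤ S * l + S ^ (3 / 2 : ℝ) / l * (normMixtureConst * (2 * η)) := by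
  set w : ℝ → ℝ := fun s => s ^ (-(3 / 2) : ℝ)
  set J : ℝ → ℝ := fun s => gaussInteraction s P P + gaussInteraction s Q Q
    - gaussInteraction s P Q - gaussInteraction s Q P
  set δ : ℝ → ℝ := fun s => gaussInteraction s P (Measure.dirac m)
    - gaussInteraction s Q (Measure.dirac m)
  have hJw : (fun s => J s * w s) = fun s => (1 - gaussInteraction s P Q) * w s
      + (1 - gaussInteraction s Q P) * w s - (1 - gaussInteraction s P P) * w s
      - (1 - gaussInteraction s Q Q) * w s := by
    ext s
    simp only [J]
    ring
  have i1 := integrableOn_gaussInteraction hP hQ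
  have i2 := integrableOn_gaussInteraction hQ hP
  have i3 := integrableOn_gaussInteraction hP hP
  have i4 := integrableOn_gaussInteraction hQ hQ
  have hJi : IntegrableOn (fun s => J s * w s) (Ioi 0) := by
    rw [hJw]
    exact ((i1.add i2).sub i3).sub i4
  have hJint : ∫ s in Ioi (0 : ℝ), J s * w s ≤ normMixtureConst * (2 * η) := by
    have e1 := integral_sub ((i1.add i2).sub i3) i4
    have e2 := integral_sub (i1.add i2) i3
    have e3 := integral_add i1 i2
    simp only [Pi.add_apply, Pi.sub_apply] at e1 e2
    rw [hJw, e1, e2, e3, integral_gaussInteraction hP hQ, integral_gaussInteraction hQ hP,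
      integral_gaussInteraction hP hP, integral_gaussInteraction hQ hQ, ← mul_add, ← mul_sub,
      ← mul_sub]
    exact mul_le_mul_of_nonneg_left (energy_le hP hQ h) normMixtureConst_nonneg
  have hδJ : ∀ s, 0 ≤ s → δ s ^ 2 ≤ J s := fun s hs =>
    sq_gaussInteraction_sub_le P Q (Measure.dirac m) hs
  have hδi : IntegrableOn δ (Ioc 0 S) :=
    (integrableOn_gaussInteraction_dirac P m S).sub (integrableOn_gaussInteraction_dirac Q m S)
  have hJi' : IntegrableOn (fun s => J s * w s) (Ioc 0 S) := hJi.mono_set Ioc_subset_Ioi_self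
  -- The energy distance controls only the weighted integral of δ². The bound |δ| ≤ l + δ²/l passes
  -- from δ to δ² with a free level l, and on (0, S] the weight s^(−3/2) is at least S^(−3/2).
  have hpt : ∀ s ∈ Ioc 0 S, ‖δ s‖ ≤ l + S ^ (3 / 2 : ℝ) / l * (J s * w s) := by
    intro s hs
    have hJ0 : 0 ≤ J s := (sq_nonneg _).trans (hδJ s hs.1.le)
    have h1 : 1 ≤ S ^ (3 / 2 : ℝ) * w s := by
      simp only [w]
      rw [Real.rpow_neg hs.1.le, ← div_eq_mul_inv, one_le_div (Real.rpow_pos_of_pos hs.1 _)]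
      exact Real.rpow_le_rpow hs.1.le hs.2 (by norm_num)
    have h2 : |δ s| ≤ l + δ s ^ 2 / l := by
      rw [← sq_abs (δ s)]
      have : l + |δ s| ^ 2 / l - |δ s| = ((|δ s| - l / 2) ^ 2 + 3 / 4 * l ^ 2) / l := by
        field_simp
        ring
      have h3 : 0 ≤ ((|δ s| - l / 2) ^ 2 + 3 / 4 * l ^ 2) / l := by positivity
      linarith
    rw [Real.norm_eq_abs]
    refine h2.trans ?_
    gcongr
    rw [div_mul_eq_mul_div]
    gcongr
    calc δ s ^ 2 ≤ J s := hδJ s hs.1.le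
      _ ≤ J s * (S ^ (3 / 2 : ℝ) * w s) := le_mul_of_one_le_right hJ0 h1
      _ = _ := by ring
  rw [← integral_gaussInteraction_dirac, ← integral_gaussInteraction_dirac,
    ← integral_sub (integrableOn_gaussInteraction_dirac P m S)
      (integrableOn_gaussInteraction_dirac Q m S), ← Real.norm_eq_abs]
  have hconst : IntegrableOn (fun _ : ℝ => l) (Ioc 0 S) := integrableOn_const (by simp)
  calc ‖∫ s in Ioc 0 S, δ s‖ ≤ ∫ s in Ioc 0 S, (l + S ^ (3 / 2 : ℝ) / l * (J s * w s)) :=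
        norm_integral_le_of_norm_le (hconst.add (hJi'.const_mul _))
          ((ae_restrict_mem measurableSet_Ioc).mono hpt)
    _ = S * l + S ^ (3 / 2 : ℝ) / l * ∫ s in Ioc 0 S, J s * w s := by
        rw [integral_add hconst (hJi'.const_mul _), integral_const_mul]
        simp [hS.le]
    _ ≤ _ := by
        gcongr
        refine le_trans (setIntegral_mono_set hJi ?_ (Ioc_subset_Ioi_self.eventuallyLE)) hJint
        refine (ae_restrict_mem measurableSet_Ioi).mono fun s hs => ?_
        have hs0 : (0 : ℝ) < s := hs
        exact mul_nonneg ((sq_nonneg _).trans (hδJ s hs0.le)) (Real.rpow_nonneg hs0.le _)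

end EnergyBound

/-! ### Uniform integrability of the inverse square distance -/

section GaussMixture

lemma gaussMixture_eq {S t : ℝ} (hS : 0 ≤ S) (ht : t ≠ 0) :
    gaussMixture S t = (1 - Real.exp (-(S * t ^ 2))) / t ^ 2 := by
  have ht2 : t ^ 2 ≠ 0 := pow_ne_zero 2 ht
  rw [gaussMixture, ← intervalIntegral.integral_of_le hS,
    intervalIntegral.integral_eq_sub_of_hasDerivAt
      (f := fun s => -Real.exp (-s * t ^ 2) / t ^ 2)]
  · simp
    ring
  · intro s _
    have h1 : HasDerivAt (fun s : ℝ => -s * t ^ 2) (-1 * t ^ 2) s :=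
      ((hasDerivAt_id s).neg).mul_const _
    refine (h1.exp.neg.div_const (t ^ 2)).congr_deriv ?_
    field_simp
  · exact Continuous.intervalIntegrable (by fun_prop) _ _

lemma gaussMixture_zero {S : ℝ} (hS : 0 ≤ S) : gaussMixture S 0 = S := by
  simp [gaussMixture, hS]

lemma gaussMixture_nonneg (S t : ℝ) : 0 ≤ gaussMixture S t :=
  integral_nonneg fun _ => (Real.exp_pos _).le

lemma gaussMixture_le {S : ℝ} (hS : 0 ≤ S) (t : ℝ) : gaussMixture S t ≤ S := by
  rcases eq_or_ne t 0 with rfl | ht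
  · exact (gaussMixture_zero hS).le
  · rw [gaussMixture_eq hS ht, div_le_iff₀ (by positivity)]
    linarith [Real.add_one_le_exp (-(S * t ^ 2))]

lemma measurable_gaussMixture {S : ℝ} (hS : 0 ≤ S) : Measurable (gaussMixture S) := by
  have : gaussMixture S = fun t => if t = 0 then S else (1 - Real.exp (-(S * t ^ 2))) / t ^ 2 := by
    ext t
    split_ifs with h
    · rw [h, gaussMixture_zero hS]
    · exact gaussMixture_eq hS h
  rw [this]
  exact Measurable.ite (measurableSet_singleton 0) measurable_const (by fun_prop)

/-- Integrating exp(−s t²) over (0, S] gives (1 − exp(−S t²)) / t², a truncation of t⁻² bounded by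
S; the other term is the tail concentrated near 0. At z = 0 both sides are infinite. -/
lemma enorm_rpow_neg_two_eq {E : Type*} [NormedAddCommGroup E] {S : ℝ} (hS : 0 ≤ S) (z : E) :
    ‖z‖ₑ ^ (-2 : ℝ) = ENNReal.ofReal (gaussMixture S ‖z‖)
      + ENNReal.ofReal (Real.exp (-(S * ‖z‖ ^ 2))) * ‖z‖ₑ ^ (-2 : ℝ) := by
  rcases eq_or_ne z 0 with rfl | hz
  · simp
  · have ht : 0 < ‖z‖ := norm_pos_iff.2 hz
    have h1 : ‖z‖ₑ ^ (-2 : ℝ) = ENNReal.ofReal ((‖z‖ ^ 2)⁻¹) := by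
      rw [← ofReal_norm, ENNReal.ofReal_rpow_of_pos ht, Real.rpow_neg ht.le]
      norm_num
    rw [h1, ← ENNReal.ofReal_mul (Real.exp_pos _).le, ← ENNReal.ofReal_add
      (gaussMixture_nonneg _ _) (by positivity), gaussMixture_eq hS ht.ne']
    congr 1
    field_simp
    ring

end GaussMixture

section UniformIntegrability
variable {d : ℕ} {F : Type*} [PseudoMetricSpace F] [MeasurableSpace F]
  {κ : Kernel F (Vec d)} [IsMarkovKernel κ] {x : F} {μ : Vec d} {β : ℝ}

lemma MomentAssumption.integrable_norm (hm : MomentAssumption κ x μ) (x' : F) :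
    Integrable (fun y => ‖y‖) (κ x') := by
  obtain ⟨m, hm1, h, -⟩ := hm.moment
  have h0 : condMoment κ m x' 0 < ∞ := by
    refine lt_of_le_of_lt ?_ (h x' 0)
    exact le_iSup₂ (f := fun u (_ : u ∈ Metric.closedBall (0 : Vec d) 0) => condMoment κ m x' u)
      0 (by simp)
  refine ⟨by fun_prop, ?_⟩
  rw [HasFiniteIntegral]
  calc ∫⁻ y, ‖‖y‖‖ₑ ∂κ x' ≤ ∫⁻ y, (1 + ‖y - 0‖ₑ ^ (m : ℝ)) ∂κ x' := by
        refine lintegral_mono fun y => ?_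
        simp only [enorm_norm, sub_zero, ENNReal.rpow_natCast]
        rcases le_total ‖y‖ₑ 1 with h1 | h1
        · exact h1.trans le_self_add
        · exact (le_self_pow₀ h1 (by omega)).trans le_add_self
    _ = 1 + condMoment κ m x' 0 := by
        rw [lintegral_add_left measurable_const]
        simp [condMoment]
    _ < ∞ := ENNReal.add_lt_top.2 ⟨ENNReal.one_lt_top, h0⟩

lemma integrable_norm_sub (hm : MomentAssumption κ x μ) (x' : F) (u : Vec d) :
    Integrable (fun y => ‖y - u‖) (κ x') := by
  refine ((hm.integrable_norm x').add (integrable_const ‖u‖)).mono' (by fun_prop)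
    (.of_forall fun y => ?_)
  rw [norm_norm]
  exact norm_sub_le _ _

/-- The Hölder condition is uniform in u, so it supplies the sup-norm closeness of mean distance
functions required by the energy bound. This is the only form of weak continuity of the conditional
laws that is needed. -/
lemma tendsto_integral_gaussMixture (hs : SmoothnessAssumption κ x μ β)
    (hm : MomentAssumption κ x μ) {S : ℝ} (hS : 0 < S) :
    Tendsto (fun x' => ∫ y, gaussMixture S ‖y - μ‖ ∂κ x') (𝓝 x)
      (𝓝 (∫ y, gaussMixture S ‖y - μ‖ ∂κ x)) := by
  obtain ⟨hβ, c, hc, h⟩ := hs.holder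
  rw [Metric.tendsto_nhds]
  intro ε hε
  have hdist : Tendsto (fun x' => c * dist x x' ^ β) (𝓝 x) (𝓝 0) := by
    have h1 : Tendsto (fun x' => dist x x') (𝓝 x) (𝓝 0) := by
      simpa using (continuous_const.dist continuous_id : Continuous fun x' => dist x x').tendsto x
    have h2 := (h1.rpow_const (.inr hβ.le)).const_mul c
    simpa [Real.zero_rpow hβ.ne'] using h2
  -- This level makes the error S l equal to ε/2; the remaining error carries the factor dist(x,
  -- x')^β and tends to 0.
  set l := ε / (2 * S)
  have hl : 0 < l := by positivity
  have hη : Tendsto (fun x' => S * l + S ^ (3 / 2 : ℝ) / l * (normMixtureConst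
      * (2 * (c * dist x x' ^ β)))) (𝓝 x) (𝓝 (S * l + S ^ (3 / 2 : ℝ) / l * (normMixtureConst
      * (2 * 0)))) :=
    tendsto_const_nhds.add (((hdist.const_mul 2).const_mul _).const_mul _)
  have hlt : S * l + S ^ (3 / 2 : ℝ) / l * (normMixtureConst * (2 * 0)) < ε := by
    have : S * l = ε / 2 := by simp only [l]; field_simp
    rw [this]
    linarith [half_lt_self hε]
  filter_upwards [h, hη.eventually_lt_const hlt] with x' h1 h2
  refine lt_of_le_of_lt ?_ h2
  rw [dist_comm, Real.dist_eq]
  exact abs_integral_gaussMixture_sub_le (hm.integrable_norm x) (hm.integrable_norm x')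
    h1 μ hS hl

/-- The bound t⁻² ≤ 1 + t^(−m) for m ≥ 2 transfers local boundedness from the inverse moment of
order m. -/
lemma eventually_lintegral_enorm_rpow_le (hs : SmoothnessAssumption κ x μ β) :
    ∃ B : ℝ≥0∞, B ≠ ∞ ∧ ∀ᶠ x' in 𝓝 x, ∫⁻ y, ‖y - μ‖ₑ ^ (-2 : ℝ) ∂κ x' ≤ B := by
  obtain ⟨m, hm2, hfin, hcont⟩ := hs.invMoment
  refine ⟨1 + (condMoment κ (-m) x μ + 1), by simp [hfin.ne], ?_⟩
  have h1 := hcont.eventually_le_const (u := condMoment κ (-m) x μ + 1)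
    (ENNReal.lt_add_right hfin.ne one_ne_zero)
  filter_upwards [h1] with x' hx'
  calc ∫⁻ y, ‖y - μ‖ₑ ^ (-2 : ℝ) ∂κ x' ≤ ∫⁻ y, (1 + ‖y - μ‖ₑ ^ (-m : ℝ)) ∂κ x' := by
        refine lintegral_mono fun y => ?_
        rcases le_total ‖y - μ‖ₑ 1 with h2 | h2
        · refine le_trans ?_ le_add_self
          exact ENNReal.rpow_le_rpow_of_exponent_ge h2 (by
            have : (2 : ℝ) ≤ m := by exact_mod_cast hm2
            linarith)
        · refine le_trans ?_ le_self_add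
          rw [ENNReal.rpow_neg]
          exact ENNReal.inv_le_one.2 (ENNReal.one_le_rpow h2 (by norm_num))
    _ = 1 + condMoment κ (-m) x' μ := by
        rw [lintegral_add_left measurable_const]
        simp [condMoment]
    _ ≤ _ := by gcongr

/-- The inverse square distance to `μ` is uniformly integrable near zero under the conditional
laws close to `x`. -/
lemma exists_eventually_setLIntegral_le (hs : SmoothnessAssumption κ x μ β)
    (hm : MomentAssumption κ x μ) {ε : ℝ≥0∞} (hε : 0 < ε) :
    ∃ r : ℝ, 0 < r ∧ ∀ᶠ x' in 𝓝 x,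
      ∫⁻ y in {y | ‖y - μ‖ ≤ r}, ‖y - μ‖ₑ ^ (-2 : ℝ) ∂κ x' ≤ ε := by
  obtain ⟨m, hm2, hfin, hcont⟩ := hs.invMoment
  have hset : ∀ r : ℝ, MeasurableSet {y : Vec d | ‖y - μ‖ ≤ r} := fun r =>
    measurableSet_le (by fun_prop) measurable_const
  rcases hm2.eq_or_lt with rfl | hm3
  · have hA : ∀ x', condMoment κ (-(2 : ℕ)) x' μ = ∫⁻ y, ‖y - μ‖ₑ ^ (-2 : ℝ) ∂κ x' := by
      intro x'; simp [condMoment]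
    set R : ℝ → F → ℝ≥0∞ := fun S x' =>
      ∫⁻ y, ENNReal.ofReal (Real.exp (-(S * ‖y - μ‖ ^ 2))) * ‖y - μ‖ₑ ^ (-2 : ℝ) ∂κ x'
    have hgi : ∀ S, 0 < S → ∀ x', Integrable (fun y => gaussMixture S ‖y - μ‖) (κ x') := by
      intro S hS x'
      refine Integrable.of_bound (C := S) ?_ (.of_forall fun y => ?_)
      · exact ((measurable_gaussMixture hS.le).comp (by fun_prop)).aestronglyMeasurable
      · rw [Real.norm_eq_abs, abs_of_nonneg (gaussMixture_nonneg _ _)]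
        exact gaussMixture_le hS.le _
    have hdec : ∀ S, 0 < S → ∀ x', condMoment κ (-(2 : ℕ)) x' μ
        = ENNReal.ofReal (∫ y, gaussMixture S ‖y - μ‖ ∂κ x') + R S x' := by
      intro S hS x'
      rw [hA, ofReal_integral_eq_lintegral_ofReal (hgi S hS x')
        (.of_forall fun y => gaussMixture_nonneg _ _), ← lintegral_add_left]
      · exact lintegral_congr fun y => enorm_rpow_neg_two_eq hS.le _
      · exact ((measurable_gaussMixture hS.le).comp (by fun_prop)).ennreal_ofReal
    -- The tail is the full inverse second moment minus its truncated part. Both are continuous at x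
    -- and the subtracted one is finite, so the tail is continuous at x too.
    have hR : ∀ S, 0 < S → Tendsto (R S) (𝓝 x) (𝓝 (R S x)) := by
      intro S hS
      have e : ∀ x', R S x' = condMoment κ (-(2 : ℕ)) x' μ
          - ENNReal.ofReal (∫ y, gaussMixture S ‖y - μ‖ ∂κ x') := by
        intro x'
        rw [hdec S hS x', ENNReal.add_sub_cancel_left ENNReal.ofReal_ne_top]
      rw [e x, funext e]
      exact ENNReal.Tendsto.sub hcont
        (ENNReal.tendsto_ofReal (tendsto_integral_gaussMixture hs hm hS)) (.inl hfin.ne)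
    have hR0 : Tendsto (fun n : ℕ => R (n + 1) x) atTop (𝓝 0) := by
      have hne : ∀ᵐ y ∂κ x, ‖y - μ‖ₑ ^ (-2 : ℝ) < ∞ := by
        refine ae_lt_top (by fun_prop) ?_
        rw [← hA]; exact hfin.ne
      have := tendsto_lintegral_of_dominated_convergence (μ := κ x)
        (F := fun (n : ℕ) y => ENNReal.ofReal (Real.exp (-(((n : ℝ) + 1) * ‖y - μ‖ ^ 2)))
          * ‖y - μ‖ₑ ^ (-2 : ℝ)) (f := fun _ => 0)
        (fun y => ‖y - μ‖ₑ ^ (-2 : ℝ)) (fun n => by fun_prop) (fun n => .of_forall fun y => ?_)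
        (by rw [← hA]; exact hfin.ne) ?_
      · simpa using this
      · refine mul_le_of_le_one_left' ?_
        rw [← ENNReal.ofReal_one]
        refine ENNReal.ofReal_le_ofReal (Real.exp_le_one_iff.2 ?_)
        have : 0 ≤ ((n : ℝ) + 1) * ‖y - μ‖ ^ 2 := by positivity
        linarith
      · filter_upwards [hne] with y hy
        have hy0 : 0 < ‖y - μ‖ := by
          rw [norm_pos_iff]
          intro h0
          simp [h0] at hy
        have h1 : Tendsto (fun n : ℕ => -(((n : ℝ) + 1) * ‖y - μ‖ ^ 2)) atTop atBot :=
          tendsto_neg_atTop_atBot.comp (Tendsto.atTop_mul_const (by positivity)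
            (tendsto_atTop_add_const_right _ _ tendsto_natCast_atTop_atTop))
        have h2 := ENNReal.tendsto_ofReal (Real.tendsto_exp_atBot.comp h1)
        have h3 := ENNReal.Tendsto.mul_const (b := ‖y - μ‖ₑ ^ (-2 : ℝ)) h2 (.inr hy.ne)
        simpa using h3
    obtain ⟨n, hn⟩ := (hR0.eventually_lt_const (u := ε / 3)
      (ENNReal.div_pos hε.ne' (by simp))).exists
    have hS : (0 : ℝ) < n + 1 := by positivity
    -- On this ball the exponent S t² with S = n + 1 is at most 1, so the tail factor is at least
    -- e⁻¹ > 1/3 and three times the tail dominates t⁻².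
    refine ⟨1 / √(n + 1), by positivity, ?_⟩
    filter_upwards [(hR _ hS).eventually_lt_const hn] with x' hx'
    calc ∫⁻ y in {y | ‖y - μ‖ ≤ 1 / √(n + 1)}, ‖y - μ‖ₑ ^ (-2 : ℝ) ∂κ x'
        ≤ ∫⁻ y in {y | ‖y - μ‖ ≤ 1 / √(n + 1)}, 3 * (ENNReal.ofReal
            (Real.exp (-(((n : ℝ) + 1) * ‖y - μ‖ ^ 2))) * ‖y - μ‖ₑ ^ (-2 : ℝ)) ∂κ x' := by
          refine setLIntegral_mono' (hset _) fun y hy => ?_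
          rw [← mul_assoc]
          refine le_mul_of_one_le_left' ?_
          have h3 : (3 : ℝ≥0∞) = ENNReal.ofReal 3 := by simp
          rw [h3, ← ENNReal.ofReal_mul (by norm_num), ← ENNReal.ofReal_one]
          refine ENNReal.ofReal_le_ofReal ?_
          have h4 : ((n : ℝ) + 1) * ‖y - μ‖ ^ 2 ≤ 1 := by
            have h5 : ‖y - μ‖ ^ 2 ≤ (1 / √((n : ℝ) + 1)) ^ 2 :=
              pow_le_pow_left₀ (norm_nonneg _) hy 2
            rw [div_pow, Real.sq_sqrt hS.le, one_pow, le_div_iff₀ hS] at h5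
            linarith
          have h6 : Real.exp (-1) ≤ Real.exp (-(((n : ℝ) + 1) * ‖y - μ‖ ^ 2)) :=
            Real.exp_le_exp.2 (by linarith)
          have h7 : (1 : ℝ) ≤ 3 * Real.exp (-1) := by
            rw [Real.exp_neg, ← div_eq_mul_inv, one_le_div (Real.exp_pos _)]
            linarith [Real.exp_one_lt_d9]
          linarith
      _ ≤ ∫⁻ y, 3 * (ENNReal.ofReal
            (Real.exp (-(((n : ℝ) + 1) * ‖y - μ‖ ^ 2))) * ‖y - μ‖ₑ ^ (-2 : ℝ)) ∂κ x' :=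
          setLIntegral_le_lintegral _ _
      _ = 3 * R (n + 1) x' := lintegral_const_mul' _ _ (by simp)
      _ ≤ 3 * (ε / 3) := by gcongr
      _ = ε := ENNReal.mul_div_cancel (by simp) (by simp)
  -- For m ≥ 3 one power is to spare: t⁻² ≤ r t^(−m) when t ≤ r ≤ 1, and the moment of order −m is
  -- locally bounded.
  · set B := condMoment κ (-m) x μ + 1
    have hB : B ≠ ∞ := by simp [B, hfin.ne]
    have hB0 : B ≠ 0 := by simp [B]
    have h1 := hcont.eventually_le_const (u := B) (ENNReal.lt_add_right hfin.ne one_ne_zero)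
    obtain ⟨r, hr0, hr1⟩ : ∃ r : NNReal, 0 < r ∧ (r : ℝ≥0∞) < min 1 (ε / B) := by
      obtain ⟨r, hr0, hr1⟩ := ENNReal.lt_iff_exists_nnreal_btwn.1
        (lt_min one_pos (ENNReal.div_pos hε.ne' hB))
      exact ⟨r, by exact_mod_cast hr0, hr1⟩
    refine ⟨r, by exact_mod_cast hr0, ?_⟩
    filter_upwards [h1] with x' hx'
    calc ∫⁻ y in {y | ‖y - μ‖ ≤ r}, ‖y - μ‖ₑ ^ (-2 : ℝ) ∂κ x'
        ≤ ∫⁻ y in {y | ‖y - μ‖ ≤ r}, r * ‖y - μ‖ₑ ^ (-m : ℝ) ∂κ x' := by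
          refine setLIntegral_mono' (hset _) fun y hy => ?_
          have hy' : ‖y - μ‖ₑ ≤ r := by
            rw [enorm_le_coe]; exact_mod_cast hy
          have hle1 : ‖y - μ‖ₑ ≤ 1 := hy'.trans (hr1.le.trans (min_le_left _ _))
          rcases eq_or_ne ‖y - μ‖ₑ 0 with h0 | h0
          · have hm0 : (-(m : ℝ)) < 0 := by
              have : 0 < (m : ℝ) := by exact_mod_cast (by omega : 0 < m)
              linarith
            rw [h0, ENNReal.zero_rpow_of_neg hm0, ENNReal.mul_top (by exact_mod_cast hr0.ne')]
            exact le_top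
          · calc ‖y - μ‖ₑ ^ (-2 : ℝ) = ‖y - μ‖ₑ ^ (1 : ℝ) * ‖y - μ‖ₑ ^ (-3 : ℝ) := by
                  rw [← ENNReal.rpow_add _ _ h0 enorm_ne_top]; norm_num
              _ ≤ r * ‖y - μ‖ₑ ^ (-m : ℝ) := by
                  gcongr ?_ * ?_
                  · simpa using hy'
                  · refine ENNReal.rpow_le_rpow_of_exponent_ge hle1 ?_
                    have : (3 : ℝ) ≤ m := by exact_mod_cast hm3
                    linarith
      _ ≤ ∫⁻ y, r * ‖y - μ‖ₑ ^ (-m : ℝ) ∂κ x' := setLIntegral_le_lintegral _ _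
      _ = r * condMoment κ (-m) x' μ := lintegral_const_mul' _ _ (by simp)
      _ ≤ (ε / B) * B := by
          gcongr
          exact hr1.le.trans (min_le_right _ _)
      _ = ε := ENNReal.div_mul_cancel hB0 hB

end UniformIntegrability

/-! ### Localized conditional expectations -/

lemma eventually_forall_dist_le {F : Type*} [PseudoMetricSpace F] {x : F} {p : F → Prop}
    (hp : ∀ᶠ x' in 𝓝 x, p x') {h : ℕ → ℝ}
    (hlim : Tendsto h atTop (𝓝 0)) : ∀ᶠ n in atTop, ∀ x', dist x x' ≤ h n → p x' := by
  obtain ⟨ε, hε, hb⟩ := Metric.eventually_nhds_iff.1 hp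
  filter_upwards [hlim.eventually_lt_const hε] with n hn x' hx'
  exact hb (by rw [dist_comm]; exact hx'.trans_lt hn)

section Localized
variable {Ω F E : Type*} [MeasurableSpace Ω] [PseudoMetricSpace F] [MeasurableSpace F]
  [MeasurableSpace E] {P : Measure Ω} [IsProbabilityMeasure P] {X : Ω → F} {Y : Ω → E}
  {κ : Kernel F E} [IsMarkovKernel κ] {x : F}

lemma ProbabilityTheory.HasCondDistrib.lintegral_mul_le (hκ : HasCondDistrib Y X κ P) {w : F → ℝ≥0∞}
    (hw : Measurable w) {r : ℝ} (hsupp : ∀ x', r < dist x x' → w x' = 0) {f : E → ℝ≥0∞}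
    (hf : Measurable f) {B : ℝ≥0∞} (hB : ∀ x', dist x x' ≤ r → ∫⁻ y, f y ∂κ x' ≤ B) :
    ∫⁻ ω, w (X ω) * f (Y ω) ∂P ≤ B * ∫⁻ ω, w (X ω) ∂P := by
  have hX : AEMeasurable X P := hκ.aemeasurable_fst
  have : IsProbabilityMeasure (P.map X) := Measure.isProbabilityMeasure_map hX
  have h1 : ∫⁻ ω, w (X ω) * f (Y ω) ∂P = ∫⁻ q, w q.1 * f q.2 ∂(P.map X ⊗ₘ κ) :=
    HasLaw.lintegral_comp (f := fun q : F × E => w q.1 * f q.2) hκ (by fun_prop)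
  have h2 : Measurable fun a => ∫⁻ b, w (a, b).1 * f (a, b).2 ∂κ a :=
    Measurable.lintegral_kernel_prod_right' (f := fun q : F × E => w q.1 * f q.2) (by fun_prop)
  rw [h1, Measure.lintegral_compProd (by fun_prop), lintegral_map' h2.aemeasurable hX,
    ← lintegral_const_mul'' (f := fun ω => w (X ω)) _ (hw.comp_aemeasurable hX)]
  refine lintegral_mono fun ω => ?_
  simp only
  rw [lintegral_const_mul _ hf, mul_comm]
  rcases lt_or_ge r (dist x (X ω)) with h | h
  · simp [hsupp _ h]
  · gcongr
    exact hB _ h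

/-- Disintegrate along X: the conditional mean of f only matters where the weight is nonzero, that
is within distance r of x, where it is η-close to a. -/
lemma ProbabilityTheory.HasCondDistrib.abs_integral_mul_sub_le (hκ : HasCondDistrib Y X κ P)
    {w : F → ℝ}
    (hw : Measurable w) (hw0 : ∀ x', 0 ≤ w x') {r : ℝ} (hsupp : ∀ x', r < dist x x' → w x' = 0)
    (hwi : Integrable (fun ω => w (X ω)) P)
    {f : E → ℝ} (hf : Measurable f) (hwf : Integrable (fun ω => w (X ω) * f (Y ω)) P) {a η : ℝ}
    (hη : ∀ x', dist x x' ≤ r → |∫ y, f y ∂κ x' - a| ≤ η) :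
    |∫ ω, w (X ω) * f (Y ω) ∂P - a * ∫ ω, w (X ω) ∂P| ≤ η * ∫ ω, w (X ω) ∂P := by
  have hX : AEMeasurable X P := hκ.aemeasurable_fst
  have : IsProbabilityMeasure (P.map X) := Measure.isProbabilityMeasure_map hX
  have hm : Measurable fun q : F × E => w q.1 * f q.2 := by fun_prop
  have h1 : ∫ ω, w (X ω) * f (Y ω) ∂P = ∫ q, w q.1 * f q.2 ∂(P.map X ⊗ₘ κ) :=
    HasLaw.integral_comp (f := fun q : F × E => w q.1 * f q.2) hκ (by fun_prop)
  have hi : Integrable (fun q : F × E => w q.1 * f q.2) (P.map X ⊗ₘ κ) := by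
    rw [← hκ.map_eq]
    exact (integrable_map_measure hm.aestronglyMeasurable hκ.aemeasurable).2 hwf
  have hi' : Integrable (fun x' => ∫ y, w x' * f y ∂κ x') (P.map X) :=
    Integrable.integral_compProd (a := ()) (κ := Kernel.const Unit (P.map X))
      (η := Kernel.prodMkLeft Unit κ) hi
  have hsec : Integrable (fun ω => w (X ω) * ∫ y, f y ∂κ (X ω)) P := by
    have := hi'.comp_aemeasurable hX
    simpa [Function.comp_def, integral_const_mul] using this
  rw [h1, Measure.integral_compProd hi, integral_map hX
    hi'.aestronglyMeasurable]
  simp only [integral_const_mul]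
  rw [← integral_const_mul, ← integral_sub hsec (hwi.const_mul a), ← integral_const_mul,
    ← Real.norm_eq_abs]
  refine norm_integral_le_of_norm_le (hwi.const_mul η) (.of_forall fun ω => ?_)
  rw [mul_comm a, ← mul_sub, norm_mul, Real.norm_eq_abs, Real.norm_eq_abs, abs_of_nonneg (hw0 _),
    mul_comm]
  rcases lt_or_ge r (dist x (X ω)) with h | h
  · simp [hsupp _ h]
  · exact mul_le_mul_of_nonneg_right (hη _ h) (hw0 _)

end Localized

/-! ### The conditional law near `x` -/

section ConditionalMoments
variable {d : ℕ} {F : Type*} [PseudoMetricSpace F] [MeasurableSpace F]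
  {κ : Kernel F (Vec d)} {x : F} {μ : Vec d} {β : ℝ}

/-- The conditional second moments of the spatial sign are continuous at `x`. -/
lemma tendsto_integral_inner_spatialSign_sq (hm : MomentAssumption κ x μ) (v : Vec d) :
    Tendsto (fun x' => ∫ y, inner ℝ v (spatialSign (y - μ)) ^ 2 ∂κ x') (𝓝 x)
      (𝓝 (∫ y, inner ℝ v (spatialSign (y - μ)) ^ 2 ∂κ x)) := by
  obtain ⟨δ, -, h⟩ := hm.sign
  have := h v 2 (by simp) 0 (by simp)
  simpa [ContinuousAt] using this

lemma tendsto_integral_hessKernel (hs : SmoothnessAssumption κ x μ β) (k j : Fin d) :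
    Tendsto (fun x' => ∫ y, hessKernel y μ k j ∂κ x') (𝓝 x) (𝓝 (∫ y, hessKernel y μ k j ∂κ x)) :=
  ((continuous_apply_apply k j).tendsto _).comp hs.hess

end ConditionalMoments

section ConditionalLaw
variable {d : ℕ} {F : Type*} [PseudoMetricSpace F] [MeasurableSpace F]
  {κ : Kernel F (Vec d)} [IsMarkovKernel κ] {x : F} {μ : Vec d} {β : ℝ}

lemma measurable_spatialSign_sub (μ : Vec d) : Measurable fun y => spatialSign (y - μ) :=
  measurable_spatialSign.comp (measurable_id.sub_const μ)

lemma measurable_spatialSign_sub_apply (μ : Vec d) (k : Fin d) :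
    Measurable fun y => spatialSign (y - μ) k :=
  (EuclideanSpace.proj (𝕜 := ℝ) k).continuous.measurable.comp (measurable_spatialSign_sub μ)

lemma measurable_inner_spatialSign (μ v : Vec d) :
    Measurable fun y => inner ℝ v (spatialSign (y - μ)) :=
  measurable_const.inner (measurable_spatialSign_sub μ)

lemma measurable_hessKernel_apply (μ : Vec d) (k j : Fin d) :
    Measurable fun y => hessKernel y μ k j := by
  simp only [hessKernel_apply]
  exact (measurable_id.sub_const μ).norm.inv.mul (measurable_const.sub
    ((measurable_spatialSign_sub_apply μ k).mul (measurable_spatialSign_sub_apply μ j)))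

lemma integrable_inner_spatialSign (m : Measure (Vec d)) [IsFiniteMeasure m] (μ v : Vec d) :
    Integrable (fun y => inner ℝ v (spatialSign (y - μ))) m :=
  Integrable.of_bound (measurable_inner_spatialSign μ v).aestronglyMeasurable ‖v‖
    (.of_forall fun _ => abs_inner_spatialSign_le _ _)

lemma ae_ne_of_lintegral_enorm_ne_top {m : Measure (Vec d)}
    (h : ∫⁻ y, ‖y - μ‖ₑ ^ (-2 : ℝ) ∂m ≠ ∞) : ∀ᵐ y ∂m, y ≠ μ := by
  filter_upwards [ae_lt_top (by fun_prop) h] with y hy h0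
  simp [h0] at hy

lemma enorm_inv_norm_le (y : Vec d) : ‖‖y‖⁻¹‖ₑ ≤ 1 + ‖y‖ₑ ^ (-2 : ℝ) := by
  rcases eq_or_ne y 0 with rfl | hy
  · simp
  · rw [enorm_inv (norm_ne_zero_iff.2 hy), enorm_norm, ← ENNReal.rpow_neg_one]
    rcases le_total ‖y‖ₑ 1 with h | h
    · exact (ENNReal.rpow_le_rpow_of_exponent_ge h (by norm_num)).trans le_add_self
    · rw [ENNReal.rpow_neg_one]
      exact (ENNReal.inv_le_one.2 h).trans le_self_add

lemma integrable_inv_norm {m : Measure (Vec d)} [IsProbabilityMeasure m]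
    (h : ∫⁻ y, ‖y - μ‖ₑ ^ (-2 : ℝ) ∂m ≠ ∞) : Integrable (fun y => ‖y - μ‖⁻¹) m := by
  refine ⟨by fun_prop, ?_⟩
  rw [HasFiniteIntegral]
  calc ∫⁻ y, ‖‖y - μ‖⁻¹‖ₑ ∂m ≤ ∫⁻ y, (1 + ‖y - μ‖ₑ ^ (-2 : ℝ)) ∂m :=
        lintegral_mono fun y => enorm_inv_norm_le _
    _ = 1 + ∫⁻ y, ‖y - μ‖ₑ ^ (-2 : ℝ) ∂m := by
        rw [lintegral_add_left measurable_const]; simp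
    _ < ∞ := by simp [lt_top_iff_ne_top, h]

/-- Divide by t and let t → 0. This turns quadratic upper bounds at a minimizer into first order
conditions. -/
lemma eq_zero_of_forall_mul_le {b c : ℝ} (h : ∀ t > 0, t * b ≤ t ^ 2 * c) : b ≤ 0 := by
  refine le_of_forall_pos_le_add fun ε hε => ?_
  have h1 := h (ε / (|c| + 1)) (by positivity)
  have hpos : 0 < ε / (|c| + 1) := by positivity
  have h2 : b ≤ ε / (|c| + 1) * c := by
    have : ε / (|c| + 1) * b ≤ ε / (|c| + 1) * (ε / (|c| + 1) * c) := by linarith [sq (ε / (|c| + 1))]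
    exact le_of_mul_le_mul_left this hpos
  have h3 : ε / (|c| + 1) * c ≤ ε := by
    rw [div_mul_eq_mul_div, div_le_iff₀ (by positivity)]
    nlinarith [le_abs_self c]
  linarith

/-- Upper quadratic bound for the mean distance function. -/
lemma integral_norm_sub_le {m : Measure (Vec d)} [IsProbabilityMeasure m]
    (hint : ∀ u, Integrable (fun y => ‖y - u‖) m)
    (h : ∫⁻ y, ‖y - μ‖ₑ ^ (-2 : ℝ) ∂m ≠ ∞) (v : Vec d) :
    ∫ y, ‖y - (μ + v)‖ ∂m ≤ ∫ y, ‖y - μ‖ ∂m - ∫ y, inner ℝ v (spatialSign (y - μ)) ∂m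
      + ‖v‖ ^ 2 / 2 * ∫ y, ‖y - μ‖⁻¹ ∂m := by
  have i1 := integrable_inner_spatialSign m μ v
  have i2 := (integrable_inv_norm h).const_mul (‖v‖ ^ 2 / 2)
  rw [← integral_sub (hint μ) i1, ← integral_const_mul]
  have e := integral_add ((hint μ).sub i1) i2
  simp only [Pi.sub_apply] at e
  rw [← e]
  refine integral_mono_ae (hint _) (((hint μ).sub i1).add i2) ?_
  filter_upwards [ae_ne_of_lintegral_enorm_ne_top h] with y hy
  have := norm_sub_le_of_ne_zero (sub_ne_zero.2 hy) v
  simpa [sub_sub] using this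

lemma le_integral_norm_sub {m : Measure (Vec d)} [IsProbabilityMeasure m]
    (hint : ∀ u, Integrable (fun y => ‖y - u‖) m) (μ v : Vec d) :
    ∫ y, ‖y - μ‖ ∂m - ∫ y, inner ℝ v (spatialSign (y - μ)) ∂m ≤ ∫ y, ‖y - (μ + v)‖ ∂m := by
  have i1 := integrable_inner_spatialSign m μ v
  rw [← integral_sub (hint μ) i1]
  refine integral_mono ((hint μ).sub i1) (hint _) fun y => ?_
  have := norm_sub_inner_spatialSign_le (y - μ) v
  simpa [sub_sub] using this

/-- First order condition for the conditional median. -/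
lemma IsCondMedian.integral_inner_spatialSign (hμ : IsCondMedian κ x μ)
    (hm : MomentAssumption κ x μ) (h : ∫⁻ y, ‖y - μ‖ₑ ^ (-2 : ℝ) ∂κ x ≠ ∞) (v : Vec d) :
    ∫ y, inner ℝ v (spatialSign (y - μ)) ∂κ x = 0 := by
  have hmin : ∀ u, ∫ y, ‖y - μ‖ ∂κ x ≤ ∫ y, ‖y - u‖ ∂κ x := by
    intro u
    have h1 := hμ (mem_univ u)
    simp only [mem_ofPred_eq] at h1
    rw [integral_sub (integrable_norm_sub hm x μ) (hm.integrable_norm x),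
      integral_sub (integrable_norm_sub hm x u) (hm.integrable_norm x)] at h1
    linarith
  have key : ∀ v : Vec d, ∫ y, inner ℝ v (spatialSign (y - μ)) ∂κ x ≤ 0 := by
    intro v
    refine eq_zero_of_forall_mul_le (c := ‖v‖ ^ 2 / 2 * ∫ y, ‖y - μ‖⁻¹ ∂κ x) fun t _ => ?_
    have h1 := integral_norm_sub_le (integrable_norm_sub hm x) h (t • v)
    have h2 := hmin (μ + t • v)
    simp only [inner_smul_left, conj_trivial, integral_const_mul, norm_smul, mul_pow,
      Real.norm_eq_abs, sq_abs] at h1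
    linarith
  refine le_antisymm (key v) ?_
  have := key (-v)
  simp only [inner_neg_left, integral_neg] at this
  linarith

/-- The conditional mean of the spatial sign vanishes at `x` and is continuous there. -/
lemma tendsto_integral_inner_spatialSign (hμ : IsCondMedian κ x μ)
    (hs : SmoothnessAssumption κ x μ β)
    (hm : MomentAssumption κ x μ) (h : ∫⁻ y, ‖y - μ‖ₑ ^ (-2 : ℝ) ∂κ x ≠ ∞) (v : Vec d) :
    Tendsto (fun x' => ∫ y, inner ℝ v (spatialSign (y - μ)) ∂κ x') (𝓝 x) (𝓝 0) := by
  obtain ⟨hβ, c, hc, hhol⟩ := hs.holder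
  have hdist : Tendsto (fun x' => c * dist x x' ^ β) (𝓝 x) (𝓝 0) := by
    have h1 : Tendsto (fun x' => dist x x') (𝓝 x) (𝓝 0) := by
      simpa using (continuous_const.dist continuous_id : Continuous fun x' => dist x x').tendsto x
    have h2 := (h1.rpow_const (.inr hβ.le)).const_mul c
    simpa [Real.zero_rpow hβ.ne'] using h2
  set c1 := ∫ y, ‖y - μ‖⁻¹ ∂κ x
  have hc1 : 0 ≤ c1 := integral_nonneg fun y => by positivity
  have key : ∀ v : Vec d, ∀ ε > 0, ∀ᶠ x' in 𝓝 x,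
      -∫ y, inner ℝ v (spatialSign (y - μ)) ∂κ x' < ε := by
    intro v ε hε
    set A := ‖v‖ ^ 2 / 2 * c1
    have hA : 0 ≤ A := by positivity
    -- The tangent bound at x' and the quadratic bound at x are compared at the point μ + t v. The
    -- Hölder error enters twice, the curvature costs t² A, and after division by t the choice of t
    -- leaves ε/2 for each.
    set t := ε / (2 * (A + 1))
    have ht : 0 < t := by positivity
    have htA : t * A ≤ ε / 2 := by
      simp only [t]
      rw [div_mul_eq_mul_div, div_le_div_iff₀ (by positivity) (by norm_num)]
      nlinarith
    filter_upwards [hhol, hdist.eventually_lt_const (u := t * ε / 4) (by positivity)] with x' h1 h2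
    have e1 := le_integral_norm_sub (integrable_norm_sub hm x') μ (t • v)
    have e2 := integral_norm_sub_le (integrable_norm_sub hm x) h (t • v)
    have e3 := abs_le.1 (h1 (μ + t • v))
    have e4 := abs_le.1 (h1 μ)
    simp only [condDist] at e3 e4
    rw [hμ.integral_inner_spatialSign hm h] at e2
    simp only [inner_smul_left, conj_trivial, integral_const_mul, norm_smul, mul_pow,
      Real.norm_eq_abs, sq_abs] at e1 e2
    have e5 : t * (-∫ y, inner ℝ v (spatialSign (y - μ)) ∂κ x') < t * ε := by
      have : t ^ 2 * ‖v‖ ^ 2 / 2 * c1 = t * (t * A) := by simp only [A]; ring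
      have h6 : t * (t * A) ≤ t * (ε / 2) := mul_le_mul_of_nonneg_left htA ht.le
      change _ ≤ _ + t ^ 2 * ‖v‖ ^ 2 / 2 * c1 at e2
      linarith
    exact lt_of_mul_lt_mul_left e5 ht.le
  rw [Metric.tendsto_nhds]
  intro ε hε
  filter_upwards [key v ε hε, key (-v) ε hε] with x' h1 h2
  simp only [inner_neg_left, integral_neg, neg_neg] at h2
  rw [Real.dist_eq, sub_zero, abs_lt]
  constructor <;> linarith

/-- The conditional second moment matrix of the spatial sign. -/
noncomputable def condSigma (m : Measure (Vec d)) (μ : Vec d) : Matrix (Fin d) (Fin d) ℝ :=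
  Matrix.of fun k j => ∫ y, spatialSign (y - μ) k * spatialSign (y - μ) j ∂m

lemma integrable_spatialSign_mul (m : Measure (Vec d)) [IsFiniteMeasure m] (μ : Vec d)
    (k j : Fin d) :
    Integrable (fun y => spatialSign (y - μ) k * spatialSign (y - μ) j) m := by
  refine Integrable.of_bound (C := 1) ((measurable_spatialSign_sub_apply μ k).mul
    (measurable_spatialSign_sub_apply μ j)).aestronglyMeasurable (.of_forall fun y => ?_)
  rw [norm_mul]
  exact mul_le_one₀ (abs_spatialSign_apply_le _ _) (norm_nonneg _) (abs_spatialSign_apply_le _ _)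

/-- The moment assumption only gives continuity of quadratic forms of the sign; mixed products are
recovered by polarization. -/
lemma tendsto_integral_spatialSign_mul (hm : MomentAssumption κ x μ) (k j : Fin d) :
    Tendsto (fun x' => ∫ y, spatialSign (y - μ) k * spatialSign (y - μ) j ∂κ x') (𝓝 x)
      (𝓝 (∫ y, spatialSign (y - μ) k * spatialSign (y - μ) j ∂κ x)) := by
  set e : Fin d → Vec d := fun k => EuclideanSpace.single k 1
  have hinner : ∀ k z, inner ℝ (e k) (spatialSign z) = spatialSign z k := by
    intro k z
    simp [e, EuclideanSpace.inner_single_left]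
  have hi : ∀ (v : Vec d) x', Integrable (fun y => inner ℝ v (spatialSign (y - μ)) ^ 2) (κ x') := by
    intro v x'
    refine Integrable.of_bound (C := ‖v‖ ^ 2)
      ((measurable_inner_spatialSign μ v).pow_const 2).aestronglyMeasurable (.of_forall fun y => ?_)
    rw [norm_pow]
    exact pow_le_pow_left₀ (norm_nonneg _) (abs_inner_spatialSign_le _ _) 2
  have hpol : ∀ x', ∫ y, spatialSign (y - μ) k * spatialSign (y - μ) j ∂κ x'
      = 1 / 2 * (∫ y, inner ℝ (e k + e j) (spatialSign (y - μ)) ^ 2 ∂κ x'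
        - ∫ y, inner ℝ (e k) (spatialSign (y - μ)) ^ 2 ∂κ x'
        - ∫ y, inner ℝ (e j) (spatialSign (y - μ)) ^ 2 ∂κ x') := by
    intro x'
    rw [← integral_sub (hi _ _) (hi _ _)]
    have e2 := integral_sub ((hi (e k + e j) x').sub (hi (e k) x')) (hi (e j) x')
    simp only [Pi.sub_apply] at e2
    rw [← e2, ← integral_const_mul]
    congr 1
    ext y
    rw [inner_add_left, hinner, hinner]
    ring
  simp_rw [hpol]
  exact (((tendsto_integral_inner_spatialSign_sq hm _).sub
    (tendsto_integral_inner_spatialSign_sq hm _)).sub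
    (tendsto_integral_inner_spatialSign_sq hm _)).const_mul _

lemma sum_mul_condSigma (m : Measure (Vec d)) [IsFiniteMeasure m] (μ v w : Vec d) :
    ∑ k, ∑ j, v k * condSigma m μ k j * w j
      = ∫ y, inner ℝ v (spatialSign (y - μ)) * inner ℝ w (spatialSign (y - μ)) ∂m := by
  have : ∀ y, inner ℝ v (spatialSign (y - μ)) * inner ℝ w (spatialSign (y - μ))
      = ∑ k, ∑ j, v k * (spatialSign (y - μ) k * spatialSign (y - μ) j) * w j := by
    intro y
    rw [inner_eq_sum_mul, inner_eq_sum_mul, Finset.sum_mul_sum]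
    refine Finset.sum_congr rfl fun k _ => Finset.sum_congr rfl fun j _ => by ring
  simp_rw [this]
  have hi : ∀ k j, Integrable (fun y => v k * (spatialSign (y - μ) k * spatialSign (y - μ) j) * w j)
      m := fun k j => ((integrable_spatialSign_mul m μ k j).const_mul _).mul_const _
  rw [integral_finsetSum _ fun k _ => integrable_finsetSum _ fun j _ => hi k j]
  refine Finset.sum_congr rfl fun k _ => ?_
  rw [integral_finsetSum _ fun j _ => hi k j]
  refine Finset.sum_congr rfl fun j _ => ?_
  rw [integral_mul_const, integral_const_mul]
  rfl

/-- A null direction w of the quadratic form would make the sign, hence Y − μ, almost surely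
orthogonal to w, so the law would sit on a hyperplane through μ. -/
lemma posDef_condSigma {m : Measure (Vec d)} [IsFiniteMeasure m]
    (hnd : ∀ v : Vec d, v ≠ 0 → ¬ ∀ᵐ y ∂m, inner ℝ v (y - μ) = 0) :
    (condSigma m μ).PosDef := by
  refine Matrix.PosDef.of_dotProduct_mulVec_pos ?_ fun v hv => ?_
  · ext k j
    simp only [condSigma, Matrix.conjTranspose_apply, Matrix.of_apply, star_trivial, mul_comm]
  · set w : Vec d := WithLp.toLp 2 v
    have hw : w ≠ 0 := by
      intro h0
      exact hv (by simpa [w] using congrArg WithLp.ofLp h0)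
    have e : star v ⬝ᵥ (condSigma m μ).mulVec v = ∫ y, inner ℝ w (spatialSign (y - μ)) ^ 2 ∂m := by
      simp_rw [pow_two]
      rw [← sum_mul_condSigma]
      simp [dotProduct, Matrix.mulVec, Finset.mul_sum, w, mul_assoc]
    rw [e]
    refine lt_of_le_of_ne (integral_nonneg fun y => sq_nonneg _) fun h0 => ?_
    refine hnd w hw ?_
    have hi : Integrable (fun y => inner ℝ w (spatialSign (y - μ)) ^ 2) m := by
      refine Integrable.of_bound (C := ‖w‖ ^ 2)
        ((measurable_inner_spatialSign μ w).pow_const 2).aestronglyMeasurable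
        (.of_forall fun y => ?_)
      rw [norm_pow]
      exact pow_le_pow_left₀ (norm_nonneg _) (abs_inner_spatialSign_le _ _) 2
    have := (integral_eq_zero_iff_of_nonneg (fun y => sq_nonneg _) hi).1 h0.symm
    filter_upwards [this] with y hy
    rw [← norm_mul_inner_spatialSign, pow_eq_zero_iff two_ne_zero |>.1 hy, mul_zero]

lemma sum_mul_hessKernel (y u v : Vec d) :
    ∑ k, ∑ j, v k * hessKernel y u k j * v j
      = ‖y - u‖⁻¹ * (‖v‖ ^ 2 - inner ℝ v (spatialSign (y - u)) ^ 2) := by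
  have e := congrArg (inner ℝ v) (toEuclideanCLM_hessKernel y u v)
  rw [inner_eq_sum_mul, inner_smul_right, inner_sub_right, inner_smul_right,
    real_inner_self_eq_norm_sq, ← pow_two] at e
  rw [← e]
  refine Finset.sum_congr rfl fun k _ => ?_
  rw [toEuclideanCLM_apply_apply, Finset.mul_sum]
  refine Finset.sum_congr rfl fun j _ => by ring

/-- The conditional Hessian is positive definite. -/
lemma exists_pos_le_hess {m : Measure (Vec d)} [IsProbabilityMeasure m] (hd : 2 ≤ d)
    (h : ∫⁻ y, ‖y - μ‖ₑ ^ (-2 : ℝ) ∂m ≠ ∞)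
    (hnd : ∀ v : Vec d, v ≠ 0 → ¬ ∀ᵐ y ∂m, inner ℝ v (y - μ) = 0) :
    ∃ c > 0, ∀ v : Vec d, c * ‖v‖ ^ 2
      ≤ ∑ k, ∑ j, v k * (∫ y, hessKernel y μ k j ∂m) * v j := by
  have : Nontrivial (Fin d) := Fin.nontrivial_iff_two_le.2 hd
  set Q : Vec d → ℝ := fun v => ∑ k, ∑ j, v k * (∫ y, hessKernel y μ k j ∂m) * v j
  have hQc : Continuous Q := by fun_prop
  have hint : ∀ k j, Integrable (fun y => hessKernel y μ k j) m := fun k j =>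
    ((integrable_inv_norm h).const_mul 2).mono' (measurable_hessKernel_apply μ k j).aestronglyMeasurable
      (.of_forall fun y => abs_hessKernel_apply_le _ _ _ _)
  have hQ : ∀ v, Q v = ∫ y, ‖y - μ‖⁻¹ * (‖v‖ ^ 2 - inner ℝ v (spatialSign (y - μ)) ^ 2) ∂m := by
    intro v
    have hi : ∀ k j, Integrable (fun y => v k * hessKernel y μ k j * v j) m := fun k j =>
      ((hint k j).const_mul _).mul_const _
    simp_rw [← sum_mul_hessKernel]
    rw [integral_finsetSum _ fun k _ => integrable_finsetSum _ fun j _ => hi k j]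
    refine Finset.sum_congr rfl fun k _ => ?_
    rw [integral_finsetSum _ fun j _ => hi k j]
    refine Finset.sum_congr rfl fun j _ => ?_
    rw [integral_mul_const, integral_const_mul]
  have hnn : ∀ v y : Vec d, 0 ≤ ‖y - μ‖⁻¹ * (‖v‖ ^ 2 - inner ℝ v (spatialSign (y - μ)) ^ 2) := by
    intro v y
    have h1 := abs_inner_spatialSign_le (y - μ) v
    have h2 := sq_le_sq' (by linarith [neg_le_of_abs_le h1]) ((le_abs_self _).trans h1)
    exact mul_nonneg (by positivity) (by linarith)
  have hpos : ∀ v : Vec d, v ≠ 0 → 0 < Q v := by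
    intro v hv
    rw [hQ]
    refine lt_of_le_of_ne (integral_nonneg (hnn v)) fun h0 => ?_
    have hi : Integrable (fun y => ‖y - μ‖⁻¹ * (‖v‖ ^ 2 - inner ℝ v (spatialSign (y - μ)) ^ 2)) m := by
      simp_rw [← sum_mul_hessKernel]
      exact integrable_finsetSum _ fun k _ => integrable_finsetSum _ fun j _ =>
        ((hint k j).const_mul _).mul_const _
    have h1 := (integral_eq_zero_iff_of_nonneg (hnn v) hi).1 h0.symm
    -- If the form vanishes at v, equality in Cauchy–Schwarz puts Y on the line μ + ℝv. Since d ≥ 2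
    -- some w ≠ 0 is orthogonal to v, and the line lies in the forbidden hyperplane w^⊥ through μ.
    obtain ⟨w, hw0, hwv⟩ : ∃ w : Vec d, w ≠ 0 ∧ inner ℝ w v = 0 := by
      have hlt : Module.finrank ℝ (Submodule.span ℝ {v}) < Module.finrank ℝ (Vec d) := by
        rw [finrank_span_singleton hv, finrank_euclideanSpace_fin]
        omega
      have hne : (Submodule.span ℝ {v})ᗮ ≠ ⊥ := by
        intro hb
        rw [Submodule.orthogonal_eq_bot_iff] at hb
        rw [hb, finrank_top] at hlt
        exact lt_irrefl _ hlt
      obtain ⟨w, hw, hw0⟩ := Submodule.exists_mem_ne_zero_of_ne_bot hne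
      exact ⟨w, hw0, Submodule.mem_orthogonal_singleton_iff_inner_left.1 hw⟩
    refine hnd w hw0 ?_
    filter_upwards [h1, ae_ne_of_lintegral_enorm_ne_top h] with y hy hyμ
    have hz : y - μ ≠ 0 := sub_ne_zero.2 hyμ
    have h2 : ‖v‖ ^ 2 = inner ℝ v (spatialSign (y - μ)) ^ 2 := by
      rcases mul_eq_zero.1 hy with h3 | h3
      · exact absurd h3 (inv_ne_zero (norm_ne_zero_iff.2 hz))
      · linarith
    have hU := norm_spatialSign hz
    set a := inner ℝ v (spatialSign (y - μ))
    have h3 : v = a • spatialSign (y - μ) := by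
      rw [← sub_eq_zero, ← norm_eq_zero, ← sq_eq_zero_iff, norm_sub_sq_real, inner_smul_right,
        norm_smul, hU, mul_one, Real.norm_eq_abs, sq_abs, h2]
      ring
    have ha : a ≠ 0 := by
      rintro h4
      rw [h4, zero_smul] at h3
      exact hv h3
    have h4 : inner ℝ w (spatialSign (y - μ)) = 0 := by
      rw [h3, inner_smul_right] at hwv
      exact (mul_eq_zero.1 hwv).resolve_left ha
    rw [← norm_mul_inner_spatialSign, h4, mul_zero]
  -- Compactness of the unit sphere and homogeneity of degree 2 upgrade strict positivity to a
  -- uniform constant.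
  obtain ⟨v0, hv0, hmin⟩ := (isCompact_sphere (0 : Vec d) 1).exists_isMinOn
    (NormedSpace.sphere_nonempty.2 zero_le_one) hQc.continuousOn
  refine ⟨Q v0, hpos v0 (ne_zero_of_mem_unit_sphere ⟨v0, hv0⟩), fun v => ?_⟩
  rcases eq_or_ne v 0 with rfl | hv
  · simp
  · have hvn : ‖v‖ ≠ 0 := norm_ne_zero_iff.2 hv
    have h1 : Q v0 ≤ Q (‖v‖⁻¹ • v) := hmin (by simp [norm_smul, hvn])
    have h2 : Q (‖v‖⁻¹ • v) = (‖v‖ ^ 2)⁻¹ * Q v := by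
      simp only [Q, PiLp.smul_apply, smul_eq_mul, Finset.mul_sum]
      refine Finset.sum_congr rfl fun k _ => Finset.sum_congr rfl fun j _ => ?_
      field_simp
    rw [h2, inv_mul_eq_div, le_div_iff₀ (by positivity)] at h1
    exact h1

end ConditionalLaw

/-! ### Weighted spatial medians: localization and linearization -/

section WeightedMedian
variable {ι : Type*} {d : ℕ} {s : Finset ι} {a : ι → ℝ} {z : ι → Vec d}

/-- A minimizer of a convex function that exceeds its value at the origin on a sphere lies inside
the sphere. -/
lemma norm_lt_of_isMinOn (ha : ∀ i, 0 ≤ a i) {r : ℝ} (hr : 0 < r)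
    (hsphere : ∀ v : Vec d, ‖v‖ = r → ∑ i ∈ s, a i * ‖z i‖ < ∑ i ∈ s, a i * ‖z i - v‖)
    {w : Vec d} (hw : IsMinOn (fun v => ∑ i ∈ s, a i * ‖z i - v‖) univ w) : ‖w‖ < r := by
  by_contra hc
  rw [not_lt] at hc
  have hw0 : 0 < ‖w‖ := hr.trans_le hc
  set t := r / ‖w‖
  have ht0 : 0 < t := by positivity
  have ht1 : t ≤ 1 := (div_le_one hw0).2 hc
  have h1 := hsphere (t • w) (by
    rw [norm_smul, Real.norm_eq_abs, abs_of_pos ht0, div_mul_cancel₀ _ hw0.ne'])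
  have h2 : ∑ i ∈ s, a i * ‖z i - t • w‖
      ≤ (1 - t) * ∑ i ∈ s, a i * ‖z i‖ + t * ∑ i ∈ s, a i * ‖z i - w‖ := by
    rw [Finset.mul_sum, Finset.mul_sum, ← Finset.sum_add_distrib]
    refine Finset.sum_le_sum fun i _ => ?_
    have : ‖z i - t • w‖ ≤ (1 - t) * ‖z i‖ + t * ‖z i - w‖ := by
      have e : z i - t • w = (1 - t) • z i + t • (z i - w) := by
        rw [sub_smul, one_smul, smul_sub]; abel
      rw [e]
      refine (norm_add_le _ _).trans_eq ?_
      rw [norm_smul, norm_smul, Real.norm_of_nonneg (by linarith), Real.norm_of_nonneg ht0.le]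
    calc a i * ‖z i - t • w‖ ≤ a i * ((1 - t) * ‖z i‖ + t * ‖z i - w‖) :=
          mul_le_mul_of_nonneg_left this (ha i)
      _ = _ := by ring
  have h3 := hw (mem_univ (0 : Vec d))
  simp only [sub_zero, mem_ofPred_eq] at h3
  nlinarith

/-- On the sphere of radius r the quadratic gain l r²/2 must beat the linear term, at most r times
the norm of the sign sum, and the cubic error of the expansion; `hsmall` is this comparison divided
by r. -/
lemma norm_lt_of_isMinOn_of_quadratic (ha : ∀ i, 0 ≤ a i) {r l : ℝ} (hr : 0 < r)
    (hquad : ∀ v : Vec d, l * ‖v‖ ^ 2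
      ≤ ∑ i ∈ s, a i * (‖z i‖⁻¹ * (‖v‖ ^ 2 - inner ℝ v (spatialSign (z i)) ^ 2)))
    (hsmall : ‖∑ i ∈ s, a i • spatialSign (z i)‖ + r ^ 2 / 2 * ∑ i ∈ s, a i * (‖z i‖ ^ 2)⁻¹
      < l / 2 * r)
    {w : Vec d} (hw : IsMinOn (fun v => ∑ i ∈ s, a i * ‖z i - v‖) univ w) : ‖w‖ < r := by
  refine norm_lt_of_isMinOn ha hr (fun v hv => ?_) hw
  have h1 : ∑ i ∈ s, a i * (‖z i‖ - inner ℝ v (spatialSign (z i))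
      + 1 / 2 * (‖z i‖⁻¹ * (‖v‖ ^ 2 - inner ℝ v (spatialSign (z i)) ^ 2))
      - ‖v‖ ^ 3 / 2 * (‖z i‖ ^ 2)⁻¹) ≤ ∑ i ∈ s, a i * ‖z i - v‖ :=
    Finset.sum_le_sum fun i _ => mul_le_mul_of_nonneg_left (norm_sub_ge_quadratic _ _) (ha i)
  have h2 : ∑ i ∈ s, a i * (‖z i‖ - inner ℝ v (spatialSign (z i))
      + 1 / 2 * (‖z i‖⁻¹ * (‖v‖ ^ 2 - inner ℝ v (spatialSign (z i)) ^ 2))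
      - ‖v‖ ^ 3 / 2 * (‖z i‖ ^ 2)⁻¹)
      = ∑ i ∈ s, a i * ‖z i‖ - inner ℝ v (∑ i ∈ s, a i • spatialSign (z i))
        + 1 / 2 * ∑ i ∈ s, a i * (‖z i‖⁻¹ * (‖v‖ ^ 2 - inner ℝ v (spatialSign (z i)) ^ 2))
        - ‖v‖ ^ 3 / 2 * ∑ i ∈ s, a i * (‖z i‖ ^ 2)⁻¹ := by
    rw [inner_sum, Finset.mul_sum, Finset.mul_sum, ← Finset.sum_sub_distrib,
      ← Finset.sum_add_distrib, ← Finset.sum_sub_distrib]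
    refine Finset.sum_congr rfl fun i _ => ?_
    rw [inner_smul_right]
    ring
  have h3 := hquad v
  have h4 := real_inner_le_norm v (∑ i ∈ s, a i • spatialSign (z i))
  rw [h2, hv] at h1
  rw [hv] at h3 h4
  have h5 := mul_lt_mul_of_pos_left hsmall hr
  nlinarith

/-- First order condition for a weighted spatial median that is not a data point. -/
lemma sum_spatialSign_eq_zero {w : Vec d} (ha : ∀ i, 0 ≤ a i)
    (hne : ∀ i ∈ s, a i ≠ 0 → z i ≠ w)
    (hw : IsMinOn (fun v => ∑ i ∈ s, a i * ‖z i - v‖) univ w) :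
    ∑ i ∈ s, a i • spatialSign (z i - w) = 0 := by
  set g := ∑ i ∈ s, a i • spatialSign (z i - w) with hg
  -- A step t g along the sign sum g itself lowers the objective by t‖g‖² up to O(t²), so minimality
  -- forces g = 0.
  have h := eq_zero_of_forall_mul_le (b := ‖g‖ ^ 2)
    (c := ‖g‖ ^ 2 / 2 * ∑ i ∈ s, a i * ‖z i - w‖⁻¹) fun t _ => ?_
  · have := (sq_nonneg ‖g‖).antisymm' h
    rwa [sq_eq_zero_iff, norm_eq_zero] at this
  · have h1 := hw (mem_univ (w + t • g))
    simp only [mem_ofPred_eq] at h1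
    have h2 : ∑ i ∈ s, a i * ‖z i - (w + t • g)‖ ≤ ∑ i ∈ s, a i * (‖z i - w‖
        - inner ℝ (t • g) (spatialSign (z i - w)) + ‖t • g‖ ^ 2 / 2 * ‖z i - w‖⁻¹) := by
      refine Finset.sum_le_sum fun i hi => ?_
      rcases eq_or_ne (a i) 0 with h0 | h0
      · simp [h0]
      · refine mul_le_mul_of_nonneg_left ?_ (ha i)
        rw [← sub_sub]
        exact norm_sub_le_of_ne_zero (sub_ne_zero.2 (hne i hi h0)) _
    have h3 : ∑ i ∈ s, a i * (‖z i - w‖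
        - inner ℝ (t • g) (spatialSign (z i - w)) + ‖t • g‖ ^ 2 / 2 * ‖z i - w‖⁻¹)
        = ∑ i ∈ s, a i * ‖z i - w‖ - inner ℝ (t • g) g
          + ‖t • g‖ ^ 2 / 2 * ∑ i ∈ s, a i * ‖z i - w‖⁻¹ := by
      conv_rhs => rw [hg]
      rw [inner_sum, Finset.mul_sum, ← Finset.sum_sub_distrib, ← Finset.sum_add_distrib]
      refine Finset.sum_congr rfl fun i _ => ?_
      rw [inner_smul_right]
      ring
    rw [h3, inner_smul_left, real_inner_self_eq_norm_sq, norm_smul, mul_pow, Real.norm_eq_abs,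
      sq_abs, conj_trivial] at h2
    linarith

/-- Linearization of the first order condition. -/
lemma norm_sum_hess_sub_le {w : Vec d} (ha : ∀ i, 0 ≤ a i)
    (hfar : ∀ i ∈ s, a i ≠ 0 → 2 * ‖w‖ < ‖z i‖)
    (hfoc : ∑ i ∈ s, a i • spatialSign (z i - w) = 0) :
    ‖∑ i ∈ s, a i • (‖z i - w‖⁻¹ •
        (w - inner ℝ w (spatialSign (z i - w)) • spatialSign (z i - w)))
      - ∑ i ∈ s, a i • spatialSign (z i)‖ ≤ 10 * ‖w‖ ^ 2 * ∑ i ∈ s, a i * (‖z i‖ ^ 2)⁻¹ := by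
  rw [← norm_neg, neg_sub, ← sub_zero (∑ i ∈ s, a i • spatialSign (z i)), ← hfoc,
    ← Finset.sum_sub_distrib, ← Finset.sum_sub_distrib, Finset.mul_sum]
  refine norm_sum_le_of_le _ fun i hi => ?_
  rw [← smul_sub, ← smul_sub, norm_smul, Real.norm_of_nonneg (ha i), mul_left_comm]
  rcases eq_or_ne (a i) 0 with h0 | h0
  · simp [h0]
  refine mul_le_mul_of_nonneg_left ?_ (ha i)
  have h1 := hfar i hi h0
  have hz : 0 < ‖z i‖ := (by positivity : (0:ℝ) ≤ 2 * ‖w‖).trans_lt h1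
  -- The expansion is centred at z_i − w. The separation 2‖w‖ < ‖z_i‖ converts its inverse square
  -- distance into that of z_i at the cost of a factor 4, and 10 = 4 · 5/2.
  have h2 : ‖z i‖ / 2 ≤ ‖z i - w‖ := by linarith [norm_sub_norm_le (z i) w]
  have hy : z i - w ≠ 0 := norm_pos_iff.1 (by linarith)
  have h3 := norm_spatialSign_add_sub_le hy w
  rw [sub_add_cancel] at h3
  refine h3.trans ?_
  have h4 : (‖z i - w‖ ^ 2)⁻¹ ≤ 4 * (‖z i‖ ^ 2)⁻¹ := by
    rw [← div_eq_mul_inv, inv_eq_one_div, div_le_div_iff₀ (by positivity) (by positivity)]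
    nlinarith
  calc 5 / 2 * ‖w‖ ^ 2 * (‖z i - w‖ ^ 2)⁻¹ ≤ 5 / 2 * ‖w‖ ^ 2 * (4 * (‖z i‖ ^ 2)⁻¹) := by gcongr
    _ = _ := by ring

/-- The natural bound involves ‖z‖⁻¹. It is relaxed to 1 + ‖z‖⁻² so that the kernel sum of inverse
squares, already under control, suffices. -/
lemma abs_signOuter_sub_le {z w : Vec d} (hz : z ≠ 0) (k j : Fin d) :
    |signOuter (z - w) k j - signOuter z k j| ≤ 4 * ‖w‖ * (1 + (‖z‖ ^ 2)⁻¹) := by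
  have h1 := norm_spatialSign_sub_le hz (z - w)
  rw [sub_sub_cancel_left, norm_neg] at h1
  have h2 : ∀ k, |spatialSign (z - w) k - spatialSign z k| ≤ 2 * ‖w‖ * ‖z‖⁻¹ := fun k =>
    (PiLp.norm_apply_le (spatialSign (z - w) - spatialSign z) k).trans h1
  have h3 : ‖z‖⁻¹ ≤ 1 + (‖z‖ ^ 2)⁻¹ := by
    rw [← inv_pow]
    nlinarith [sq_nonneg (‖z‖⁻¹ - 1), sq_nonneg (‖z‖⁻¹)]
  have e : signOuter (z - w) k j - signOuter z k j
      = (spatialSign (z - w) k - spatialSign z k) * spatialSign (z - w) j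
        + spatialSign z k * (spatialSign (z - w) j - spatialSign z j) := by
    rw [signOuter_apply, signOuter_apply]; ring
  rw [e]
  refine (abs_add_le _ _).trans ?_
  rw [abs_mul, abs_mul]
  calc _ ≤ (2 * ‖w‖ * ‖z‖⁻¹) * 1 + 1 * (2 * ‖w‖ * ‖z‖⁻¹) := by
        gcongr
        · exact h2 k
        · exact abs_spatialSign_apply_le _ _
        · exact abs_spatialSign_apply_le _ _
        · exact h2 j
    _ = 4 * ‖w‖ * ‖z‖⁻¹ := by ring
    _ ≤ _ := by gcongr

end WeightedMedian

/-! ### The bias of the kernel sum of spatial signs -/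

section Bias
variable {d : ℕ} {Ω F : Type*} {mΩ : MeasurableSpace Ω} [PseudoMetricSpace F] [MeasurableSpace F]
  {P : Measure Ω} [IsProbabilityMeasure P] {X : Ω → F} {Y : Ω → Vec d}
  {κ : Kernel F (Vec d)} [IsMarkovKernel κ] {x : F} {μ : Vec d} {β : ℝ}

lemma integrable_spatialSign_comp (hY : Measurable Y) (μ : Vec d) :
    Integrable (fun ω => spatialSign (Y ω - μ)) P :=
  Integrable.of_bound ((measurable_spatialSign_sub μ).comp hY).aestronglyMeasurable 1
    (.of_forall fun _ => norm_spatialSign_le _)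

/-- The weight is a function of ρ(x, X) and can be pulled out of the conditional expectation given
ρ(x, X). -/
lemma integral_smul_spatialSign_eq (hx : Measurable fun x' : F => dist x x') (hX : Measurable X)
    (hY : Measurable Y) {ψ : ℝ → Vec d}
    (hψ : P[fun ω => spatialSign (Y ω - μ) |
      MeasurableSpace.comap (fun ω => dist x (X ω)) inferInstance]
      =ᵐ[P] fun ω => ψ (dist x (X ω)))
    {w : ℝ → ℝ} (hw : Measurable w) {C : ℝ} (hC : ∀ t, |w t| ≤ C) :
    ∫ ω, w (dist x (X ω)) • spatialSign (Y ω - μ) ∂P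
      = ∫ ω, w (dist x (X ω)) • ψ (dist x (X ω)) ∂P := by
  have hm : MeasurableSpace.comap (fun ω => dist x (X ω)) inferInstance ≤ mΩ :=
    (hx.comp hX).comap_le
  have hwm : StronglyMeasurable[MeasurableSpace.comap (fun ω => dist x (X ω)) inferInstance]
      fun ω => w (dist x (X ω)) :=
    (hw.comp (comap_measurable (fun ω => dist x (X ω)))).stronglyMeasurable
  have h := condExp_aestronglyMeasurable_bilin_of_bound (ContinuousLinearMap.lsmul ℝ ℝ) hm
    (hwm.aestronglyMeasurable (μ := P)) (integrable_spatialSign_comp (P := P) hY μ) C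
    (.of_forall fun ω => hC _)
  simp only [ContinuousLinearMap.lsmul_apply] at h
  rw [← integral_condExp hm]
  refine integral_congr_ae ?_
  filter_upwards [h, hψ] with ω h1 h2
  rw [h1, h2]

variable {K : ℝ → ℝ} {h : ℕ → ℝ}

lemma measurable_kernel_weight (hK : KernelAssumption K) (hx : Measurable fun x' : F => dist x x')
    (h : ℝ) : Measurable fun x' : F => K (dist x x' / h) :=
  hK.measurable.comp (hx.div_const h)

lemma integrable_kernel_weight (hK : KernelAssumption K)
    (hx : Measurable fun x' : F => dist x x') (hX : Measurable X) (h : ℝ) :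
    Integrable (fun ω => K (dist x (X ω) / h)) P := by
  obtain ⟨C, hC⟩ := hK.bounded
  refine Integrable.of_bound (C := C)
    ((measurable_kernel_weight hK hx h).comp hX).aestronglyMeasurable (.of_forall fun ω => ?_)
  rw [Real.norm_eq_abs, abs_of_nonneg (hK.nonneg _)]
  exact hC _

/-- The kernel sum of the spatial signs has a bias of order `h`. -/
lemma exists_norm_integral_kernel_sign_le (hK : KernelAssumption K)
    (hx : Measurable fun x' : F => dist x x') (hX : Measurable X) (hY : Measurable Y)
    (hκ : HasCondDistrib Y X κ P) (hμ : IsCondMedian κ x μ)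
    (hs : SmoothnessAssumption κ x μ β) (hm : MomentAssumption κ x μ)
    (hinv : ∫⁻ y, ‖y - μ‖ₑ ^ (-2 : ℝ) ∂κ x ≠ ∞) (hbias : BiasAssumption P X Y x μ)
    (hpos : ∀ n, 0 < h n) (hlim : Tendsto h atTop (𝓝 0))
    (hmass : ∀ᶠ n in atTop, 0 < ∫ ω, K (dist x (X ω) / h n) ∂P) :
    ∃ C, ∀ᶠ n in atTop, ‖∫ ω, K (dist x (X ω) / h n) • spatialSign (Y ω - μ) ∂P‖
      ≤ C * h n * ∫ ω, K (dist x (X ω) / h n) ∂P := by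
  obtain ⟨ψ, hψd, -, hψ⟩ := hbias
  obtain ⟨CK, -, hCK⟩ := hK.exists_pos_bound
  have hKm : ∀ n, Measurable fun t => K (t / h n) := fun n =>
    hK.measurable.comp (measurable_id.div_const _)
  have heq : ∀ n, ∫ ω, K (dist x (X ω) / h n) • spatialSign (Y ω - μ) ∂P
      = ∫ ω, K (dist x (X ω) / h n) • ψ (dist x (X ω)) ∂P := fun n =>
    integral_smul_spatialSign_eq hx hX hY hψ (hKm n) (C := CK) fun t => by
      rw [abs_of_nonneg (hK.nonneg _)]; exact hCK _
  have hwi := fun n => integrable_kernel_weight (P := P) hK hx hX (h n)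
  have hsupp : ∀ n x', h n < dist x x' → K (dist x x' / h n) = 0 := fun n x' h' =>
    hK.eq_zero_of_lt (hpos n) h'
  have hψm : Measurable fun ω => ψ (dist x (X ω)) := hψd.continuous.measurable.comp (hx.comp hX)
  have happrox : ∀ (a : Vec d) (ε : ℝ) (n : ℕ), (∀ t, 0 ≤ t → t ≤ h n → ‖ψ t - a‖ ≤ ε) →
      ‖∫ ω, K (dist x (X ω) / h n) • ψ (dist x (X ω)) ∂P
        - (∫ ω, K (dist x (X ω) / h n) ∂P) • a‖ ≤ ε * ∫ ω, K (dist x (X ω) / h n) ∂P := by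
    intro a ε n hε
    have hb : ∀ ω, ‖K (dist x (X ω) / h n) • (ψ (dist x (X ω)) - a)‖
        ≤ ε * K (dist x (X ω) / h n) := by
      intro ω
      rw [norm_smul, Real.norm_eq_abs, abs_of_nonneg (hK.nonneg _), mul_comm]
      rcases le_or_gt (dist x (X ω)) (h n) with h1 | h1
      · exact mul_le_mul_of_nonneg_right (hε _ dist_nonneg h1) (hK.nonneg _)
      · simp [hsupp n _ h1]
    have hi : Integrable (fun ω => K (dist x (X ω) / h n) • (ψ (dist x (X ω)) - a)) P :=
      ((hwi n).const_mul ε).mono' (((hKm n).comp (hx.comp hX)).smul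
        (hψm.sub_const a)).aestronglyMeasurable (.of_forall hb)
    have hi2 : Integrable (fun ω => K (dist x (X ω) / h n) • ψ (dist x (X ω))) P := by
      refine (hi.add ((hwi n).smul_const a)).congr (.of_forall fun ω => ?_)
      simp [smul_sub]
    rw [← integral_smul_const, ← integral_sub hi2 ((hwi n).smul_const a), ← integral_const_mul]
    simp_rw [← smul_sub]
    exact norm_integral_le_of_norm_le ((hwi n).const_mul ε) (.of_forall hb)
  -- Otherwise the kernel mean of the sign would be within ‖ψ(0)‖/4 of ψ(0) for small h, while its
  -- inner product with ψ(0) is at most ‖ψ(0)‖²/4 because the conditional means tend to 0 at x.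
  -- Together these give ‖ψ(0)‖² ≤ ‖ψ(0)‖²/2.
  have hψ0 : ψ 0 = 0 := by
    by_contra hne
    have hp : 0 < ‖ψ 0‖ := norm_pos_iff.2 hne
    set ε := ‖ψ 0‖ / 4
    have hε : 0 < ε := by positivity
    have h1 : ∀ᶠ x' in 𝓝 x, |∫ y, inner ℝ (ψ 0) (spatialSign (y - μ)) ∂κ x' - 0| ≤ ε * ‖ψ 0‖ := by
      have := (tendsto_integral_inner_spatialSign hμ hs hm hinv (ψ 0)).abs
      rw [abs_zero] at this
      filter_upwards [this.eventually_le_const (u := ε * ‖ψ 0‖) (by positivity)] with x' hx'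
      rwa [sub_zero]
    have h2 : ∀ᶠ t in 𝓝 (0 : ℝ), ‖ψ t - ψ 0‖ ≤ ε := by
      have := Metric.tendsto_nhds.1 (hψd.continuous.tendsto 0) ε hε
      filter_upwards [this] with t ht
      rw [← dist_eq_norm]; exact ht.le
    have h2' := eventually_forall_dist_le h2 hlim
    obtain ⟨n, h3, h4, h5⟩ := ((eventually_forall_dist_le h1 hlim).and (h2'.and hmass)).exists
    set M := ∫ ω, K (dist x (X ω) / h n) ∂P
    have e1 := happrox (ψ 0) ε n fun t ht0 ht => h4 t (by
      rw [Real.dist_eq, zero_sub, abs_neg, abs_of_nonneg ht0]; exact ht)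
    have hwf : Integrable (fun ω => K (dist x (X ω) / h n)
        * inner ℝ (ψ 0) (spatialSign (Y ω - μ))) P := by
      refine (hwi n).mul_bdd (c := ‖ψ 0‖) ?_ (.of_forall fun ω => abs_inner_spatialSign_le _ _)
      exact ((measurable_inner_spatialSign μ (ψ 0)).comp hY).aestronglyMeasurable
    have e2 := hκ.abs_integral_mul_sub_le (measurable_kernel_weight hK hx (h n))
      (fun _ => hK.nonneg _) (hsupp n) (hwi n) (measurable_inner_spatialSign μ (ψ 0)) hwf h3
    have hwU : Integrable (fun ω => K (dist x (X ω) / h n) • spatialSign (Y ω - μ)) P := by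
      refine (hwi n).mono' (((hKm n).comp (hx.comp hX)).smul
        ((measurable_spatialSign_sub μ).comp hY)).aestronglyMeasurable (.of_forall fun ω => ?_)
      rw [norm_smul, Real.norm_eq_abs, abs_of_nonneg (hK.nonneg _)]
      exact mul_le_of_le_one_right (hK.nonneg _) (norm_spatialSign_le _)
    have e3 : ∫ ω, K (dist x (X ω) / h n) * inner ℝ (ψ 0) (spatialSign (Y ω - μ)) ∂P
        = inner ℝ (ψ 0) (∫ ω, K (dist x (X ω) / h n) • ψ (dist x (X ω)) ∂P) := by
      rw [← heq, ← integral_inner hwU]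
      simp_rw [inner_smul_right]
    rw [e3, zero_mul, sub_zero] at e2
    set I := ∫ ω, K (dist x (X ω) / h n) • ψ (dist x (X ω)) ∂P
    have e4 : ‖ψ 0‖ ^ 2 * M = inner ℝ (ψ 0) I - inner ℝ (ψ 0) (I - M • ψ 0) := by
      rw [inner_sub_right, inner_smul_right, real_inner_self_eq_norm_sq]
      ring
    have e5 : -inner ℝ (ψ 0) (I - M • ψ 0) ≤ ‖ψ 0‖ * (ε * M) :=
      (neg_le_abs _).trans ((abs_real_inner_le_norm _ _).trans (by gcongr))
    have e6 := (le_abs_self _).trans e2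
    have e7 : ‖ψ 0‖ ^ 2 * M ≤ ‖ψ 0‖ ^ 2 / 2 * M := by
      have : ε * ‖ψ 0‖ * M + ‖ψ 0‖ * (ε * M) = ‖ψ 0‖ ^ 2 / 2 * M := by simp only [ε]; ring
      linarith
    have e8 := le_of_mul_le_mul_right e7 h5
    nlinarith [sq_nonneg ‖ψ 0‖, mul_pos hp hp]
  -- As ψ(0) = 0, differentiability at 0 gives ‖ψ(t)‖ ≤ C t near 0, and the kernel restricts to t ≤
  -- h.
  obtain ⟨C, hC⟩ := (hψd 0).hasDerivAt.isBigO_sub.bound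
  refine ⟨C, ?_⟩
  filter_upwards [eventually_forall_dist_le hC hlim] with n hn
  have hC0 : 0 ≤ C := by
    have := hn (h n) (by rw [Real.dist_eq, zero_sub, abs_neg, abs_of_pos (hpos n)])
    have h1 := (norm_nonneg _).trans this
    refine nonneg_of_mul_nonneg_left h1 ?_
    simpa using (hpos n).ne'
  have := happrox 0 (C * h n) n fun t ht0 ht => by
    have h1 := hn t (by rw [Real.dist_eq, zero_sub, abs_neg, abs_of_nonneg ht0]; exact ht)
    rw [hψ0, sub_zero] at h1
    rw [sub_zero]
    refine h1.trans ?_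
    gcongr
    rwa [sub_zero, Real.norm_eq_abs, abs_of_nonneg ht0]
  rw [smul_zero, sub_zero, ← heq] at this
  exact this

end Bias

/-! ### Weighted sums of localized observations -/

section Weighted
variable {Ω F E : Type*} [MeasurableSpace Ω] [PseudoMetricSpace F] [MeasurableSpace F]
  [MeasurableSpace E] {P : Measure Ω} {X : ℕ → Ω → F} {Y : ℕ → Ω → E} {κ : Kernel F E} {x : F}
  {h : ℕ → ℝ} {w : ℕ → F → ℝ}

/-- An i.i.d. sample together with bounded nonnegative weights `w n` which concentrate at `x` and
whose total expected mass tends to infinity. -/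
structure WeightedSample (P : Measure Ω) (X : ℕ → Ω → F) (Y : ℕ → Ω → E) (κ : Kernel F E) (x : F)
    (h : ℕ → ℝ) (w : ℕ → F → ℝ) : Prop where
  indep : iIndepFun (fun i ω => (X i ω, Y i ω)) P
  ident : ∀ i, IdentDistrib (fun ω => (X i ω, Y i ω)) (fun ω => (X 0 ω, Y 0 ω)) P P
  cond : HasCondDistrib (Y 0) (X 0) κ P
  meas : ∀ n, Measurable (w n)
  nonneg : ∀ n x', 0 ≤ w n x'
  bounded : ∃ C, ∀ n x', w n x' ≤ C
  supp : ∀ n x', h n < dist x x' → w n x' = 0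
  lim : Tendsto h atTop (𝓝 0)
  mass : Tendsto (fun n : ℕ => n * ∫ ω, w n (X 0 ω) ∂P) atTop atTop

namespace WeightedSample

lemma integrable [IsProbabilityMeasure P] (S : WeightedSample P X Y κ x h w) (n : ℕ) :
    Integrable (fun ω => w n (X 0 ω)) P := by
  obtain ⟨C, hC⟩ := S.bounded
  refine Integrable.of_bound (C := C)
    ((S.meas n).comp_aemeasurable S.cond.aemeasurable_fst).aestronglyMeasurable
    (.of_forall fun ω => ?_)
  rw [Real.norm_eq_abs, abs_of_nonneg (S.nonneg _ _)]
  exact hC _ _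

lemma lintegral_ofReal [IsProbabilityMeasure P] (S : WeightedSample P X Y κ x h w) (n : ℕ) :
    ∫⁻ ω, ENNReal.ofReal (w n (X 0 ω)) ∂P = ENNReal.ofReal (∫ ω, w n (X 0 ω) ∂P) :=
  (ofReal_integral_eq_lintegral_ofReal (S.integrable n) (.of_forall fun _ => S.nonneg _ _)).symm

lemma mass_pos (S : WeightedSample P X Y κ x h w) :
    ∀ᶠ n : ℕ in atTop, 0 < n * ∫ ω, w n (X 0 ω) ∂P := S.mass.eventually_gt_atTop 0

lemma integral_nonneg (S : WeightedSample P X Y κ x h w) (n : ℕ) :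
    0 ≤ ∫ ω, w n (X 0 ω) ∂P := MeasureTheory.integral_nonneg fun _ => S.nonneg _ _

lemma tendsto_integral [IsProbabilityMeasure P] [IsMarkovKernel κ]
    (S : WeightedSample P X Y κ x h w) {f : E → ℝ} (hf : Measurable f)
    (hwf : ∀ᶠ n in atTop, Integrable (fun ω => w n (X 0 ω) * f (Y 0 ω)) P) {a : ℝ}
    (ha : Tendsto (fun x' => ∫ y, f y ∂κ x') (𝓝 x) (𝓝 a)) :
    Tendsto (fun n : ℕ => (n * ∫ ω, w n (X 0 ω) ∂P)⁻¹
      * (n * ∫ ω, w n (X 0 ω) * f (Y 0 ω) ∂P)) atTop (𝓝 a) := by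
  rw [Metric.tendsto_nhds]
  intro η hη
  have h1 : ∀ᶠ x' in 𝓝 x, |∫ y, f y ∂κ x' - a| ≤ η / 2 :=
    (Metric.tendsto_nhds.1 ha (η / 2) (half_pos hη)).mono fun x' hx' => hx'.le
  filter_upwards [eventually_forall_dist_le h1 S.lim, S.mass_pos, hwf] with n hn hp hi
  have h2 := S.cond.abs_integral_mul_sub_le (S.meas n) (S.nonneg n) (S.supp n) (S.integrable n)
    hf hi hn
  set m := ∫ ω, w n (X 0 ω) ∂P
  rw [Real.dist_eq]
  have e : (n * m)⁻¹ * (n * ∫ ω, w n (X 0 ω) * f (Y 0 ω) ∂P) - a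
      = (n * m)⁻¹ * (n * (∫ ω, w n (X 0 ω) * f (Y 0 ω) ∂P - a * m)) := by
    field_simp [hp.ne', left_ne_zero_of_mul hp.ne', right_ne_zero_of_mul hp.ne']
  rw [e, abs_mul, abs_mul, abs_of_pos (inv_pos.2 hp), Nat.abs_cast]
  calc (n * m)⁻¹ * (n * |∫ ω, w n (X 0 ω) * f (Y 0 ω) ∂P - a * m|)
      ≤ (n * m)⁻¹ * (n * (η / 2 * m)) := by gcongr
    _ = η / 2 := by
      field_simp [hp.ne', left_ne_zero_of_mul hp.ne', right_ne_zero_of_mul hp.ne']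
    _ < η := half_lt_self hη

lemma eventually_lintegral_mul_le [IsProbabilityMeasure P] [IsMarkovKernel κ]
    (S : WeightedSample P X Y κ x h w) {f : E → ℝ≥0∞} (hf : Measurable f) {B : ℝ≥0∞}
    (hB : ∀ᶠ x' in 𝓝 x, ∫⁻ y, f y ∂κ x' ≤ B) :
    ∀ᶠ n in atTop, ∫⁻ ω, ENNReal.ofReal (w n (X 0 ω)) * f (Y 0 ω) ∂P
      ≤ B * ENNReal.ofReal (∫ ω, w n (X 0 ω) ∂P) := by
  filter_upwards [eventually_forall_dist_le hB S.lim] with n hn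
  rw [← S.lintegral_ofReal]
  exact S.cond.lintegral_mul_le (w := fun x' => ENNReal.ofReal (w n x')) (S.meas n).ennreal_ofReal
    (fun x' hx' => by simp [S.supp n x' hx']) hf hn

/-- Second moments of the summands. -/
lemma exists_eventually_sq_le [IsProbabilityMeasure P] [IsMarkovKernel κ]
    (S : WeightedSample P X Y κ x h w) {f : E → ℝ} (hf : Measurable f) {B : ℝ≥0∞} (hB0 : B ≠ ∞)
    (hB : ∀ᶠ x' in 𝓝 x, ∫⁻ y, ‖f y‖ₑ ^ 2 ∂κ x' ≤ B) :
    ∃ C, ∀ᶠ n in atTop, MemLp (fun ω => w n (X 0 ω) * f (Y 0 ω)) 2 P ∧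
      ∫ ω, (w n (X 0 ω) * f (Y 0 ω)) ^ 2 ∂P ≤ C * ∫ ω, w n (X 0 ω) ∂P := by
  obtain ⟨C, hC⟩ := S.bounded
  refine ⟨C * B.toReal, ?_⟩
  have hC0 : 0 ≤ C := (S.nonneg 0 x).trans (hC 0 x)
  filter_upwards [S.eventually_lintegral_mul_le (f := fun y => ‖f y‖ₑ ^ 2) (by fun_prop) hB]
    with n hn
  have hm : AEStronglyMeasurable (fun ω => w n (X 0 ω) * f (Y 0 ω)) P :=
    (((S.meas n).comp_aemeasurable S.cond.aemeasurable_fst).mul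
      (hf.comp_aemeasurable S.cond.aemeasurable_snd)).aestronglyMeasurable
  have hle : ∫⁻ ω, ‖(w n (X 0 ω) * f (Y 0 ω)) ^ 2‖ₑ ∂P
      ≤ ENNReal.ofReal C * (B * ENNReal.ofReal (∫ ω, w n (X 0 ω) ∂P)) := by
    calc ∫⁻ ω, ‖(w n (X 0 ω) * f (Y 0 ω)) ^ 2‖ₑ ∂P
        ≤ ∫⁻ ω, ENNReal.ofReal C * (ENNReal.ofReal (w n (X 0 ω)) * ‖f (Y 0 ω)‖ₑ ^ 2) ∂P := by
          refine lintegral_mono fun ω => ?_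
          simp only
          rw [enorm_pow, enorm_mul, mul_pow, sq ‖w n (X 0 ω)‖ₑ,
            Real.enorm_of_nonneg (S.nonneg n _), mul_assoc]
          gcongr
          exact hC _ _
      _ ≤ _ := by
        rw [lintegral_const_mul' _ _ ENNReal.ofReal_ne_top]
        gcongr
  have htop : ENNReal.ofReal C * (B * ENNReal.ofReal (∫ ω, w n (X 0 ω) ∂P)) ≠ ∞ :=
    ENNReal.mul_ne_top ENNReal.ofReal_ne_top (ENNReal.mul_ne_top hB0 ENNReal.ofReal_ne_top)
  constructor
  · rw [memLp_two_iff_integrable_sq hm]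
    exact ⟨hm.pow 2, hle.trans_lt htop.lt_top⟩
  · rw [integral_eq_lintegral_of_nonneg_ae (.of_forall fun _ => sq_nonneg _) (hm.pow 2)]
    refine (ENNReal.toReal_mono htop ((lintegral_mono fun ω => ?_).trans hle)).trans_eq ?_
    · rw [Real.enorm_of_nonneg (sq_nonneg _)]
    · rw [ENNReal.toReal_mul, ENNReal.toReal_mul, ENNReal.toReal_ofReal hC0,
        ENNReal.toReal_ofReal (S.integral_nonneg n), mul_assoc]

lemma measurable_mul [IsProbabilityMeasure P] (S : WeightedSample P X Y κ x h w) {f : E → ℝ}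
    (hf : Measurable f) (n : ℕ) : Measurable fun q : F × E => w n q.1 * f q.2 :=
  ((S.meas n).comp measurable_fst).mul (hf.comp measurable_snd)

/-- The weak law of large numbers for localized weights. -/
lemma tendsto_mean [IsProbabilityMeasure P] [IsMarkovKernel κ]
    (S : WeightedSample P X Y κ x h w) {f : E → ℝ} (hf : Measurable f) {B : ℝ≥0∞} (hB0 : B ≠ ∞)
    (hB : ∀ᶠ x' in 𝓝 x, ∫⁻ y, ‖f y‖ₑ ^ 2 ∂κ x' ≤ B) {a : ℝ}
    (ha : Tendsto (fun x' => ∫ y, f y ∂κ x') (𝓝 x) (𝓝 a)) :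
    Tendsto (fun z : ℕ × Ω => (z.1 * ∫ ω, w z.1 (X 0 ω) ∂P)⁻¹
      * ∑ i ∈ Finset.range z.1, w z.1 (X i z.2) * f (Y i z.2)) (inProb P) (𝓝 a) := by
  obtain ⟨C, hC⟩ := S.exists_eventually_sq_le hf hB0 hB
  refine tendsto_inProb_mul_sum (Z := fun i ω => (X i ω, Y i ω)) S.indep S.ident
    (ξ := fun n q => w n q.1 * f q.2) (c := fun n : ℕ => (n * ∫ ω, w n (X 0 ω) ∂P)⁻¹)
    (S.measurable_mul hf) (hC.mono fun n hn => hn.1) ?_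
    (S.tendsto_integral hf (hC.mono fun n hn => hn.1.integrable one_le_two) ha)
  -- Bounded weights satisfy w² ≤ C w, so the normalized second moment is at most a constant over n
  -- E w, which tends to 0.
  refine squeeze_zero' (.of_forall fun n => by positivity) ?_
    (S.mass.inv_tendsto_atTop.const_mul C |>.trans (by rw [mul_zero]))
  filter_upwards [hC, S.mass_pos] with n hn hp
  simp only [Pi.inv_apply]
  calc ((n * ∫ ω, w n (X 0 ω) ∂P)⁻¹) ^ 2 * (n * ∫ ω, (w n (X 0 ω) * f (Y 0 ω)) ^ 2 ∂P)
      ≤ ((n * ∫ ω, w n (X 0 ω) ∂P)⁻¹) ^ 2 * (n * (C * ∫ ω, w n (X 0 ω) ∂P)) := by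
        gcongr; exact hn.2
    _ = C * (n * ∫ ω, w n (X 0 ω) ∂P)⁻¹ := by
      field_simp [hp.ne', left_ne_zero_of_mul hp.ne', right_ne_zero_of_mul hp.ne']

lemma tendsto_total [IsProbabilityMeasure P] [IsMarkovKernel κ]
    (S : WeightedSample P X Y κ x h w) :
    Tendsto (fun z : ℕ × Ω => (z.1 * ∫ ω, w z.1 (X 0 ω) ∂P)⁻¹
      * ∑ i ∈ Finset.range z.1, w z.1 (X i z.2)) (inProb P) (𝓝 1) := by
  have := S.tendsto_mean (f := fun _ => 1) measurable_const (B := 1) ENNReal.one_ne_top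
    (.of_forall fun x' => by simp) (a := 1) (by simp)
  simpa using this

/-- Markov bound for sums of nonnegative localized terms. -/
lemma tendsto_mul_sum_of_nonneg [IsProbabilityMeasure P] [IsMarkovKernel κ]
    (S : WeightedSample P X Y κ x h w) {f : ℕ → E → ℝ} (hf : ∀ n, Measurable (f n))
    (hf0 : ∀ n y, 0 ≤ f n y) {c B : ℕ → ℝ} (hc : ∀ n, 0 ≤ c n)
    (hB : ∀ᶠ n in atTop, ∀ x', dist x x' ≤ h n →
      ∫⁻ y, ENNReal.ofReal (f n y) ∂κ x' ≤ ENNReal.ofReal (B n))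
    (hlim : Tendsto (fun n : ℕ => c n * B n * (n * ∫ ω, w n (X 0 ω) ∂P)) atTop (𝓝 0)) :
    Tendsto (fun z : ℕ × Ω => c z.1 * ∑ i ∈ Finset.range z.1, w z.1 (X i z.2) * f z.1 (Y i z.2))
      (inProb P) (𝓝 0) := by
  refine tendsto_inProb_mul_sum_of_nonneg (Z := fun i ω => (X i ω, Y i ω)) S.ident
    (ξ := fun n q => w n q.1 * f n q.2) (fun n => S.measurable_mul (hf n) n)
    (fun n q => mul_nonneg (S.nonneg _ _) (hf0 _ _)) hc ?_
  have hlim' := ENNReal.tendsto_ofReal hlim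
  rw [ENNReal.ofReal_zero] at hlim'
  refine tendsto_of_tendsto_of_tendsto_of_le_of_le' tendsto_const_nhds hlim'
    (.of_forall fun _ => zero_le) ?_
  filter_upwards [hB] with n hn
  have h1 := S.cond.lintegral_mul_le (w := fun x' => ENNReal.ofReal (w n x'))
    (S.meas n).ennreal_ofReal (fun x' hx' => by simp [S.supp n x' hx'])
    (f := fun y => ENNReal.ofReal (f n y)) (hf n).ennreal_ofReal hn
  rw [S.lintegral_ofReal] at h1
  simp only [ENNReal.ofReal_mul (S.nonneg _ _)]
  calc ENNReal.ofReal (c n) * (n * ∫⁻ ω, ENNReal.ofReal (w n (X 0 ω))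
        * ENNReal.ofReal (f n (Y 0 ω)) ∂P)
      ≤ ENNReal.ofReal (c n) * (n * (ENNReal.ofReal (B n)
        * ENNReal.ofReal (∫ ω, w n (X 0 ω) ∂P))) := by gcongr
    _ = ENNReal.ofReal (c n * (n * ∫ ω, w n (X 0 ω) ∂P)) * ENNReal.ofReal (B n) := by
        rw [ENNReal.ofReal_mul (hc n), ENNReal.ofReal_mul (Nat.cast_nonneg n),
          ENNReal.ofReal_natCast]
        ring
    _ = ENNReal.ofReal (c n * B n * (n * ∫ ω, w n (X 0 ω) ∂P)) := by
        rw [← ENNReal.ofReal_mul (mul_nonneg (hc n) (mul_nonneg (Nat.cast_nonneg n)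
          (S.integral_nonneg n)))]
        congr 1
        ring

end WeightedSample
end Weighted

/-! ### The kernel weights -/

/-- The weight that the kernel assigns to an observation `x'`. -/
noncomputable def kernelWeight {F : Type*} [PseudoMetricSpace F] (K : ℝ → ℝ) (x : F) (h : ℕ → ℝ)
    (n : ℕ) (x' : F) : ℝ := K (dist x x' / h n)

/-- The expected total weight of `n` observations. -/
noncomputable def totalMass {Ω F : Type*} [MeasurableSpace Ω] (P : Measure Ω) (X : ℕ → Ω → F)
    (w : ℕ → F → ℝ) (n : ℕ) : ℝ := n * ∫ ω, w n (X 0 ω) ∂P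

section Sample
variable {d : ℕ} {Ω F : Type*} [MeasurableSpace Ω] [PseudoMetricSpace F] [MeasurableSpace F]
  {P : Measure Ω} {X : ℕ → Ω → F} {Y : ℕ → Ω → Vec d} {κ : Kernel F (Vec d)} {x : F} {μ : Vec d}
  {K : ℝ → ℝ} {h : ℕ → ℝ} {β : ℝ}

/-- The standing assumptions on the sample, the kernel, the bandwidth and the conditional law. -/
structure MedianSample (P : Measure Ω) (X : ℕ → Ω → F) (Y : ℕ → Ω → Vec d) (κ : Kernel F (Vec d))
    (x : F) (μ : Vec d) (K : ℝ → ℝ) (h : ℕ → ℝ) (β : ℝ) : Prop where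
  two_le : 2 ≤ d
  measurable_dist : Measurable fun x' : F => dist x x'
  measurable_fst : ∀ i, Measurable (X i)
  measurable_snd : ∀ i, Measurable (Y i)
  indep : iIndepFun (fun i ω => (X i ω, Y i ω)) P
  ident : ∀ i, IdentDistrib (fun ω => (X i ω, Y i ω)) (fun ω => (X 0 ω, Y 0 ω)) P P
  cond : HasCondDistrib (Y 0) (X 0) κ P
  median : IsCondMedian κ x μ
  nondeg : ∀ v : Vec d, v ≠ 0 → ¬ ∀ᵐ y ∂κ x, inner ℝ v (y - μ) = 0
  pos : ∀ n, 0 < h n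
  lim : Tendsto h atTop (𝓝 0)
  kernel : KernelAssumption K
  smooth : SmoothnessAssumption κ x μ β
  moment : MomentAssumption κ x μ
  bias : BiasAssumption P (X 0) (Y 0) x μ
  mass : Tendsto (fun n : ℕ => n * smallBall P (X 0) x (h n)) atTop atTop
  band : Tendsto (fun n : ℕ => √(n * smallBall P (X 0) x (h n)) * h n) atTop (𝓝 0)

lemma norm_le_sum_abs (v : Vec d) : ‖v‖ ≤ ∑ k, |v k| := by
  conv_lhs => rw [← (EuclideanSpace.basisFun (Fin d) ℝ).sum_repr v]
  refine (norm_sum_le _ _).trans (Finset.sum_le_sum fun k _ => ?_)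
  simp [norm_smul]

/-- A random vector sequence with tight coordinates is tight. -/
lemma tight_of_forall_tight_apply {W : ℕ → Ω → Vec d}
    (hW : ∀ k, ∀ ε : ℝ≥0∞, 0 < ε → ∃ M : ℝ, ∀ᶠ n in atTop, P {ω | M < |W n ω k|} ≤ ε)
    (ε : ℝ≥0∞) (hε : 0 < ε) : ∃ M : ℝ, ∀ᶠ n in atTop, P {ω | M < ‖W n ω‖} ≤ ε := by
  -- Splitting ε into d + 1 shares keeps the divisor nonzero even when d = 0.
  have hε' : 0 < ε / (d + 1 : ℕ) := ENNReal.div_pos hε.ne' (ENNReal.natCast_ne_top _)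
  choose M hM using fun k => hW k _ hε'
  refine ⟨∑ k, M k, ?_⟩
  filter_upwards [eventually_all.2 hM] with n hn
  calc P {ω | ∑ k, M k < ‖W n ω‖} ≤ P (⋃ k, {ω | M k < |W n ω k|}) := by
        refine measure_mono fun ω hω => ?_
        by_contra hc
        simp only [mem_iUnion, mem_ofPred_eq, not_exists, not_lt] at hc hω
        exact absurd (hω.trans_le (norm_le_sum_abs _)) (not_lt.2 (Finset.sum_le_sum fun k _ => hc k))
    _ ≤ ∑ k, P {ω | M k < |W n ω k|} := measure_iUnion_fintype_le _ _
    _ ≤ ∑ _k : Fin d, ε / (d + 1 : ℕ) := Finset.sum_le_sum fun k _ => hn k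
    _ ≤ (d + 1 : ℕ) * (ε / (d + 1 : ℕ)) := by
        rw [Finset.sum_const, Finset.card_univ, Fintype.card_fin, nsmul_eq_mul]
        gcongr
        simp
    _ ≤ ε := ENNReal.mul_div_le

namespace MedianSample

lemma integral_indicator_eq [IsProbabilityMeasure P] (S : MedianSample P X Y κ x μ K h β) (r : ℝ) :
    ∫ ω, (if dist x (X 0 ω) ≤ r then (1 : ℝ) else 0) ∂P = smallBall P (X 0) x r := by
  have hs : MeasurableSet {ω | dist x (X 0 ω) ≤ r} :=
    measurableSet_le (S.measurable_dist.comp (S.measurable_fst 0)) measurable_const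
  rw [smallBall, ← integral_indicator_one hs]
  rfl

lemma measurable_indicator (S : MedianSample P X Y κ x μ K h β) (r : ℝ) :
    Measurable fun x' : F => if dist x x' ≤ r then (1 : ℝ) else 0 :=
  Measurable.ite (measurableSet_le S.measurable_dist measurable_const) measurable_const
    measurable_const

lemma integrable_indicator [IsProbabilityMeasure P] (S : MedianSample P X Y κ x μ K h β) (r : ℝ) :
    Integrable (fun ω => if dist x (X 0 ω) ≤ r then (1 : ℝ) else 0) P := by
  refine Integrable.of_bound (C := 1)
    ((S.measurable_indicator r).comp (S.measurable_fst 0)).aestronglyMeasurable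
    (.of_forall fun ω => ?_)
  split_ifs <;> simp

lemma measurable_kernelWeight (S : MedianSample P X Y κ x μ K h β) (n : ℕ) :
    Measurable (kernelWeight K x h n) := measurable_kernel_weight S.kernel S.measurable_dist _

lemma kernelWeight_eq_zero (S : MedianSample P X Y κ x μ K h β) (n : ℕ) (x' : F)
    (hx' : h n < dist x x') : kernelWeight K x h n x' = 0 := S.kernel.eq_zero_of_lt (S.pos n) hx'

lemma smallBall_le [IsProbabilityMeasure P] (S : MedianSample P X Y κ x μ K h β) (n : ℕ) :
    K 1 * (n * smallBall P (X 0) x (h n)) ≤ totalMass P X (kernelWeight K x h) n := by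
  rw [totalMass, ← S.integral_indicator_eq, mul_left_comm, ← integral_const_mul]
  refine mul_le_mul_of_nonneg_left (integral_mono ((S.integrable_indicator _).const_mul _)
    (integrable_kernel_weight S.kernel S.measurable_dist (S.measurable_fst 0) _) fun ω => ?_)
    (Nat.cast_nonneg n)
  have := S.kernel.indicator_le (dist_nonneg (x := x) (y := X 0 ω)) (S.pos n)
  simpa [kernelWeight] using this

lemma exists_le_smallBall [IsProbabilityMeasure P] (S : MedianSample P X Y κ x μ K h β) :
    ∃ C > 0, ∀ n, totalMass P X (kernelWeight K x h) n ≤ C * (n * smallBall P (X 0) x (h n)) := by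
  obtain ⟨C, hC0, hC⟩ := S.kernel.exists_pos_bound
  refine ⟨C, hC0, fun n => ?_⟩
  rw [totalMass, ← S.integral_indicator_eq, mul_left_comm, ← integral_const_mul C]
  refine mul_le_mul_of_nonneg_left (integral_mono
    (integrable_kernel_weight S.kernel S.measurable_dist (S.measurable_fst 0) _)
    ((S.integrable_indicator _).const_mul _) fun ω => ?_) (Nat.cast_nonneg n)
  simp only
  split_ifs with h1
  · simpa [kernelWeight] using hC _
  · simp [S.kernelWeight_eq_zero n _ (not_le.1 h1)]

lemma tendsto_totalMass [IsProbabilityMeasure P] (S : MedianSample P X Y κ x μ K h β) :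
    Tendsto (totalMass P X (kernelWeight K x h)) atTop atTop :=
  tendsto_atTop_mono S.smallBall_le (S.mass.const_mul_atTop S.kernel.one_pos)

lemma totalMass_nonneg (S : MedianSample P X Y κ x μ K h β) (n : ℕ) :
    0 ≤ totalMass P X (kernelWeight K x h) n :=
  mul_nonneg (Nat.cast_nonneg n) (integral_nonneg fun _ => S.kernel.nonneg _)

lemma tendsto_sqrt_mul [IsProbabilityMeasure P] (S : MedianSample P X Y κ x μ K h β) :
    Tendsto (fun n => √(totalMass P X (kernelWeight K x h) n) * h n) atTop (𝓝 0) := by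
  obtain ⟨C, hC0, hC⟩ := S.exists_le_smallBall
  have := S.band.const_mul √C
  rw [mul_zero] at this
  refine squeeze_zero (fun n => mul_nonneg (Real.sqrt_nonneg _) (S.pos n).le) (fun n => ?_) this
  rw [← mul_assoc, ← Real.sqrt_mul hC0.le]
  exact mul_le_mul_of_nonneg_right (Real.sqrt_le_sqrt (hC n)) (S.pos n).le

lemma kernelWeight_sq_integrable [IsProbabilityMeasure P] (S : MedianSample P X Y κ x μ K h β)
    (n : ℕ) : Integrable (fun ω => kernelWeight K x h n (X 0 ω) ^ 2) P := by
  obtain ⟨C, hC0, hC⟩ := S.kernel.exists_pos_bound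
  refine Integrable.of_bound (C := C ^ 2)
    (((S.measurable_kernelWeight n).comp (S.measurable_fst 0)).pow_const 2).aestronglyMeasurable
    (.of_forall fun ω => ?_)
  rw [norm_pow, Real.norm_eq_abs, sq_abs]
  exact pow_le_pow_left₀ (S.kernel.nonneg _) (hC _) 2

lemma le_totalMass_sq [IsProbabilityMeasure P] (S : MedianSample P X Y κ x μ K h β) (n : ℕ) :
    K 1 * totalMass P X (kernelWeight K x h) n
      ≤ totalMass P X (fun n x' => kernelWeight K x h n x' ^ 2) n := by
  rw [totalMass, totalMass, mul_left_comm, ← integral_const_mul (K 1)]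
  refine mul_le_mul_of_nonneg_left (integral_mono
    ((integrable_kernel_weight S.kernel S.measurable_dist (S.measurable_fst 0) _).const_mul _)
    (S.kernelWeight_sq_integrable n) fun ω => ?_) (Nat.cast_nonneg n)
  simp only [sq]
  rcases le_or_gt (dist x (X 0 ω)) (h n) with h1 | h1
  · refine mul_le_mul_of_nonneg_right ?_ (S.kernel.nonneg _)
    exact S.kernel.one_le_apply ⟨div_nonneg dist_nonneg (S.pos n).le,
      (div_le_one (S.pos n)).2 h1⟩
  · have := S.kernelWeight_eq_zero n _ h1
    rw [kernelWeight] at this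
    simp [kernelWeight, this]

lemma exists_totalMass_sq_le [IsProbabilityMeasure P] (S : MedianSample P X Y κ x μ K h β) :
    ∃ C > 0, ∀ n, totalMass P X (fun n x' => kernelWeight K x h n x' ^ 2) n
      ≤ C * totalMass P X (kernelWeight K x h) n := by
  obtain ⟨C, hC0, hC⟩ := S.kernel.exists_pos_bound
  refine ⟨C, hC0, fun n => ?_⟩
  rw [totalMass, totalMass, mul_left_comm, ← integral_const_mul C]
  refine mul_le_mul_of_nonneg_left (integral_mono (S.kernelWeight_sq_integrable n)
    ((integrable_kernel_weight S.kernel S.measurable_dist (S.measurable_fst 0) _).const_mul _)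
    fun ω => ?_) (Nat.cast_nonneg n)
  simp only [sq]
  exact mul_le_mul_of_nonneg_right (hC _) (S.kernel.nonneg _)

lemma tendsto_totalMass_sq [IsProbabilityMeasure P] (S : MedianSample P X Y κ x μ K h β) :
    Tendsto (totalMass P X fun n x' => kernelWeight K x h n x' ^ 2) atTop atTop :=
  tendsto_atTop_mono S.le_totalMass_sq (S.tendsto_totalMass.const_mul_atTop S.kernel.one_pos)

lemma weighted [IsProbabilityMeasure P] (S : MedianSample P X Y κ x μ K h β) :
    WeightedSample P X Y κ x h (kernelWeight K x h) where
  indep := S.indep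
  ident := S.ident
  cond := S.cond
  meas := S.measurable_kernelWeight
  nonneg _ _ := S.kernel.nonneg _
  bounded := S.kernel.bounded.imp fun _ hC _ _ => hC _
  supp := S.kernelWeight_eq_zero
  lim := S.lim
  mass := S.tendsto_totalMass

lemma weighted_sq [IsProbabilityMeasure P] (S : MedianSample P X Y κ x μ K h β) :
    WeightedSample P X Y κ x h (fun n x' => kernelWeight K x h n x' ^ 2) where
  indep := S.indep
  ident := S.ident
  cond := S.cond
  meas n := (S.measurable_kernelWeight n).pow_const 2
  nonneg _ _ := sq_nonneg _
  bounded := S.kernel.bounded.imp' (fun C => C ^ 2) fun _ hC _ _ =>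
    pow_le_pow_left₀ (S.kernel.nonneg _) (hC _) 2
  supp n x' hx' := by rw [S.kernelWeight_eq_zero n x' hx']; norm_num
  lim := S.lim
  mass := S.tendsto_totalMass_sq

/-- Indicator weights turn the Markov bound for kernel sums into a bound on the number of
observations in the ball whose responses lie close to μ. -/
lemma weighted_ball [IsProbabilityMeasure P] (S : MedianSample P X Y κ x μ K h β) :
    WeightedSample P X Y κ x h (fun n x' => if dist x x' ≤ h n then 1 else 0) where
  indep := S.indep
  ident := S.ident
  cond := S.cond
  meas n := S.measurable_indicator _
  nonneg _ _ := by split_ifs <;> simp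
  bounded := ⟨1, fun _ _ => by split_ifs <;> simp⟩
  supp n x' hx' := if_neg (not_le.2 hx')
  lim := S.lim
  mass := by
    simp only [S.integral_indicator_eq]
    exact S.mass

lemma lintegral_ne_top [IsMarkovKernel κ] (S : MedianSample P X Y κ x μ K h β) :
    ∫⁻ y, ‖y - μ‖ₑ ^ (-2 : ℝ) ∂κ x ≠ ∞ := by
  obtain ⟨B, hB0, hB⟩ := eventually_lintegral_enorm_rpow_le S.smooth
  exact (hB.self_of_nhds.trans_lt hB0.lt_top).ne

/-- The standardized mean of the kernel sum of spatial signs vanishes. -/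
lemma tendsto_mean_inner [IsProbabilityMeasure P] [IsMarkovKernel κ]
    (S : MedianSample P X Y κ x μ K h β) (v : Vec d) :
    Tendsto (fun n : ℕ => (√(totalMass P X (fun n x' => kernelWeight K x h n x' ^ 2) n))⁻¹
      * (n * ∫ ω, kernelWeight K x h n (X 0 ω) * inner ℝ v (spatialSign (Y 0 ω - μ)) ∂P))
      atTop (𝓝 0) := by
  have hmass : ∀ᶠ n in atTop, 0 < ∫ ω, K (dist x (X 0 ω) / h n) ∂P := by
    filter_upwards [S.weighted.mass_pos] with n hn
    exact pos_of_mul_pos_right hn (Nat.cast_nonneg n)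
  obtain ⟨C, hC⟩ := exists_norm_integral_kernel_sign_le S.kernel S.measurable_dist
    (S.measurable_fst 0) (S.measurable_snd 0) S.cond S.median S.smooth S.moment S.lintegral_ne_top
    S.bias S.pos S.lim hmass
  have hlim := (S.tendsto_sqrt_mul.const_mul (‖v‖ * C * (√(K 1))⁻¹))
  rw [mul_zero] at hlim
  refine squeeze_zero_norm' ?_ hlim
  filter_upwards [hC, S.tendsto_totalMass.eventually_gt_atTop 0] with n hn hp
  set s := totalMass P X (kernelWeight K x h) n with hs
  set q := totalMass P X (fun n x' => kernelWeight K x h n x' ^ 2) n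
  have hq : K 1 * s ≤ q := S.le_totalMass_sq n
  have hK1 := S.kernel.one_pos
  -- Since q ≥ K(1) s, a bias of order h s divided by √q is of order √s h, which the bandwidth
  -- condition sends to 0.
  have hqs : (√q)⁻¹ ≤ (√(K 1))⁻¹ * (√s)⁻¹ := by
    rw [← mul_inv, ← Real.sqrt_mul hK1.le]
    exact inv_anti₀ (Real.sqrt_pos.2 (by positivity)) (Real.sqrt_le_sqrt hq)
  have hwU : Integrable (fun ω => K (dist x (X 0 ω) / h n) • spatialSign (Y 0 ω - μ)) P := by
    refine (S.weighted.integrable n).mono' (((S.measurable_kernelWeight n).comp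
      (S.measurable_fst 0)).smul ((measurable_spatialSign_sub μ).comp
        (S.measurable_snd 0))).aestronglyMeasurable (.of_forall fun ω => ?_)
    rw [norm_smul, Real.norm_eq_abs, abs_of_nonneg (S.kernel.nonneg _)]
    exact mul_le_of_le_one_right (S.kernel.nonneg _) (norm_spatialSign_le _)
  have e : ∫ ω, kernelWeight K x h n (X 0 ω) * inner ℝ v (spatialSign (Y 0 ω - μ)) ∂P
      = inner ℝ v (∫ ω, K (dist x (X 0 ω) / h n) • spatialSign (Y 0 ω - μ) ∂P) := by
    rw [← integral_inner hwU]
    simp_rw [inner_smul_right]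
    rfl
  have hI : ‖∫ ω, kernelWeight K x h n (X 0 ω) * inner ℝ v (spatialSign (Y 0 ω - μ)) ∂P‖
      ≤ ‖v‖ * (C * h n * ∫ ω, K (dist x (X 0 ω) / h n) ∂P) := by
    rw [e]
    exact (norm_inner_le_norm _ _).trans (mul_le_mul_of_nonneg_left hn (norm_nonneg _))
  have hnn : 0 ≤ ‖v‖ * (C * h n * ∫ ω, K (dist x (X 0 ω) / h n) ∂P) := (norm_nonneg _).trans hI
  rw [norm_mul, norm_mul, norm_inv, Real.norm_of_nonneg (Real.sqrt_nonneg _), Real.norm_natCast]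
  calc _ ≤ ((√(K 1))⁻¹ * (√s)⁻¹) * (n * (‖v‖ * (C * h n * ∫ ω, K (dist x (X 0 ω) / h n) ∂P))) := by
        gcongr
    _ = ‖v‖ * C * (√(K 1))⁻¹ * h n * ((√s)⁻¹ * s) := by
        rw [hs, totalMass]
        simp only [kernelWeight]
        ring
    _ = ‖v‖ * C * (√(K 1))⁻¹ * (√s * h n) := by
        have : (√s)⁻¹ * s = √s := by
          rw [inv_mul_eq_iff_eq_mul₀ (Real.sqrt_pos.2 hp).ne', Real.mul_self_sqrt hp.le]
        rw [this]
        ring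

end MedianSample
end Sample

/-! ### Choice of the localization radius -/

/-- Take r = 1/(p √s) with p = (ε + 1/s)^(1/8) → 0. Then (r√s)⁻¹ = p. Since 1/s ≤ p⁸ and ε ≤ p⁸, one
gets √s r² = 1/(p²√s) ≤ p², s r² ε = ε/p² ≤ p⁶, and r⁴ ≤ p⁴/s ≤ 1/s for large n. -/
lemma exists_localization_rate {s ε : ℕ → ℝ} (hs : Tendsto s atTop atTop) (hε0 : ∀ n, 0 ≤ ε n)
    (hε : Tendsto ε atTop (𝓝 0)) :
    ∃ r : ℕ → ℝ, (∀ n, 0 ≤ r n) ∧ (∀ᶠ n in atTop, 0 < r n) ∧ Tendsto r atTop (𝓝 0) ∧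
      Tendsto (fun n => (r n * √(s n))⁻¹) atTop (𝓝 0) ∧
      Tendsto (fun n => √(s n) * r n ^ 2) atTop (𝓝 0) ∧
      Tendsto (fun n => s n * r n ^ 2 * ε n) atTop (𝓝 0) ∧
      ∀ᶠ n in atTop, r n ≤ √√(s n)⁻¹ := by
  set p : ℕ → ℝ := fun n => |ε n + (s n)⁻¹| ^ (1 / 8 : ℝ) with hp
  have hp0 : ∀ n, 0 ≤ p n := fun n => by positivity
  have hplim : Tendsto p atTop (𝓝 0) := by
    have h1 := (hε.add hs.inv_tendsto_atTop).abs
    rw [add_zero, abs_zero] at h1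
    have h2 := (Real.continuousAt_rpow_const 0 (1 / 8) (.inr (by norm_num))).tendsto.comp h1
    rw [Real.zero_rpow (by norm_num)] at h2
    exact h2
  have hpow : ∀ k : ℕ, k ≠ 0 → Tendsto (fun n => p n ^ k) atTop (𝓝 0) := fun k hk => by
    have := hplim.pow k
    rwa [zero_pow hk] at this
  have hs0 := hs.eventually_gt_atTop 0
  have hkey : ∀ᶠ n in atTop, 0 < s n ∧ 0 < p n ∧ p n ^ 8 = ε n + (s n)⁻¹ := by
    filter_upwards [hs0] with n hn
    have h1 : 0 < ε n + (s n)⁻¹ := add_pos_of_nonneg_of_pos (hε0 n) (inv_pos.2 hn)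
    refine ⟨hn, by positivity, ?_⟩
    rw [hp]
    simp only
    rw [abs_of_pos h1, ← Real.rpow_natCast, ← Real.rpow_mul h1.le]
    norm_num
  have hr4 : ∀ᶠ n in atTop, ((p n * √(s n))⁻¹) ^ 4 ≤ p n ^ 4 * (s n)⁻¹ ∧
      ((p n * √(s n))⁻¹) ^ 2 = (p n ^ 2)⁻¹ * (s n)⁻¹ := by
    filter_upwards [hkey] with n ⟨h1, h2, h3⟩
    have e2 : ((p n * √(s n))⁻¹) ^ 2 = (p n ^ 2)⁻¹ * (s n)⁻¹ := by
      rw [inv_pow, mul_pow, Real.sq_sqrt h1.le, mul_inv]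
    refine ⟨?_, e2⟩
    have e4 : ((p n * √(s n))⁻¹) ^ 4 = (p n ^ 4)⁻¹ * (s n)⁻¹ * (s n)⁻¹ := by
      rw [show ((p n * √(s n))⁻¹) ^ 4 = (((p n * √(s n))⁻¹) ^ 2) ^ 2 by ring, e2, mul_pow, inv_pow,
        ← pow_mul]
      ring
    rw [e4]
    have : (s n)⁻¹ ≤ p n ^ 8 := by rw [h3]; linarith [hε0 n]
    calc (p n ^ 4)⁻¹ * (s n)⁻¹ * (s n)⁻¹ ≤ (p n ^ 4)⁻¹ * p n ^ 8 * (s n)⁻¹ := by gcongr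
      _ = p n ^ 4 * (s n)⁻¹ := by field_simp
  have hle : ∀ᶠ n in atTop, (p n * √(s n))⁻¹ ≤ √√(s n)⁻¹ := by
    filter_upwards [hr4, hkey, (hpow 4 (by norm_num)).eventually_le_const one_pos]
      with n ⟨h1, _⟩ ⟨h2, h3, _⟩ h4
    refine Real.le_sqrt_of_sq_le (Real.le_sqrt_of_sq_le ?_)
    rw [← pow_mul]
    exact h1.trans (mul_le_of_le_one_left (by positivity) h4)
  refine ⟨fun n => (p n * √(s n))⁻¹, fun n => by positivity, ?_, ?_, ?_, ?_, ?_, hle⟩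
  · filter_upwards [hkey] with n ⟨h1, h2, _⟩
    positivity
  · refine squeeze_zero' (.of_forall fun n => by positivity) hle ?_
    have h1 := (hs.inv_tendsto_atTop.sqrt).sqrt
    simpa using h1
  · refine hplim.congr' ?_
    filter_upwards [hkey] with n ⟨h1, h2, _⟩
    have := (Real.sqrt_pos.2 h1).ne'
    field_simp
  · refine squeeze_zero' (.of_forall fun n => by positivity) ?_ (hpow 2 two_ne_zero)
    filter_upwards [hr4, hkey] with n ⟨h1, _⟩ ⟨h2, h3, _⟩
    refine (sq_le_sq₀ (by positivity) (by positivity)).1 ?_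
    calc (√(s n) * (p n * √(s n))⁻¹ ^ 2) ^ 2 = s n * (p n * √(s n))⁻¹ ^ 4 := by
          rw [mul_pow, Real.sq_sqrt h2.le]; ring
      _ ≤ s n * (p n ^ 4 * (s n)⁻¹) := by gcongr
      _ = (p n ^ 2) ^ 2 := by field_simp
  · refine squeeze_zero' ?_ ?_ (hpow 6 (by norm_num))
    · filter_upwards [hkey] with n ⟨h1, _, _⟩
      have := hε0 n
      positivity
    filter_upwards [hr4, hkey] with n ⟨_, h1⟩ ⟨h2, h3, h4⟩
    rw [h1]
    have : ε n ≤ p n ^ 8 := by rw [h4]; linarith [inv_pos.2 h2]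
    calc s n * ((p n ^ 2)⁻¹ * (s n)⁻¹) * ε n ≤ s n * ((p n ^ 2)⁻¹ * (s n)⁻¹) * p n ^ 8 := by gcongr
      _ = p n ^ 6 := by field_simp

/-! ### Conditional mass of small balls around the median. -/

section SmallBallMass
variable {d : ℕ} {F : Type*} [PseudoMetricSpace F] [MeasurableSpace F]
  {κ : Kernel F (Vec d)} [IsMarkovKernel κ] {x : F} {μ : Vec d} {β : ℝ}

/-- Near `x`, the inverse second moment over shrinking balls around `μ` is uniformly small. -/
lemma exists_setLIntegral_le_rate (hs : SmoothnessAssumption κ x μ β)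
    (hm : MomentAssumption κ x μ) {h t : ℕ → ℝ} (hh : Tendsto h atTop (𝓝 0))
    (ht : Tendsto t atTop (𝓝 0)) :
    ∃ ε : ℕ → ℝ, (∀ n, 0 ≤ ε n) ∧ Tendsto ε atTop (𝓝 0) ∧ ∀ᶠ n in atTop, ∀ x', dist x x' ≤ h n →
      ∫⁻ y in {y | ‖y - μ‖ ≤ t n}, ‖y - μ‖ₑ ^ (-2 : ℝ) ∂κ x' ≤ ENNReal.ofReal (ε n) := by
  set e : ℕ → ℝ≥0∞ := fun n => ⨆ x', ⨆ _ : dist x x' ≤ h n,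
    ∫⁻ y in {y | ‖y - μ‖ ≤ t n}, ‖y - μ‖ₑ ^ (-2 : ℝ) ∂κ x' with he
  have hlim : Tendsto e atTop (𝓝 0) := by
    refine ENNReal.tendsto_nhds_zero.2 fun η hη => ?_
    obtain ⟨r, hr, hb⟩ := exists_eventually_setLIntegral_le hs hm hη
    filter_upwards [eventually_forall_dist_le hb hh, ht.eventually_le_const hr] with n h1 h2
    refine iSup₂_le fun x' hx' => (lintegral_mono_set ?_).trans (h1 x' hx')
    exact fun y hy => le_trans hy h2
  refine ⟨fun n => (e n).toReal, fun n => ENNReal.toReal_nonneg, ?_, ?_⟩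
  · exact (ENNReal.tendsto_toReal ENNReal.zero_ne_top).comp hlim
  · filter_upwards [hlim.eventually_lt_const zero_lt_one] with n hn x' hx'
    rw [ENNReal.ofReal_toReal (hn.trans ENNReal.one_lt_top).ne]
    exact le_iSup₂ (f := fun x' (_ : dist x x' ≤ h n) =>
      ∫⁻ y in {y | ‖y - μ‖ ≤ t n}, ‖y - μ‖ₑ ^ (-2 : ℝ) ∂κ x') x' hx'

/-- On the ball, 1 ≤ t² ‖y − μ‖⁻². This improves the mass t² of the plain Markov bound to t² ε,
which is what offsets s t² → ∞. -/
lemma lintegral_indicator_le (m : Measure (Vec d)) (μ : Vec d) {t ε : ℝ} (ht : 0 < t)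
    (h : ∫⁻ y in {y | ‖y - μ‖ ≤ t}, ‖y - μ‖ₑ ^ (-2 : ℝ) ∂m ≤ ENNReal.ofReal ε) :
    ∫⁻ y, ENNReal.ofReal (if ‖y - μ‖ ≤ t then 1 else 0) ∂m ≤ ENNReal.ofReal (t ^ 2 * ε) := by
  have hset : MeasurableSet {y : Vec d | ‖y - μ‖ ≤ t} :=
    measurableSet_le (by fun_prop) measurable_const
  have h1 : ∀ y : Vec d, ENNReal.ofReal (if ‖y - μ‖ ≤ t then 1 else 0)
      = {y : Vec d | ‖y - μ‖ ≤ t}.indicator (fun _ => 1) y := by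
    intro y
    by_cases hy : ‖y - μ‖ ≤ t <;> simp [hy]
  simp only [h1]
  rw [lintegral_indicator hset, ENNReal.ofReal_mul (sq_nonneg _)]
  calc ∫⁻ y in {y | ‖y - μ‖ ≤ t}, 1 ∂m
      ≤ ∫⁻ y in {y | ‖y - μ‖ ≤ t}, ENNReal.ofReal (t ^ 2) * ‖y - μ‖ₑ ^ (-2 : ℝ) ∂m := by
        refine setLIntegral_mono (by fun_prop) fun y hy => ?_
        have hy' : ‖y - μ‖ₑ ≤ ENNReal.ofReal t := by
          rw [← ofReal_norm]; exact ENNReal.ofReal_le_ofReal hy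
        rcases eq_or_ne (y - μ) 0 with h0 | h0
        · have h2 : ENNReal.ofReal (t ^ 2) ≠ 0 := by simpa using ht.ne'
          simp [h0, ENNReal.mul_top h2]
        · have h2 : ‖y - μ‖ₑ ≠ 0 := by simpa using h0
          have h3 : ‖y - μ‖ₑ ^ (-2 : ℝ) = (‖y - μ‖ₑ ^ 2)⁻¹ := by
            rw [ENNReal.rpow_neg]; norm_cast
          rw [h3, ← div_eq_mul_inv, ENNReal.le_div_iff_mul_le (.inl (by simpa using h0))
            (.inl (by simp)), one_mul, ENNReal.ofReal_pow ht.le]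
          gcongr
    _ = ENNReal.ofReal (t ^ 2) * ∫⁻ y in {y | ‖y - μ‖ ≤ t}, ‖y - μ‖ₑ ^ (-2 : ℝ) ∂m :=
        lintegral_const_mul' _ _ ENNReal.ofReal_ne_top
    _ ≤ _ := by gcongr

end SmallBallMass

/-! ### Kernel sums in probability -/

section KernelSums
variable {d : ℕ} {Ω F : Type*} [MeasurableSpace Ω] [PseudoMetricSpace F] [MeasurableSpace F]
  {P : Measure Ω} [IsProbabilityMeasure P] {X : ℕ → Ω → F} {Y : ℕ → Ω → Vec d}
  {κ : Kernel F (Vec d)} [IsMarkovKernel κ] {x : F} {μ : Vec d}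
  {K : ℝ → ℝ} {h : ℕ → ℝ} {β : ℝ}

/-- `∑ Δᵢ a(Yᵢ)`, the kernel sum of a vector-valued function of the responses. -/
noncomputable def kernelSum {E : Type*} [AddCommMonoid E] [Module ℝ E] (K : ℝ → ℝ) (x : F)
    (h : ℕ → ℝ) (X : ℕ → Ω → F) (Y : ℕ → Ω → Vec d) (f : Vec d → E) (z : ℕ × Ω) : E :=
  ∑ i ∈ Finset.range z.1, kernelWeight K x h z.1 (X i z.2) • f (Y i z.2)

lemma lintegral_enorm_sq_le {m : Measure (Vec d)} [IsProbabilityMeasure m] {f : Vec d → ℝ}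
    {C : ℝ} (hf : ∀ y, |f y| ≤ C) : ∫⁻ y, ‖f y‖ₑ ^ 2 ∂m ≤ ENNReal.ofReal C ^ 2 := by
  calc ∫⁻ y, ‖f y‖ₑ ^ 2 ∂m ≤ ∫⁻ _, ENNReal.ofReal C ^ 2 ∂m := by
        refine lintegral_mono fun y => ?_
        simp only
        gcongr
        rw [← ofReal_norm]
        exact ENNReal.ofReal_le_ofReal (hf y)
    _ = _ := by simp

lemma enorm_inv_norm_sq (y : Vec d) : ‖‖y‖⁻¹‖ₑ ^ 2 ≤ ‖y‖ₑ ^ (-2 : ℝ) := by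
  rcases eq_or_ne y 0 with rfl | hy
  · simp
  · rw [enorm_inv (norm_ne_zero_iff.2 hy), enorm_norm, ENNReal.rpow_neg, ← ENNReal.inv_pow]
    norm_cast

lemma enorm_hessKernel_sq_le (y u : Vec d) (k j : Fin d) :
    ‖hessKernel y u k j‖ₑ ^ 2 ≤ 4 * ‖y - u‖ₑ ^ (-2 : ℝ) := by
  have h1 : ‖hessKernel y u k j‖ₑ ≤ 2 * ‖‖y - u‖⁻¹‖ₑ := by
    have h2 := ENNReal.ofReal_le_ofReal (abs_hessKernel_apply_le y u k j)
    rw [ENNReal.ofReal_mul (by norm_num), ENNReal.ofReal_ofNat] at h2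
    rwa [Real.enorm_of_nonneg (inv_nonneg.2 (norm_nonneg _)), Real.enorm_eq_ofReal_abs]
  calc ‖hessKernel y u k j‖ₑ ^ 2 ≤ (2 * ‖‖y - u‖⁻¹‖ₑ) ^ 2 := by gcongr
    _ = 4 * ‖‖y - u‖⁻¹‖ₑ ^ 2 := by rw [mul_pow]; norm_num
    _ ≤ _ := by gcongr; exact enorm_inv_norm_sq _

namespace MedianSample

lemma tendsto_kernelSum (S : MedianSample P X Y κ x μ K h β) {f : Vec d → ℝ}
    (hf : Measurable f) {B : ℝ≥0∞} (hB0 : B ≠ ∞)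
    (hB : ∀ᶠ x' in 𝓝 x, ∫⁻ y, ‖f y‖ₑ ^ 2 ∂κ x' ≤ B) {a : ℝ}
    (ha : Tendsto (fun x' => ∫ y, f y ∂κ x') (𝓝 x) (𝓝 a)) :
    Tendsto (fun z => (totalMass P X (kernelWeight K x h) z.1)⁻¹ * kernelSum K x h X Y f z)
      (inProb P) (𝓝 a) := S.weighted.tendsto_mean hf hB0 hB ha

lemma tendsto_kernelSum_one (S : MedianSample P X Y κ x μ K h β) :
    Tendsto (fun z => (totalMass P X (kernelWeight K x h) z.1)⁻¹
      * kernelSum K x h X Y (fun _ => (1 : ℝ)) z) (inProb P) (𝓝 1) := by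
  have := S.weighted.tendsto_total
  simp only [kernelSum, smul_eq_mul, mul_one]
  exact this

lemma tendsto_kernelSum_sq (S : MedianSample P X Y κ x μ K h β) :
    Tendsto (fun z : ℕ × Ω => (totalMass P X (fun n x' => kernelWeight K x h n x' ^ 2) z.1)⁻¹
      * ∑ i ∈ Finset.range z.1, kernelWeight K x h z.1 (X i z.2) ^ 2) (inProb P) (𝓝 1) :=
  S.weighted_sq.tendsto_total

lemma tendsto_kernelSum_hessKernel (S : MedianSample P X Y κ x μ K h β) (k j : Fin d) :
    Tendsto (fun z => (totalMass P X (kernelWeight K x h) z.1)⁻¹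
      * kernelSum K x h X Y (fun y => hessKernel y μ k j) z) (inProb P)
      (𝓝 (∫ y, hessKernel y μ k j ∂κ x)) := by
  obtain ⟨B, hB0, hB⟩ := eventually_lintegral_enorm_rpow_le S.smooth
  refine S.tendsto_kernelSum (measurable_hessKernel_apply μ k j) (B := 4 * B)
    (ENNReal.mul_ne_top (by simp) hB0) ?_ (tendsto_integral_hessKernel S.smooth k j)
  filter_upwards [hB] with x' hx'
  calc ∫⁻ y, ‖hessKernel y μ k j‖ₑ ^ 2 ∂κ x' ≤ ∫⁻ y, 4 * ‖y - μ‖ₑ ^ (-2 : ℝ) ∂κ x' :=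
        lintegral_mono fun y => enorm_hessKernel_sq_le y μ k j
    _ = 4 * ∫⁻ y, ‖y - μ‖ₑ ^ (-2 : ℝ) ∂κ x' := lintegral_const_mul' _ _ (by simp)
    _ ≤ 4 * B := by gcongr

lemma tendsto_kernelSum_signOuter (S : MedianSample P X Y κ x μ K h β) (k j : Fin d) :
    Tendsto (fun z => (totalMass P X (kernelWeight K x h) z.1)⁻¹
      * kernelSum K x h X Y (fun y => signOuter (y - μ) k j) z) (inProb P)
      (𝓝 (condSigma (κ x) μ k j)) := by
  refine S.tendsto_kernelSum ((measurable_spatialSign_sub_apply μ k).mul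
    (measurable_spatialSign_sub_apply μ j)) (B := ENNReal.ofReal 1 ^ 2) (by simp) ?_
    (tendsto_integral_spatialSign_mul S.moment k j)
  refine .of_forall fun x' => lintegral_enorm_sq_le fun y => ?_
  simp only [Pi.mul_apply, abs_mul]
  exact mul_le_one₀ (abs_spatialSign_apply_le _ _) (abs_nonneg _) (abs_spatialSign_apply_le _ _)

/-- The kernel sum of `‖Yᵢ - μ‖⁻²` is of the order of the total mass. -/
lemma tendsto_mul_kernelSum_inv_sq (S : MedianSample P X Y κ x μ K h β) {c : ℕ → ℝ}
    (hc : ∀ n, 0 ≤ c n) (hlim : Tendsto (fun n => c n * totalMass P X (kernelWeight K x h) n)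
      atTop (𝓝 0)) :
    Tendsto (fun z => c z.1 * kernelSum K x h X Y (fun y => (‖y - μ‖ ^ 2)⁻¹) z) (inProb P)
      (𝓝 0) := by
  obtain ⟨B, hB0, hB⟩ := eventually_lintegral_enorm_rpow_le S.smooth
  refine S.weighted.tendsto_mul_sum_of_nonneg (f := fun _ y => (‖y - μ‖ ^ 2)⁻¹)
    (fun _ => by fun_prop) (fun _ _ => by positivity) hc (B := fun _ => B.toReal) ?_ ?_
  · filter_upwards [eventually_forall_dist_le hB S.lim] with n hn x' hx'
    rw [ENNReal.ofReal_toReal hB0]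
    refine le_trans (lintegral_mono fun y => ?_) (hn x' hx')
    refine le_trans (le_of_eq ?_) (enorm_inv_norm_sq _)
    rw [← inv_pow, ENNReal.ofReal_pow (by positivity), Real.enorm_of_nonneg (by positivity)]
  · have := hlim.const_mul B.toReal
    rw [mul_zero] at this
    refine this.congr fun n => ?_
    rw [totalMass]
    ring

/-- No localized response falls into a sufficiently fast shrinking ball around `μ`. -/
lemma eventually_forall_lt_norm (S : MedianSample P X Y κ x μ K h β) {t ε : ℕ → ℝ}
    (ht : ∀ᶠ n in atTop, 0 < t n)
    (hε : ∀ᶠ n in atTop, ∀ x', dist x x' ≤ h n →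
      ∫⁻ y in {y | ‖y - μ‖ ≤ t n}, ‖y - μ‖ₑ ^ (-2 : ℝ) ∂κ x' ≤ ENNReal.ofReal (ε n))
    (hε0 : ∀ n, 0 ≤ ε n)
    (hlim : Tendsto (fun n => totalMass P X (kernelWeight K x h) n * t n ^ 2 * ε n) atTop (𝓝 0)) :
    ∀ᶠ z in inProb P, ∀ i ∈ Finset.range z.1, kernelWeight K x h z.1 (X i z.2) ≠ 0 →
      t z.1 < ‖Y i z.2 - μ‖ := by
  have hset : ∀ n, MeasurableSet {y : Vec d | ‖y - μ‖ ≤ t n} := fun n =>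
    measurableSet_le (by fun_prop) measurable_const
  have h1 := S.weighted_ball.tendsto_mul_sum_of_nonneg
    (f := fun n y => if ‖y - μ‖ ≤ t n then 1 else 0) (c := fun _ => 1)
    (B := fun n => t n ^ 2 * ε n)
    (fun n => Measurable.ite (hset n) measurable_const measurable_const)
    (fun n y => by split_ifs <;> simp) (fun _ => zero_le_one)
    (by
      filter_upwards [ht, hε] with n h1 h2 x' hx'
      exact lintegral_indicator_le _ _ h1 (h2 x' hx'))
    (by
      simp only [S.integral_indicator_eq]
      have := hlim.const_mul (K 1)⁻¹
      rw [mul_zero] at this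
      refine squeeze_zero (fun n => ?_) (fun n => ?_) this
      · have := hε0 n
        have : 0 ≤ smallBall P (X 0) x (h n) := measureReal_nonneg
        positivity
      · have h2 : n * smallBall P (X 0) x (h n)
            ≤ (K 1)⁻¹ * totalMass P X (kernelWeight K x h) n := by
          rw [inv_mul_eq_div, le_div_iff₀' S.kernel.one_pos]
          exact S.smallBall_le n
        have := hε0 n
        calc 1 * (t n ^ 2 * ε n) * (n * smallBall P (X 0) x (h n))
            ≤ 1 * (t n ^ 2 * ε n) * ((K 1)⁻¹ * totalMass P X (kernelWeight K x h) n) := by gcongr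
          _ = _ := by ring)
  -- The number of offending observations is an integer tending to 0 in probability; once it is
  -- below 1 there are none.
  filter_upwards [h1.eventually_lt_const one_pos] with z hz i hi hne
  by_contra hc
  have hdist : dist x (X i z.2) ≤ h z.1 := by
    by_contra h2
    exact hne (S.kernelWeight_eq_zero _ _ (not_le.1 h2))
  refine absurd hz (not_lt.2 ?_)
  rw [one_mul]
  refine le_trans (le_of_eq ?_) (Finset.single_le_sum (f := fun i =>
    (if dist x (X i z.2) ≤ h z.1 then (1 : ℝ) else 0)
      * (if ‖Y i z.2 - μ‖ ≤ t z.1 then (1 : ℝ) else 0)) (fun i _ => ?_) hi)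
  · simp [hdist, not_lt.1 hc]
  · split_ifs <;> simp

/-- The standardized kernel sum of the spatial signs is tight. -/
lemma tight_signSum (S : MedianSample P X Y κ x μ K h β) (ε : ℝ≥0∞) (hε : 0 < ε) :
    ∃ M : ℝ, ∀ᶠ n in atTop,
      P {ω | M < ‖(√(totalMass P X (fun n x' => kernelWeight K x h n x' ^ 2) n))⁻¹ •
        kernelSum K x h X Y (fun y => spatialSign (y - μ)) (n, ω)‖} ≤ ε := by
  refine tight_of_forall_tight_apply (fun k ε hε => ?_) ε hε
  set e : Vec d := EuclideanSpace.single k 1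
  have hinner : ∀ z : Vec d, inner ℝ e z = z k := fun z => by
    simp [e, EuclideanSpace.inner_single_left]
  have hm := measurable_inner_spatialSign μ e
  obtain ⟨C, hC⟩ := S.weighted.exists_eventually_sq_le hm (B := ENNReal.ofReal ‖e‖ ^ 2)
    (by simp) (.of_forall fun x' => lintegral_enorm_sq_le fun y => abs_inner_spatialSign_le _ _)
  have := tight_mul_sum (Z := fun i ω => (X i ω, Y i ω)) S.indep S.ident
    (ξ := fun n q => kernelWeight K x h n q.1 * inner ℝ e (spatialSign (q.2 - μ)))
    (c := fun n => (√(totalMass P X (fun n x' => kernelWeight K x h n x' ^ 2) n))⁻¹)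
    (C := C * (K 1)⁻¹)
    (S.weighted.measurable_mul hm) (hC.mono fun n hn => hn.1) ?_ (S.tendsto_mean_inner e) ε hε
  · obtain ⟨M, hM⟩ := this
    refine ⟨M, hM.mono fun n hn => le_trans (le_of_eq ?_) hn⟩
    congr 1
    ext ω
    have : ((√(totalMass P X (fun n x' => kernelWeight K x h n x' ^ 2) n))⁻¹ •
        kernelSum K x h X Y (fun y => spatialSign (y - μ)) (n, ω)) k
        = (√(totalMass P X (fun n x' => kernelWeight K x h n x' ^ 2) n))⁻¹ *
          ∑ i ∈ Finset.range n, kernelWeight K x h n (X i ω)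
            * inner ℝ e (spatialSign (Y i ω - μ)) := by
      simp [kernelSum, hinner]
    rw [mem_ofPred_eq, mem_ofPred_eq, this]
  · filter_upwards [hC, S.tendsto_totalMass.eventually_gt_atTop 0] with n hn hp
    have hq := S.le_totalMass_sq n
    have hK1 := S.kernel.one_pos
    have hq0 : 0 < totalMass P X (fun n x' => kernelWeight K x h n x' ^ 2) n :=
      (mul_pos hK1 hp).trans_le hq
    set q := totalMass P X (fun n x' => kernelWeight K x h n x' ^ 2) n
    set s := totalMass P X (kernelWeight K x h) n with hs
    have hI0 : 0 ≤ ∫ ω, (kernelWeight K x h n (X 0 ω) * inner ℝ e (spatialSign (Y 0 ω - μ))) ^ 2 ∂P :=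
      integral_nonneg fun _ => sq_nonneg _
    have hCs : n * ∫ ω, (kernelWeight K x h n (X 0 ω) * inner ℝ e (spatialSign (Y 0 ω - μ))) ^ 2 ∂P
        ≤ C * s := by
      refine (mul_le_mul_of_nonneg_left hn.2 (Nat.cast_nonneg n)).trans_eq ?_
      rw [hs, totalMass]; ring
    rw [inv_pow, Real.sq_sqrt hq0.le, inv_mul_le_iff₀ hq0]
    refine hCs.trans ?_
    have hC0 : 0 ≤ C := by
      have := (mul_nonneg (Nat.cast_nonneg n) hI0).trans hCs
      exact nonneg_of_mul_nonneg_left this hp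
    calc C * s = K 1 * s * (C * (K 1)⁻¹) := by field_simp
      _ ≤ q * (C * (K 1)⁻¹) := by gcongr

end MedianSample
end KernelSums

/-! ### Localization of the estimator -/

section Localization
variable {d : ℕ} {Ω F : Type*} [PseudoMetricSpace F] {X : ℕ → Ω → F} {Y : ℕ → Ω → Vec d} {x : F}
  {K : ℝ → ℝ} {h : ℕ → ℝ}

lemma le_sum_mul_of_abs_sub_le {A B : Fin d → Fin d → ℝ} {c δ : ℝ} (hδ : 0 ≤ δ)
    (hA : ∀ v : Vec d, c * ‖v‖ ^ 2 ≤ ∑ k, ∑ j, v k * A k j * v j)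
    (hAB : ∀ k j, |B k j - A k j| ≤ δ) (v : Vec d) :
    (c - d ^ 2 * δ) * ‖v‖ ^ 2 ≤ ∑ k, ∑ j, v k * B k j * v j := by
  have h1 : ∑ k, ∑ j, (v k * A k j * v j - δ * ‖v‖ ^ 2) ≤ ∑ k, ∑ j, v k * B k j * v j := by
    refine Finset.sum_le_sum fun k _ => Finset.sum_le_sum fun j _ => ?_
    have hk : ∀ k, |v k| ≤ ‖v‖ := fun k => PiLp.norm_apply_le v k
    have h2 : |v k * (B k j - A k j) * v j| ≤ δ * ‖v‖ ^ 2 := by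
      rw [abs_mul, abs_mul]
      calc |v k| * |B k j - A k j| * |v j| ≤ ‖v‖ * δ * ‖v‖ := by gcongr <;> apply_assumption
        _ = δ * ‖v‖ ^ 2 := by ring
    have h3 := (abs_le.1 h2).1
    linarith [show v k * (B k j - A k j) * v j = v k * B k j * v j - v k * A k j * v j by ring]
  refine le_trans ?_ h1
  simp only [Finset.sum_sub_distrib, Finset.sum_const, Finset.card_univ, Fintype.card_fin,
    nsmul_eq_mul]
  have := hA v
  linarith

lemma hessEst_apply_eq (n : ℕ) (ω : Ω) (u : Vec d) (k j : Fin d) :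
    hessEst K x (h n) (fun i => X i ω) (fun i => Y i ω) n u k j
      = (kernelSum K x h X Y (fun _ => (1 : ℝ)) (n, ω))⁻¹
        * kernelSum K x h X Y (fun y => hessKernel y u k j) (n, ω) := by
  simp only [hessEst, Matrix.sum_apply, Matrix.smul_apply, smul_eq_mul, nwWeight, kernelSum,
    Finset.mul_sum, mul_one, kernelWeight]
  refine Finset.sum_congr rfl fun i _ => ?_
  rw [div_eq_inv_mul, mul_assoc]

lemma sigmaEst_apply_eq (n : ℕ) (ω : Ω) (u : Vec d) (k j : Fin d) :
    sigmaEst K x (h n) (fun i => X i ω) (fun i => Y i ω) n u k j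
      = (kernelSum K x h X Y (fun _ => (1 : ℝ)) (n, ω))⁻¹
        * kernelSum K x h X Y (fun y => signOuter (y - u) k j) (n, ω) := by
  simp only [sigmaEst, Matrix.sum_apply, Matrix.smul_apply, smul_eq_mul, nwWeight, kernelSum,
    Finset.mul_sum, mul_one, kernelWeight]
  refine Finset.sum_congr rfl fun i _ => ?_
  rw [div_eq_inv_mul, mul_assoc]

/-- Recentring at μ and rescaling by the nonnegative factor s D preserve minimizers. The scale s is
left free: localization uses the inverse total mass, linearization uses 1. -/
lemma isMinOn_sum_of_isMinOn_objectiveEst {n : ℕ} {ω : Ω} {m : Vec d} {s : ℝ} (hs : 0 ≤ s)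
    (hpos : 0 < kernelSum K x h X Y (fun _ => (1 : ℝ)) (n, ω)) (μ : Vec d)
    (hm : IsMinOn (objectiveEst K x (h n) (fun i => X i ω) (fun i => Y i ω) n) univ m) :
    IsMinOn (fun v => ∑ i ∈ Finset.range n, (s * kernelWeight K x h n (X i ω))
      * ‖(Y i ω - μ) - v‖) univ (m - μ) := by
  set D := kernelSum K x h X Y (fun _ => (1 : ℝ)) (n, ω) with hD
  have key : ∀ v, ∑ i ∈ Finset.range n, (s * kernelWeight K x h n (X i ω)) * ‖(Y i ω - μ) - v‖
      = s * D * objectiveEst K x (h n) (fun i => X i ω) (fun i => Y i ω) n (μ + v) := by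
    intro v
    rw [objectiveEst, Finset.mul_sum]
    refine Finset.sum_congr rfl fun i _ => ?_
    have e : nwWeight K x (h n) (fun i => X i ω) n i = kernelWeight K x h n (X i ω) / D := by
      simp [nwWeight, hD, kernelSum, kernelWeight]
    rw [e, sub_sub]
    field_simp
  intro v _
  simp only [mem_ofPred_eq, key]
  have h1 := hm (mem_univ (μ + v))
  simp only [mem_ofPred_eq] at h1
  rw [add_sub_cancel]
  gcongr

namespace MedianSample
variable [MeasurableSpace Ω] [MeasurableSpace F] {P : Measure Ω} [IsProbabilityMeasure P]
  {κ : Kernel F (Vec d)} [IsMarkovKernel κ] {μ : Vec d} {β : ℝ}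

/-- The estimator is within a radius `r` of `μ` that is free of localized responses. -/
lemma exists_localization (S : MedianSample P X Y κ x μ K h β) {μn : ℕ → Ω → Vec d}
    (hμn : ∀ n, ∀ᵐ ω ∂P,
      IsMinOn (objectiveEst K x (h n) (fun i => X i ω) (fun i => Y i ω) n) univ (μn n ω)) :
    ∃ r : ℕ → ℝ, (∀ n, 0 ≤ r n) ∧ Tendsto r atTop (𝓝 0) ∧
      Tendsto (fun n => √(totalMass P X (kernelWeight K x h) n) * r n ^ 2) atTop (𝓝 0) ∧
      ∀ᶠ z in inProb P, ‖μn z.1 z.2 - μ‖ < r z.1 ∧ ∀ i ∈ Finset.range z.1,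
        kernelWeight K x h z.1 (X i z.2) ≠ 0 → 2 * r z.1 < ‖Y i z.2 - μ‖ := by
  set s := totalMass P X (kernelWeight K x h) with hs
  set q := totalMass P X (fun n x' => kernelWeight K x h n x' ^ 2) with hq
  have hslim : Tendsto s atTop atTop := S.tendsto_totalMass
  -- The rate ε must be known before r is chosen, yet it concerns balls of radius 2r. It is
  -- therefore taken for the larger radius 2 s^(−1/4), and r ≤ s^(−1/4) is part of the choice of r.
  have ht : Tendsto (fun n => 2 * √√(s n)⁻¹) atTop (𝓝 0) := by
    have h1 := (hslim.inv_tendsto_atTop.sqrt).sqrt.const_mul 2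
    simpa using h1
  obtain ⟨ε, hε0, hεlim, hε⟩ := exists_setLIntegral_le_rate S.smooth S.moment S.lim ht
  obtain ⟨r, hr0, hrpos, hrlim, hrs, hsr, hsrε, hrle⟩ := exists_localization_rate hslim hε0 hεlim
  refine ⟨r, hr0, hrlim, hsr, ?_⟩
  have hfar := S.eventually_forall_lt_norm (t := fun n => 2 * r n) (ε := ε)
    (hrpos.mono fun n hn => by positivity) (by
      filter_upwards [hε, hrle] with n h1 h2 x' hx'
      refine le_trans (lintegral_mono_set fun y hy => ?_) (h1 x' hx')
      exact (show ‖y - μ‖ ≤ 2 * r n from hy).trans (by linarith)) hε0 (by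
      have := hsrε.const_mul 4
      rw [mul_zero] at this
      refine this.congr fun n => by ring)
  obtain ⟨c, hc, hH⟩ := exists_pos_le_hess (m := κ x) S.two_le S.lintegral_ne_top S.nondeg
  have hd0 : (0 : ℝ) < d := by
    have := S.two_le
    exact_mod_cast (by omega : 0 < d)
  -- Entrywise errors δ in d² entries cost at most d² δ = c/2 in the quadratic form, so the
  -- empirical Hessian keeps the constant c/2.
  set δ : ℝ := c / (2 * d ^ 2) with hδ
  have hδ0 : 0 < δ := by positivity
  have hHn : ∀ᶠ z in inProb P, ∀ k j, |(s z.1)⁻¹ * kernelSum K x h X Y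
      (fun y => hessKernel y μ k j) z - ∫ y, hessKernel y μ k j ∂κ x| ≤ δ := by
    refine eventually_all.2 fun k => eventually_all.2 fun j => ?_
    exact (Metric.tendsto_nhds.1 (S.tendsto_kernelSum_hessKernel k j) δ hδ0).mono
      fun z hz => hz.le
  -- The sign sum is of order √q = O(√s), so divided by s r it is of order 1/(r√s), which tends to
  -- 0.
  have hsign : Tendsto (fun z : ℕ × Ω => (r z.1)⁻¹ * ‖(s z.1)⁻¹ •
      kernelSum K x h X Y (fun y => spatialSign (y - μ)) z‖) (inProb P) (𝓝 0) := by
    obtain ⟨C, hC0, hC⟩ := S.exists_totalMass_sq_le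
    have hcoef : Tendsto (fun n => (r n)⁻¹ * (s n)⁻¹ * √(q n)) atTop (𝓝 0) := by
      have := hrs.const_mul √C
      rw [mul_zero] at this
      refine squeeze_zero' (.of_forall fun n => ?_) ?_ this
      · have := hr0 n
        have : 0 ≤ s n := S.totalMass_nonneg n
        positivity
      · filter_upwards [hslim.eventually_gt_atTop 0, hrpos] with n h1 h2
        calc (r n)⁻¹ * (s n)⁻¹ * √(q n) ≤ (r n)⁻¹ * (s n)⁻¹ * √(C * s n) := by gcongr; exact hC n
          _ = √C * (r n * √(s n))⁻¹ := by
            rw [Real.sqrt_mul hC0.le]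
            have h3 := Real.mul_self_sqrt h1.le
            have h4 := Real.sqrt_pos.2 h1
            field_simp
            linarith [sq (√(s n))]
    have h1 : Tendsto (fun z : ℕ × Ω => ((r z.1)⁻¹ * (s z.1)⁻¹ * √(q z.1)) • ((√(q z.1))⁻¹ •
        kernelSum K x h X Y (fun y => spatialSign (y - μ)) z)) (inProb P) (𝓝 0) :=
      tendsto_inProb_smul_of_tight hcoef.inProb S.tight_signSum
    replace h1 := h1.norm
    rw [norm_zero] at h1
    refine h1.congr' ?_
    filter_upwards [(hslim.eventually_gt_atTop 0).inProb, hrpos.inProb,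
      (S.tendsto_totalMass_sq.eventually_gt_atTop 0).inProb] with z h2 h3 h4
    have h5 : 0 < √(q z.1) := Real.sqrt_pos.2 h4
    rw [smul_smul, norm_smul, norm_smul, Real.norm_of_nonneg (by positivity),
      Real.norm_of_nonneg (by positivity)]
    field_simp
  have hinv : Tendsto (fun z : ℕ × Ω => r z.1 * (s z.1)⁻¹ *
      kernelSum K x h X Y (fun y => (‖y - μ‖ ^ 2)⁻¹) z) (inProb P) (𝓝 0) := by
    refine S.tendsto_mul_kernelSum_inv_sq (c := fun n => r n * (s n)⁻¹)
      (fun n => mul_nonneg (hr0 n) (inv_nonneg.2 (S.totalMass_nonneg n))) (hrlim.congr' ?_)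
    filter_upwards [hslim.eventually_gt_atTop 0] with n hn
    rw [← hs, inv_mul_cancel_right₀ hn.ne']
  -- The thresholds c/16 bound the linear and cubic contributions by rc/16 and rc/32, together below
  -- the rc/4 required with l = c/2.
  filter_upwards [hfar, hHn, hsign.eventually_lt_const (u := c / 16) (by positivity),
    hinv.eventually_lt_const (u := c / 16) (by positivity), eventually_inProb_of_ae hμn,
    (hslim.eventually_gt_atTop 0).inProb, hrpos.inProb,
    S.tendsto_kernelSum_one.eventually_const_lt (u := 0) one_pos]
    with z hz1 hz2 hz3 hz4 hz5 hz6 hz7 hz8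
  refine ⟨?_, hz1⟩
  have hD := pos_of_mul_pos_right hz8 (inv_pos.2 hz6).le
  have hmin := isMinOn_sum_of_isMinOn_objectiveEst (inv_nonneg.2 hz6.le) hD μ hz5
  refine norm_lt_of_isMinOn_of_quadratic (l := c / 2)
    (a := fun i => (s z.1)⁻¹ * kernelWeight K x h z.1 (X i z.2))
    (fun i => mul_nonneg (inv_nonneg.2 hz6.le) (S.kernel.nonneg _)) hz7 (fun v => ?_) ?_ hmin
  · have h1 := le_sum_mul_of_abs_sub_le hδ0.le hH hz2 v
    have h2 : c - d ^ 2 * δ = c / 2 := by rw [hδ]; field_simp; ring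
    rw [h2] at h1
    refine h1.trans_eq ?_
    simp only [← sum_mul_hessKernel, kernelSum, smul_eq_mul, Finset.mul_sum, Finset.sum_mul]
    symm
    rw [Finset.sum_comm]
    refine Finset.sum_congr rfl fun k _ => ?_
    rw [Finset.sum_comm]
    refine Finset.sum_congr rfl fun j _ => Finset.sum_congr rfl fun i _ => ?_
    ring
  · have e1 : ∑ i ∈ Finset.range z.1, ((s z.1)⁻¹ * kernelWeight K x h z.1 (X i z.2)) •
        spatialSign (Y i z.2 - μ)
        = (s z.1)⁻¹ • kernelSum K x h X Y (fun y => spatialSign (y - μ)) z := by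
      simp only [kernelSum, Finset.smul_sum, smul_smul]
    have e2 : ∑ i ∈ Finset.range z.1, ((s z.1)⁻¹ * kernelWeight K x h z.1 (X i z.2)) *
        (‖Y i z.2 - μ‖ ^ 2)⁻¹
        = (s z.1)⁻¹ * kernelSum K x h X Y (fun y => (‖y - μ‖ ^ 2)⁻¹) z := by
      simp only [kernelSum, Finset.mul_sum, smul_eq_mul, mul_assoc]
    rw [e1, e2]
    rw [inv_mul_lt_iff₀ hz7] at hz3
    have h5 : r z.1 ^ 2 / 2 * ((s z.1)⁻¹ * kernelSum K x h X Y (fun y => (‖y - μ‖ ^ 2)⁻¹) z)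
        ≤ r z.1 / 2 * (c / 16) := by
      calc _ = r z.1 / 2 * (r z.1 * (s z.1)⁻¹ *
            kernelSum K x h X Y (fun y => (‖y - μ‖ ^ 2)⁻¹) z) := by ring
        _ ≤ _ := by gcongr
    have : 0 < r z.1 * c := mul_pos hz7 hc
    linarith

end MedianSample
end Localization

/-! ### Asymptotic normality -/

section Normality
variable {d : ℕ}

/-- Whitening with the inverse square root of `Σ`. -/
lemma integral_inner_whiten_sq {m : Measure (Vec d)} [IsFiniteMeasure m] {μ : Vec d}
    (hpd : (condSigma m μ).PosDef) (t : Vec d) :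
    ∫ y, inner ℝ (Matrix.toEuclideanCLM (𝕜 := ℝ) (CFC.sqrt (condSigma m μ))⁻¹ t)
      (spatialSign (y - μ)) ^ 2 ∂m = ‖t‖ ^ 2 := by
  set A := condSigma m μ
  set R := CFC.sqrt A
  have hR : R * R = A := CFC.sqrt_mul_sqrt_self A hpd.posSemidef.nonneg
  have hdet : IsUnit R.det := isUnit_iff_ne_zero.2 hpd.det_sqrt_ne_zero
  have hRs : star R = R := (CFC.sqrt_nonneg A).isSelfAdjoint
  have hRB : R * R⁻¹ = 1 := Matrix.mul_nonsing_inv _ hdet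
  set v := Matrix.toEuclideanCLM (𝕜 := ℝ) R⁻¹ t with hv
  have hRv : Matrix.toEuclideanCLM (𝕜 := ℝ) R v = t := by
    rw [hv, ← mul_apply_eq_comp, ← map_mul, hRB, map_one]
    rfl
  have h1 := sum_mul_condSigma m μ v v
  simp only [← sq] at h1
  rw [← h1]
  have h2 : inner ℝ v (Matrix.toEuclideanCLM (𝕜 := ℝ) A v) = ‖t‖ ^ 2 := by
    have h3 := inner_toEuclideanCLM_transpose_mul R v
    have h4 : R.transpose = star R := by
      rw [Matrix.star_eq_conjTranspose, Matrix.conjTranspose_eq_transpose_of_trivial]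
    rw [h4, hRs, hR, hRv] at h3
    exact h3
  rw [← h2, inner_eq_sum_mul]
  refine Finset.sum_congr rfl fun k _ => ?_
  rw [toEuclideanCLM_apply_apply A v k, Finset.mul_sum]
  exact Finset.sum_congr rfl fun j _ => mul_assoc _ _ _

lemma inner_inv_sqrt_comm (A : Matrix (Fin d) (Fin d) ℝ) (v t : Vec d) :
    inner ℝ (Matrix.toEuclideanCLM (𝕜 := ℝ) (CFC.sqrt A)⁻¹ v) t
      = inner ℝ (Matrix.toEuclideanCLM (𝕜 := ℝ) (CFC.sqrt A)⁻¹ t) v := by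
  have hs : star (CFC.sqrt A)⁻¹ = (CFC.sqrt A)⁻¹ := by
    have h1 : star (CFC.sqrt A) = CFC.sqrt A := (CFC.sqrt_nonneg A).isSelfAdjoint
    rw [Matrix.star_eq_conjTranspose] at h1 ⊢
    rw [Matrix.conjTranspose_nonsing_inv, h1]
  rw [← ContinuousLinearMap.adjoint_inner_right, ← ContinuousLinearMap.star_eq_adjoint, ← map_star,
    hs, real_inner_comm]

lemma tendsto_toEuclideanCLM {ι : Type*} {l : Filter ι} {A : ι → Matrix (Fin d) (Fin d) ℝ}
    {B : Matrix (Fin d) (Fin d) ℝ} (h : Tendsto A l (𝓝 B)) :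
    Tendsto (fun i => Matrix.toEuclideanCLM (𝕜 := ℝ) (A i)) l
      (𝓝 (Matrix.toEuclideanCLM (𝕜 := ℝ) B)) :=
  (LinearMap.continuous_of_finiteDimensional
    (Matrix.toEuclideanCLM (𝕜 := ℝ) (n := Fin d)).toAlgEquiv.toLinearMap).tendsto B |>.comp h

variable {Ω F : Type*} [MeasurableSpace Ω] [PseudoMetricSpace F] [MeasurableSpace F]
  {P : Measure Ω} [IsProbabilityMeasure P] {X : ℕ → Ω → F} {Y : ℕ → Ω → Vec d}
  {κ : Kernel F (Vec d)} [IsMarkovKernel κ] {x : F} {μ : Vec d}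
  {K : ℝ → ℝ} {h : ℕ → ℝ} {β : ℝ}

/-- The standardized kernel sum of the spatial signs. -/
noncomputable def signSum (P : Measure Ω) (K : ℝ → ℝ) (x : F) (h : ℕ → ℝ) (X : ℕ → Ω → F)
    (Y : ℕ → Ω → Vec d) (μ : Vec d) (z : ℕ × Ω) : Vec d :=
  (√(totalMass P X (fun n x' => kernelWeight K x h n x' ^ 2) z.1))⁻¹ •
    kernelSum K x h X Y (fun y => spatialSign (y - μ)) z

namespace MedianSample

/-- Central limit theorem for the standardized kernel sum of the spatial signs. -/
theorem tendstoInDistribution_signSum (S : MedianSample P X Y κ x μ K h β) :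
    TendstoInDistribution (fun n ω => Matrix.toEuclideanCLM (𝕜 := ℝ)
      (CFC.sqrt (condSigma (κ x) μ))⁻¹ (signSum P K x h X Y μ (n, ω))) atTop id (fun _ => P)
      (stdGaussian (Vec d)) := by
  set T := Matrix.toEuclideanCLM (𝕜 := ℝ) (CFC.sqrt (condSigma (κ x) μ))⁻¹ with hT
  set q := totalMass P X (fun n x' => kernelWeight K x h n x' ^ 2) with hq
  have hqlim : Tendsto q atTop atTop := S.tendsto_totalMass_sq
  set ξ : ℕ → F × Vec d → Vec d := fun n p =>
    ((√(q n))⁻¹ * kernelWeight K x h n p.1) • T (spatialSign (p.2 - μ)) with hξ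
  have hinner : ∀ n p t, inner ℝ (ξ n p) t
      = (√(q n))⁻¹ * (kernelWeight K x h n p.1 * inner ℝ (T t) (spatialSign (p.2 - μ))) := by
    intro n p t
    rw [hξ]
    simp only
    rw [real_inner_smul_left, inner_inv_sqrt_comm, mul_assoc]
  obtain ⟨C, hC0, hC⟩ := S.kernel.exists_pos_bound
  have key := tendstoInDistribution_sum_array (Z := fun i ω => (X i ω, Y i ω)) S.indep S.ident
    (ξ := ξ) (b := fun n => (√(q n))⁻¹ * (C * ‖T‖)) (fun n => ?_) ?_ ?_ (fun t => ?_) fun t => ?_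
  · convert key using 3 with n ω
    simp only [signSum, kernelSum, map_smul, map_sum, Finset.smul_sum, hξ, smul_smul]
    rfl
  · exact (((S.measurable_kernelWeight n).comp _root_.measurable_fst).const_mul _).smul
      (T.continuous.measurable.comp ((measurable_spatialSign_sub μ).comp _root_.measurable_snd))
  · have := (Real.tendsto_sqrt_atTop.comp hqlim).inv_tendsto_atTop.mul_const (C * ‖T‖)
    rwa [zero_mul] at this
  · refine .of_forall fun n p => ?_
    rw [hξ]
    simp only
    have hw : 0 ≤ kernelWeight K x h n p.1 := S.kernel.nonneg _
    rw [norm_smul, Real.norm_of_nonneg (by positivity), mul_assoc]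
    have h1 : ‖T (spatialSign (p.2 - μ))‖ ≤ ‖T‖ :=
      (T.le_opNorm _).trans (mul_le_of_le_one_right (norm_nonneg _) (norm_spatialSign_le _))
    have h2 : kernelWeight K x h n p.1 ≤ C := hC _
    gcongr
  · simp only [hinner, integral_const_mul]
    refine (S.tendsto_mean_inner (T t)).congr fun n => by rw [← hq]; ring
  -- Squaring the summands turns the weights into Δ², so the second moment is a localized mean for
  -- the weights Δ² and tends to the conditional one at x, which the whitening makes equal to ‖t‖².
  · have h1 := S.weighted_sq.tendsto_integral (f := fun y => inner ℝ (T t) (spatialSign (y - μ)) ^ 2)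
      ((measurable_inner_spatialSign μ (T t)).pow_const 2) (.of_forall fun n => ?_)
      (tendsto_integral_inner_spatialSign_sq S.moment (T t))
    · rw [integral_inner_whiten_sq (posDef_condSigma S.nondeg)] at h1
      refine h1.congr' ?_
      filter_upwards [hqlim.eventually_gt_atTop 0] with n hn
      simp only [hinner, mul_pow, integral_const_mul, inv_pow, Real.sq_sqrt hn.le]
      rw [hq, totalMass]
      ring
    · refine (S.kernelWeight_sq_integrable n).mul_bdd (c := ‖T t‖ ^ 2)
        (((measurable_inner_spatialSign μ (T t)).pow_const 2).comp
          (S.measurable_snd 0)).aestronglyMeasurable (.of_forall fun ω => ?_)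
      rw [norm_pow]
      exact pow_le_pow_left₀ (norm_nonneg _) (abs_inner_spatialSign_le _ _) 2

/-- Consistency of the plug-in covariance estimator. -/
lemma tendsto_sigmaEst (S : MedianSample P X Y κ x μ K h β) {μn : ℕ → Ω → Vec d} {r : ℕ → ℝ}
    (hr : Tendsto r atTop (𝓝 0)) (hr0 : ∀ n, 0 ≤ r n)
    (hloc : ∀ᶠ z in inProb P, ‖μn z.1 z.2 - μ‖ < r z.1 ∧ ∀ i ∈ Finset.range z.1,
        kernelWeight K x h z.1 (X i z.2) ≠ 0 → 2 * r z.1 < ‖Y i z.2 - μ‖) :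
    Tendsto (fun z : ℕ × Ω => sigmaEst K x (h z.1) (fun i => X i z.2) (fun i => Y i z.2) z.1
      (μn z.1 z.2)) (inProb P) (𝓝 (condSigma (κ x) μ)) := by
  refine tendsto_pi_nhds.2 fun k => tendsto_pi_nhds.2 fun j => ?_
  set s := totalMass P X (kernelWeight K x h) with hs
  have hslim : Tendsto s atTop atTop := S.tendsto_totalMass
  have hD := S.tendsto_kernelSum_one
  rw [← hs] at hD
  have hL : Tendsto (fun z : ℕ × Ω => 4 * r z.1 * (s z.1)⁻¹ *
      kernelSum K x h X Y (fun y => (‖y - μ‖ ^ 2)⁻¹) z) (inProb P) (𝓝 0) := by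
    refine S.tendsto_mul_kernelSum_inv_sq (c := fun n => 4 * r n * (s n)⁻¹)
      (fun n => mul_nonneg (mul_nonneg (by norm_num) (hr0 n))
        (inv_nonneg.2 (S.totalMass_nonneg n))) ?_
    have := hr.const_mul 4
    rw [mul_zero] at this
    refine this.congr' ?_
    filter_upwards [hslim.eventually_gt_atTop 0] with n hn
    rw [← hs, inv_mul_cancel_right₀ hn.ne']
  -- Moving the centre from μ to μ_n changes each term by at most 4r(1 + ‖Y_i − μ‖⁻²). Both
  -- resulting kernel sums are O(s) in probability, so the factor r → 0 wins.
  have hdiff : Tendsto (fun z : ℕ × Ω => (s z.1)⁻¹ *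
        kernelSum K x h X Y (fun y => signOuter (y - μn z.1 z.2) k j) z
      - (s z.1)⁻¹ * kernelSum K x h X Y (fun y => signOuter (y - μ) k j) z) (inProb P) (𝓝 0) := by
    have h1 := ((hr.inProb (P := P)).const_mul 4).mul hD
    have h2 := h1.add hL
    rw [mul_zero, zero_mul, add_zero] at h2
    refine squeeze_zero_norm' ?_ h2
    filter_upwards [hloc, (hslim.eventually_gt_atTop 0).inProb] with z hz hsz
    rw [← mul_sub, norm_mul, Real.norm_of_nonneg (inv_nonneg.2 hsz.le)]
    have h3 : ‖kernelSum K x h X Y (fun y => signOuter (y - μn z.1 z.2) k j) z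
        - kernelSum K x h X Y (fun y => signOuter (y - μ) k j) z‖
        ≤ 4 * r z.1 * kernelSum K x h X Y (fun _ => (1 : ℝ)) z
          + 4 * r z.1 * kernelSum K x h X Y (fun y => (‖y - μ‖ ^ 2)⁻¹) z := by
      simp only [kernelSum, ← Finset.sum_sub_distrib, Finset.mul_sum, ← Finset.sum_add_distrib]
      refine norm_sum_le_of_le _ fun i hi => ?_
      rcases eq_or_ne (kernelWeight K x h z.1 (X i z.2)) 0 with h0 | h0
      · simp [h0]
      · have hz0 : Y i z.2 - μ ≠ 0 := by
          have := (mul_nonneg zero_le_two (hr0 z.1)).trans_lt (hz.2 i hi h0)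
          exact norm_pos_iff.1 this
        have h4 := abs_signOuter_sub_le (w := μn z.1 z.2 - μ) hz0 k j
        rw [sub_sub_sub_cancel_right] at h4
        have hw : 0 ≤ kernelWeight K x h z.1 (X i z.2) := S.kernel.nonneg _
        rw [← smul_sub, norm_smul, Real.norm_of_nonneg hw, Real.norm_eq_abs]
        calc _ ≤ kernelWeight K x h z.1 (X i z.2)
              * (4 * r z.1 * (1 + (‖Y i z.2 - μ‖ ^ 2)⁻¹)) := by
              gcongr
              refine h4.trans ?_
              gcongr
              exact hz.1.le
          _ = _ := by simp only [smul_eq_mul]; ring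
    calc _ ≤ (s z.1)⁻¹ * (4 * r z.1 * kernelSum K x h X Y (fun _ => (1 : ℝ)) z
          + 4 * r z.1 * kernelSum K x h X Y (fun y => (‖y - μ‖ ^ 2)⁻¹) z) := by gcongr
      _ = _ := by ring
  have hnum := hdiff.add (S.tendsto_kernelSum_signOuter k j)
  rw [zero_add] at hnum
  have h5 := (hD.inv₀ one_ne_zero).mul hnum
  rw [inv_one, one_mul] at h5
  refine h5.congr' ?_
  filter_upwards [(hslim.eventually_gt_atTop 0).inProb] with z hz
  rw [sigmaEst_apply_eq, ← hs, sub_add_cancel, mul_inv, inv_inv]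
  field_simp

end MedianSample
end Normality

/-! ### The plug-in statistic -/

section Plugin
variable {d : ℕ} {Ω F : Type*} [PseudoMetricSpace F] {X : ℕ → Ω → F} {Y : ℕ → Ω → Vec d} {x : F}
  {K : ℝ → ℝ} {h : ℕ → ℝ}

lemma kernelSum_smul_hessEst {n : ℕ} {ω : Ω} {m w : Vec d}
    (hpos : 0 < kernelSum K x h X Y (fun _ => (1 : ℝ)) (n, ω)) :
    kernelSum K x h X Y (fun _ => (1 : ℝ)) (n, ω) • Matrix.toEuclideanCLM (𝕜 := ℝ)
        (hessEst K x (h n) (fun i => X i ω) (fun i => Y i ω) n m) w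
      = ∑ i ∈ Finset.range n, kernelWeight K x h n (X i ω) • (‖Y i ω - m‖⁻¹ •
          (w - inner ℝ w (spatialSign (Y i ω - m)) • spatialSign (Y i ω - m))) := by
  set D := kernelSum K x h X Y (fun _ => (1 : ℝ)) (n, ω) with hD
  simp only [hessEst, map_sum, map_smul, sum_apply, smul_apply, Finset.smul_sum,
    toEuclideanCLM_hessKernel]
  refine Finset.sum_congr rfl fun i _ => ?_
  have e : nwWeight K x (h n) (fun i => X i ω) n i = kernelWeight K x h n (X i ω) / D := by
    simp [nwWeight, hD, kernelSum, kernelWeight]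
  rw [e, smul_smul, mul_div_cancel₀ _ hpos.ne']

variable [MeasurableSpace Ω] {P : Measure Ω} {μ : Vec d}

lemma aemeasurable_vec {f : Ω → Vec d} (hf : ∀ k, AEMeasurable (fun ω => f ω k) P) :
    AEMeasurable f P :=
  (PiLp.continuous_toLp 2 fun _ : Fin d => ℝ).measurable.comp_aemeasurable
    (aemeasurable_pi_lambda (fun ω k => f ω k) hf)

namespace MedianSample
variable [MeasurableSpace F] {κ : Kernel F (Vec d)} {β : ℝ}

lemma aemeasurable_kernelSum (S : MedianSample P X Y κ x μ K h β) (n : ℕ) {m : Ω → Vec d}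
    (hm : AEMeasurable m P) {f : Vec d → Vec d → ℝ} (hf : Measurable fun p : Vec d × Vec d =>
      f p.1 p.2) :
    AEMeasurable (fun ω => kernelSum K x h X Y (fun y => f y (m ω)) (n, ω)) P := by
  simp only [kernelSum]
  refine Finset.aemeasurable_fun_sum _ fun i _ => ?_
  exact (((S.measurable_kernelWeight n).comp (S.measurable_fst i)).aemeasurable).smul
    (hf.comp_aemeasurable ((S.measurable_snd i).aemeasurable.prodMk hm))

/-- The exact normalization replaces the integrals against τ_n by finite sums of kernel values, so
measurability is read off entrywise. -/
lemma aemeasurable_pluginStat [IsProbabilityMeasure P] (S : MedianSample P X Y κ x μ K h β)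
    (n : ℕ) {m : Ω → Vec d} (hm : AEMeasurable m P) :
    AEMeasurable (fun ω => pluginStat K x (h n) (fun i => X i ω) (fun i => Y i ω) n μ (m ω)) P := by
  have hD := S.aemeasurable_kernelSum n hm (f := fun _ _ => (1 : ℝ)) measurable_const
  have hsign : ∀ k, Measurable fun p : Vec d × Vec d => spatialSign (p.1 - p.2) k := fun k =>
    (EuclideanSpace.proj (𝕜 := ℝ) k).continuous.measurable.comp
      (measurable_spatialSign.comp (_root_.measurable_fst.sub _root_.measurable_snd))
  have hA : ∀ k j, AEMeasurable (fun ω =>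
      sigmaEst K x (h n) (fun i => X i ω) (fun i => Y i ω) n (m ω) k j) P := fun k j => by
    simp only [sigmaEst_apply_eq]
    exact hD.inv.mul (S.aemeasurable_kernelSum n hm (f := fun y u => signOuter (y - u) k j)
      ((hsign k).mul (hsign j)))
  have hH : ∀ k j, AEMeasurable (fun ω =>
      hessEst K x (h n) (fun i => X i ω) (fun i => Y i ω) n (m ω) k j) P := fun k j => by
    simp only [hessEst_apply_eq]
    refine hD.inv.mul (S.aemeasurable_kernelSum n hm (f := fun y u => hessKernel y u k j) ?_)
    simp only [hessKernel_apply]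
    exact (_root_.measurable_fst.sub _root_.measurable_snd).norm.inv.mul
      (measurable_const.sub ((hsign k).mul (hsign j)))
  have hB := aemeasurable_inv_sqrt_apply (fun ω =>
    posSemidef_sigmaEst S.kernel x (h n) (fun i => X i ω) (fun i => Y i ω) n (m ω)) hA
  have hS2 : Measurable fun ω => ∑ i ∈ Finset.range n, K (dist x (X i ω) / h n) ^ 2 :=
    Finset.measurable_fun_sum _ fun i _ =>
      ((S.measurable_kernelWeight n).comp (S.measurable_fst i)).pow_const 2
  have hS1 : Measurable fun ω => ∑ i ∈ Finset.range n, K (dist x (X i ω) / h n) :=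
    Finset.measurable_fun_sum _ fun i _ =>
      (S.measurable_kernelWeight n).comp (S.measurable_fst i)
  refine aemeasurable_vec fun k => ?_
  simp only [pluginStat, kernelConstEst_normalization S.kernel x (S.pos n), PiLp.smul_apply,
    smul_eq_mul, toEuclideanCLM_apply_apply, Matrix.mul_apply]
  refine (hS1.div hS2.sqrt).aemeasurable.mul (Finset.aemeasurable_fun_sum _ fun j _ => ?_)
  refine (Finset.aemeasurable_fun_sum _ fun i _ => (hB k i).mul (hH i j)).mul ?_
  exact (EuclideanSpace.proj (𝕜 := ℝ) j).continuous.measurable.comp_aemeasurable (hm.sub_const μ)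

variable [IsProbabilityMeasure P] [IsMarkovKernel κ]

/-- The statistic is a random operator A → T applied to the sign sum W plus a remainder R → 0, so
the difference from T W is (A − T) W + A R. Tightness of W kills the first term and boundedness of A
the second. -/
lemma tendsto_pluginStat_sub (S : MedianSample P X Y κ x μ K h β) {μn : ℕ → Ω → Vec d}
    (hμn : ∀ n, ∀ᵐ ω ∂P,
      IsMinOn (objectiveEst K x (h n) (fun i => X i ω) (fun i => Y i ω) n) univ (μn n ω)) :
    Tendsto (fun z : ℕ × Ω => pluginStat K x (h z.1) (fun i => X i z.2) (fun i => Y i z.2) z.1 μ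
        (μn z.1 z.2) - Matrix.toEuclideanCLM (𝕜 := ℝ) (CFC.sqrt (condSigma (κ x) μ))⁻¹
          (signSum P K x h X Y μ z)) (inProb P) (𝓝 0) := by
  obtain ⟨r, hr0, hrlim, hsr, hloc⟩ := S.exists_localization hμn
  have hpd := posDef_condSigma S.nondeg
  have hsig := S.tendsto_sigmaEst hrlim hr0 hloc
  have hB := tendsto_inv_sqrt (fun z : ℕ × Ω => posSemidef_sigmaEst S.kernel x (h z.1)
    (fun i => X i z.2) (fun i => Y i z.2) z.1 (μn z.1 z.2)) hpd hsig
  set s := totalMass P X (kernelWeight K x h) with hs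
  set q := totalMass P X (fun n x' => kernelWeight K x h n x' ^ 2) with hq
  have hslim : Tendsto s atTop atTop := S.tendsto_totalMass
  have hqlim : Tendsto q atTop atTop := S.tendsto_totalMass_sq
  set S2 : ℕ × Ω → ℝ := fun z => ∑ i ∈ Finset.range z.1, kernelWeight K x h z.1 (X i z.2) ^ 2
    with hS2
  have hS2lim : Tendsto (fun z => (q z.1)⁻¹ * S2 z) (inProb P) (𝓝 1) := S.tendsto_kernelSum_sq
  set T := Matrix.toEuclideanCLM (𝕜 := ℝ) (CFC.sqrt (condSigma (κ x) μ))⁻¹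
  -- The random normalization D/√(∑ Δ_i²) is traded for the deterministic √q; the correction √(q / ∑
  -- Δ_i²) → 1 is absorbed into this operator.
  set A : ℕ × Ω → Vec d →L[ℝ] Vec d := fun z => (√((q z.1)⁻¹ * S2 z))⁻¹ •
    Matrix.toEuclideanCLM (𝕜 := ℝ) (CFC.sqrt (sigmaEst K x (h z.1) (fun i => X i z.2)
      (fun i => Y i z.2) z.1 (μn z.1 z.2)))⁻¹ with hA
  have hAlim : Tendsto A (inProb P) (𝓝 T) := by
    have h1 := hS2lim.sqrt.inv₀ (by simp)
    have h2 := h1.smul (tendsto_toEuclideanCLM hB)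
    simpa using h2
  set D : ℕ × Ω → ℝ := kernelSum K x h X Y (fun _ => (1 : ℝ)) with hD
  set G : ℕ × Ω → Vec d := fun z => D z • Matrix.toEuclideanCLM (𝕜 := ℝ)
    (hessEst K x (h z.1) (fun i => X i z.2) (fun i => Y i z.2) z.1 (μn z.1 z.2))
      (μn z.1 z.2 - μ) with hG
  set R : ℕ × Ω → Vec d := fun z => (√(q z.1))⁻¹ • G z - signSum P K x h X Y μ z with hR
  have hDpos : ∀ᶠ z in inProb P, 0 < D z := by
    filter_upwards [S.tendsto_kernelSum_one.eventually_const_lt (u := 0) one_pos,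
      (hslim.eventually_gt_atTop 0).inProb] with z h1 h2
    exact pos_of_mul_pos_right h1 (inv_pos.2 h2).le
  have hRlim : Tendsto R (inProb P) (𝓝 0) := by
    -- The linearization error is r² times a kernel sum of order s, divided by √q of order at least
    -- √s: altogether √s r² → 0.
    have hL : Tendsto (fun z : ℕ × Ω => (√(q z.1))⁻¹ * (10 * r z.1 ^ 2) *
        kernelSum K x h X Y (fun y => (‖y - μ‖ ^ 2)⁻¹) z) (inProb P) (𝓝 0) := by
      refine S.tendsto_mul_kernelSum_inv_sq (c := fun n => (√(q n))⁻¹ * (10 * r n ^ 2))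
        (fun n => by positivity) ?_
      have h1 := hsr.const_mul (10 * (√(K 1))⁻¹)
      rw [mul_zero] at h1
      have hs0 : ∀ n, 0 ≤ s n := S.totalMass_nonneg
      refine squeeze_zero' (.of_forall fun n => mul_nonneg (by positivity) (hs0 n)) ?_ h1
      filter_upwards [hslim.eventually_gt_atTop 0] with n hn
      have hK1 := S.kernel.one_pos
      have hqs : (√(q n))⁻¹ ≤ (√(K 1))⁻¹ * (√(s n))⁻¹ := by
        rw [← mul_inv, ← Real.sqrt_mul hK1.le]
        exact inv_anti₀ (Real.sqrt_pos.2 (by positivity)) (Real.sqrt_le_sqrt (S.le_totalMass_sq n))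
      calc (√(q n))⁻¹ * (10 * r n ^ 2) * s n
          ≤ (√(K 1))⁻¹ * (√(s n))⁻¹ * (10 * r n ^ 2) * s n := by gcongr
        _ = 10 * (√(K 1))⁻¹ * (((√(s n))⁻¹ * s n) * r n ^ 2) := by ring
        _ = _ := by
          have : (√(s n))⁻¹ * s n = √(s n) := by
            rw [inv_mul_eq_iff_eq_mul₀ (Real.sqrt_pos.2 hn).ne', Real.mul_self_sqrt hn.le]
          rw [this]
    refine squeeze_zero_norm' ?_ hL
    filter_upwards [hloc, hDpos, eventually_inProb_of_ae hμn] with z hz hDz hmin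
    have hmin' := isMinOn_sum_of_isMinOn_objectiveEst zero_le_one hDz μ hmin
    simp only [one_mul] at hmin'
    have ha : ∀ i, 0 ≤ kernelWeight K x h z.1 (X i z.2) := fun i => S.kernel.nonneg _
    have hfar : ∀ i ∈ Finset.range z.1, kernelWeight K x h z.1 (X i z.2) ≠ 0 →
        2 * ‖μn z.1 z.2 - μ‖ < ‖Y i z.2 - μ‖ := fun i hi h0 =>
      lt_of_le_of_lt (by linarith [hz.1]) (hz.2 i hi h0)
    have hfoc := sum_spatialSign_eq_zero ha (fun i hi h0 heq => by
      have := hfar i hi h0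
      rw [heq] at this
      linarith [norm_nonneg (μn z.1 z.2 - μ)]) hmin'
    have hlin := norm_sum_hess_sub_le ha hfar hfoc
    simp only [sub_sub_sub_cancel_right] at hlin
    rw [← kernelSum_smul_hessEst hDz] at hlin
    rw [hR]
    simp only [signSum]
    rw [← smul_sub, norm_smul, Real.norm_of_nonneg (by positivity), mul_assoc]
    refine mul_le_mul_of_nonneg_left (hlin.trans ?_) (by positivity)
    have hL0 : 0 ≤ kernelSum K x h X Y (fun y => (‖y - μ‖ ^ 2)⁻¹) z :=
      Finset.sum_nonneg fun i _ => smul_nonneg (ha i) (by positivity)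
    change 10 * ‖μn z.1 z.2 - μ‖ ^ 2 * kernelSum K x h X Y (fun y => (‖y - μ‖ ^ 2)⁻¹) z ≤ _
    gcongr
    exact hz.1.le
  have h1 : Tendsto (fun z => ‖A z - T‖ • signSum P K x h X Y μ z) (inProb P) (𝓝 0) := by
    refine tendsto_inProb_smul_of_tight ?_ S.tight_signSum
    have := (hAlim.sub_const T).norm
    rwa [sub_self, norm_zero] at this
  have h2 : Tendsto (fun z => (A z - T) (signSum P K x h X Y μ z)) (inProb P) (𝓝 0) := by
    have h1' := h1.norm
    rw [norm_zero] at h1'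
    refine squeeze_zero_norm (fun z => ?_) h1'
    rw [norm_smul, norm_norm]
    exact (A z - T).le_opNorm _
  have h3 : Tendsto (fun z => A z (R z)) (inProb P) (𝓝 0) := by
    have := ((isBoundedBilinearMap_apply (𝕜 := ℝ) (E := Vec d) (F := Vec d)).continuous.tendsto
      (T, (0 : Vec d))).comp (hAlim.prodMk_nhds hRlim)
    simpa using! this
  have h4 := h2.add h3
  rw [add_zero] at h4
  refine h4.congr' ?_
  filter_upwards [hDpos, (hqlim.eventually_gt_atTop 0).inProb,
    hS2lim.eventually_const_lt (u := 0) one_pos] with z hDz hqz hSz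
  have hp : pluginStat K x (h z.1) (fun i => X i z.2) (fun i => Y i z.2) z.1 μ (μn z.1 z.2)
      = A z ((√(q z.1))⁻¹ • G z) := by
    have hS2z : 0 < S2 z := pos_of_mul_pos_right hSz (inv_pos.2 hqz).le
    have e1 : ∑ i ∈ Finset.range z.1, K (dist x (X i z.2) / h z.1) = D z := by
      simp [hD, kernelSum, kernelWeight]
    rw [pluginStat, kernelConstEst_normalization S.kernel x (S.pos _), e1, hA, hG]
    simp only [map_smul, smul_apply, map_mul, mul_apply_eq_comp, smul_smul]
    congr 1
    rw [Real.sqrt_mul (inv_nonneg.2 hqz.le), Real.sqrt_inv, mul_inv, inv_inv]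
    have := Real.sqrt_pos.2 hqz
    have := Real.sqrt_pos.2 hS2z
    change D z / √(S2 z) = _
    field_simp
  rw [hp, hR]
  simp only [map_sub, sub_apply]
  abel

/-- Asymptotic normality of the plug-in statistic. -/
theorem tendstoInDistribution_pluginStat (S : MedianSample P X Y κ x μ K h β)
    {μn : ℕ → Ω → Vec d} (hm : ∀ n, AEMeasurable (μn n) P) (hμn : ∀ n, ∀ᵐ ω ∂P,
      IsMinOn (objectiveEst K x (h n) (fun i => X i ω) (fun i => Y i ω) n) univ (μn n ω)) :
    TendstoInDistribution
      (fun (n : ℕ) ω => pluginStat K x (h n) (fun i => X i ω) (fun i => Y i ω) n μ (μn n ω))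
      atTop id (fun _ => P) (stdGaussian (Vec d)) :=
  tendstoInDistribution_of_tendstoInMeasure_sub _ _ S.tendstoInDistribution_signSum
    (tendstoInMeasure_of_tendsto_inProb (S.tendsto_pluginStat_sub hμn))
    fun n => S.aemeasurable_pluginStat n (hm n)

end MedianSample
end Plugin

/-! ### The chi-squared limit -/

/-- With the other coordinates fixed, the first one is confined to at most two values, which a
Gaussian avoids; Fubini concludes. The absence of atoms lets the distribution function converge at
the quantile. -/
lemma chiSquaredLaw_singleton {d : ℕ} (hd : 0 < d) (q : ℝ) : chiSquaredLaw d {q} = 0 := by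
  obtain ⟨k, rfl⟩ : ∃ k, d = k + 1 := ⟨d - 1, by omega⟩
  rw [chiSquaredLaw, Measure.map_apply (by fun_prop) (measurableSet_singleton q),
    ← map_pi_eq_stdGaussian, Measure.map_apply (by fun_prop) (by measurability)]
  set B : Set (ℝ × (Fin k → ℝ)) := {p | p.1 ^ 2 + ∑ j, p.2 j ^ 2 = q}
  have hB : MeasurableSet B := measurableSet_eq_fun (by fun_prop) (by fun_prop)
  have e := measurePreserving_piFinSuccAbove (fun _ : Fin (k + 1) => gaussianReal 0 1) 0
  have hset : WithLp.toLp 2 ⁻¹' ((fun z : Vec (k + 1) => ‖z‖ ^ 2) ⁻¹' {q})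
      = MeasurableEquiv.piFinSuccAbove (fun _ : Fin (k + 1) => ℝ) 0 ⁻¹' B := by
    ext y
    simp [B, EuclideanSpace.norm_sq_eq, Fin.sum_univ_succ, Fin.tail]
  have := nullSingletonClass_gaussianReal (μ := 0) one_ne_zero
  rw [hset, e.measure_preimage hB.nullMeasurableSet, Measure.prod_apply_symm hB]
  refine (lintegral_congr fun y => ?_).trans lintegral_zero
  refine Set.Finite.measure_zero (Set.Finite.subset
    (Set.toFinite {√(q - ∑ j, y j ^ 2), -√(q - ∑ j, y j ^ 2)}) fun t ht => ?_) _
  have h1 : t ^ 2 + ∑ j, y j ^ 2 = q := ht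
  have h2 : √(q - ∑ j, y j ^ 2) = |t| := by
    rw [← h1, add_sub_cancel_right, Real.sqrt_sq_eq_abs]
  rw [h2]
  rcases abs_choice t with h | h <;> simp [h]

lemma tendstoInDistribution_norm_sq {Ω : Type*} [MeasurableSpace Ω] {P : Measure Ω}
    [IsProbabilityMeasure P] {d : ℕ} {T : ℕ → Ω → Vec d}
    (hT : TendstoInDistribution T atTop id (fun _ => P) (stdGaussian (Vec d))) :
    TendstoInDistribution (fun n ω => ‖T n ω‖ ^ 2) atTop id (fun _ => P) (chiSquaredLaw d) := by
  have h := hT.continuous_comp (g := fun z : Vec d => ‖z‖ ^ 2) (by fun_prop)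
  refine ⟨h.forall_aemeasurable, aemeasurable_id, ?_⟩
  have e : (⟨(chiSquaredLaw d).map id, Measure.isProbabilityMeasure_map aemeasurable_id⟩ :
      ProbabilityMeasure ℝ) = ⟨(stdGaussian (Vec d)).map ((fun z => ‖z‖ ^ 2) ∘ id),
        Measure.isProbabilityMeasure_map h.aemeasurable_limit⟩ :=
    Subtype.ext Measure.map_id
  rw [e]
  exact h.tendsto

lemma tendsto_measureReal_le {Ω : Type*} [MeasurableSpace Ω] {P : Measure Ω}
    [IsProbabilityMeasure P] {T : ℕ → Ω → ℝ} {m : Measure ℝ} [IsProbabilityMeasure m]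
    (hT : TendstoInDistribution T atTop id (fun _ => P) m) {q : ℝ} (hq : m {q} = 0) :
    Tendsto (fun n => P.real {ω | T n ω ≤ q}) atTop (𝓝 (m.real (Iic q))) := by
  have h := ProbabilityMeasure.tendsto_measure_of_null_frontier_of_tendsto' hT.tendsto
    (E := Iic q) (by simpa [frontier_Iic] using hq)
  simp only [ProbabilityMeasure.coe_mk, Measure.map_id] at h
  refine (((ENNReal.tendsto_toReal (measure_ne_top m _)).comp h).congr fun n => ?_)
  rw [Function.comp_apply, Measure.map_apply_of_aemeasurable (hT.forall_aemeasurable n)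
    measurableSet_Iic]
  rfl

/-- The small ball expansion gives F_x(h) ≤ (g(x) + 1) φ(h) eventually, so the bandwidth condition
passes from φ to F_x. -/
lemma tendsto_sqrt_smallBall_mul {F : Type*} {K Fx : ℝ → ℝ} {g : F → ℝ} {x : F} {φ τ₀ : ℝ → ℝ}
    (hball : SmallBallAssumption K Fx g x φ τ₀) {h : ℕ → ℝ} (hpos : ∀ n, 0 < h n)
    (hlim : Tendsto h atTop (𝓝 0))
    (hband : Tendsto (fun n : ℕ => √(n * φ (h n)) * h n) atTop (𝓝 0)) :
    Tendsto (fun n : ℕ => √(n * Fx (h n)) * h n) atTop (𝓝 0) := by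
  have h0 : Tendsto h atTop (𝓝[>] 0) :=
    tendsto_nhdsWithin_iff.2 ⟨hlim, .of_forall hpos⟩
  have h1 := hband.const_mul √(g x + 1)
  rw [mul_zero] at h1
  refine squeeze_zero' (.of_forall fun n => mul_nonneg (Real.sqrt_nonneg _) (hpos n).le) ?_ h1
  filter_upwards [h0.eventually (hball.smallBall_eq.def one_pos)] with n hn
  have hφ := hball.phi_nonneg (h n)
  have hg := hball.g_nonneg x
  rw [Real.norm_of_nonneg hφ, one_mul] at hn
  have h2 := (le_abs_self _).trans hn
  rw [← mul_assoc, ← Real.sqrt_mul (by positivity)]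
  refine mul_le_mul_of_nonneg_right (Real.sqrt_le_sqrt ?_) (hpos n).le
  calc n * Fx (h n) ≤ n * ((g x + 1) * φ (h n)) := by gcongr; linarith
    _ = _ := by ring

theorem corollary3p6
    {Ω 𝓕 : Type*} [MeasurableSpace Ω] [PseudoMetricSpace 𝓕] [MeasurableSpace 𝓕]
    (P : Measure Ω) [IsProbabilityMeasure P]
    (d : ℕ) (hd : 2 ≤ d)
    -- the point `x`; the semi-metric is measurable around it
    (x : 𝓕) (hx : Measurable fun x' : 𝓕 => dist x x')
    -- the i.i.d. sample
    (X : ℕ → Ω → 𝓕) (Y : ℕ → Ω → Vec d)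
    (hX : ∀ i, Measurable (X i)) (hY : ∀ i, Measurable (Y i))
    (hindep : iIndepFun (fun i ω => (X i ω, Y i ω)) P)
    (hident : ∀ i, IdentDistrib (fun ω => (X i ω, Y i ω)) (fun ω => (X 0 ω, Y 0 ω)) P P)
    (hYint : Integrable (Y 0) P)
    -- the conditional law of `Y` given `X`, and the conditional median at `x`
    (κ : Kernel 𝓕 (Vec d)) [IsMarkovKernel κ] (hκ : HasCondDistrib (Y 0) (X 0) κ P)
    (μ : Vec d) (hμ : IsCondMedian κ x μ)
    (hnondeg : ∀ v : Vec d, v ≠ 0 → ¬ ∀ᵐ y ∂κ x, inner ℝ v (y - μ) = 0)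
    -- kernel, bandwidth and small ball behaviour
    (K : ℝ → ℝ) (h : ℕ → ℝ) (hpos : ∀ n, 0 < h n) (hlim : Tendsto h atTop (𝓝 0))
    (g : 𝓕 → ℝ) (φ τ₀ : ℝ → ℝ) (β : ℝ)
    (hK : KernelAssumption K)
    (hball : SmallBallAssumption K (smallBall P (X 0) x) g x φ τ₀) (hgx : 0 < g x)
    (hsmooth : SmoothnessAssumption κ x μ β)
    (hmoment : MomentAssumption κ x μ)
    (hbias : BiasAssumption P (X 0) (Y 0) x μ)
    (hlog : Tendsto (fun n : ℕ => Real.log n / (n * φ (h n))) atTop (𝓝 0))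
    (hδ : ∃ δ : ℝ, 0 < δ ∧ Tendsto (fun n : ℕ => (n * φ (h n)) ^ (δ / 2)) atTop atTop)
    (hband : Tendsto (fun n : ℕ => √(n * φ (h n)) * h n) atTop (𝓝 0))
    (hnF : Tendsto (fun n : ℕ => n * smallBall P (X 0) x (h n)) atTop atTop)
    (hβF : Tendsto (fun n : ℕ => h n ^ β * √(n * smallBall P (X 0) x (h n))) atTop (𝓝 0))
    -- the estimator: a measurable minimizer of the kernel estimate of the objective function
    (μn : ℕ → Ω → Vec d) (hμn_meas : ∀ n, AEMeasurable (μn n) P)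
    (hμn : ∀ n, ∀ᵐ ω ∂P,
      IsMinOn (objectiveEst K x (h n) (fun i => X i ω) (fun i => Y i ω) n) univ (μn n ω)) :
    -- asymptotic normality of the plug-in normalized error
    TendstoInDistribution
      (fun (n : ℕ) ω => pluginStat K x (h n) (fun i => X i ω) (fun i => Y i ω) n μ (μn n ω))
      atTop id (fun _ => P) (stdGaussian (Vec d)) ∧
    -- the quadratic form is asymptotically chi-squared
    TendstoInDistribution
      (fun (n : ℕ) ω => ellipsoidStat K x (h n) (fun i => X i ω) (fun i => Y i ω) n μ (μn n ω))
      atTop id (fun _ => P) (chiSquaredLaw d) ∧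
    -- asymptotic coverage of the confidence ellipsoid
    ∀ α ∈ Ioo (0 : ℝ) 1, ∀ q : ℝ, (chiSquaredLaw d).real (Iic q) = 1 - α →
      Tendsto (fun n : ℕ => P.real
        {ω | ellipsoidStat K x (h n) (fun i => X i ω) (fun i => Y i ω) n μ (μn n ω) ≤ q})
        atTop (𝓝 (1 - α)) := by
  have S : MedianSample P X Y κ x μ K h β :=
    ⟨hd, hx, hX, hY, hindep, hident, hκ, hμ, hnondeg, hpos, hlim, hK, hsmooth, hmoment, hbias, hnF,
      tendsto_sqrt_smallBall_mul hball hpos hlim hband⟩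
  have hN := S.tendstoInDistribution_pluginStat hμn_meas hμn
  have hE : TendstoInDistribution
      (fun (n : ℕ) ω => ellipsoidStat K x (h n) (fun i => X i ω) (fun i => Y i ω) n μ (μn n ω))
      atTop id (fun _ => P) (chiSquaredLaw d) := by
    simp only [ellipsoidStat_eq hK x (hpos _)]
    exact tendstoInDistribution_norm_sq hN
  refine ⟨hN, hE, fun α _ q hq => ?_⟩
  have := tendsto_measureReal_le hE (chiSquaredLaw_singleton (by omega) q)
  rwa [hq] at this
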